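/- Let $f:\mathbb R\to\mathbb R$ be $C^\infty$, $c\in\mathbb R$, and let $u(x-ct)$ be a travelling wave of $u_t=u_{xx}+f(u)$, i.e. $u\in C^2(\mathbb R)$, $u''+cu'+f(u)=0$ and $u(\xi)\to u_\pm$ as $\xi\to\pm\infty$. Put $\phi(\xi)=f'(u(\xi))$ and assume that $\phi$ tends to its limits $f'(u_\pm)$ exponentially fast as $\xi\to\pm\infty$. For $\lambda\in\mathbb C$ let $$A(\xi;\lambda)=\begin{bmatrix}0&1\\ \lambda-\phi(\xi)&-c\end{bmatrix},\qquad \kappa_\pm=\sqrt{c^2+4(\lambda-f'(u_\pm))},\qquad \mu_-=\tfrac12(-c+\kappa_-),\quad \mu_+=\tfrac12(-c-\kappa_+)$$ (principal square roots). Let $y_-$ be the solution of $y'=A(\xi;\lambda)y$ on $(-\infty,0]$ with $y_-(\xi)\sim e^{\mu_-\xi}(1,\mu_-)^\top$ as $\xi\to-\infty$, and $y_+$ the solution on $[0,\infty)$ with $y_+(\xi)\sim e^{\mu_+\xi}(1,\mu_+)^\top$ as $\xi\to\infty$. The Evans function is $D(\lambda)=\det[\,y_-(0)\mid y_+(0)\,]$.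 One step of (signed) size $s$ of the fourth-order Magnus method, from $\xi$ to $\xi+s$, multiplies by $$\exp\Bigl(\tfrac12 s\,(A_1+A_2)-\tfrac{\sqrt3}{12}s^2(A_1A_2-A_2A_1)\Bigr),\qquad A_{1,2}=A\bigl(\xi+(\tfrac12\mp\tfrac{\sqrt3}6)s;\lambda\bigr).$$ Given $h>0$ and $N\in\mathbb N$, put $L=Nh$. Let $y^-_N$ be the result of $N$ steps of size $h$ from the exact value $y_-(-L)$ at $-L$, let $y^+_N$ be the result of $N$ steps of size $-h$ from the exact value $y_+(L)$ at $L$, and put $D_{\rm num}(\lambda)=\det[\,y_N^-\mid y_N^+\,]$ and $E_D=D_{\rm num}(\lambda)-D(\lambda)$. Then $\int_{-\infty}^\infty\phi'(x)^2\,dx<\infty$, and there is $b>0$, depending only on $f,c,u$, such that the following hold. 1. (The Gauss quadrature error is negligible for large $L$.) For every $h_0>0$ there is $C$ such that for all $0<h\le h_0$ and all $N$, $$\Bigl|\tfrac12h\sum_{j=-N}^{N-1}\Bigl(\phi\bigl(jh+(\tfrac12-\tfrac{\sqrt3}6)h\bigr)+\phi\bigl(jh+(\tfrac12+\tfrac{\sqrt3}6)h\bigr)\Bigr)-\int_{-L}^{L}\phi(x)\,dx\Bigr|\le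 C\,(h^6+h^4e^{-bL}).$$ 2. (The error in the Evans function.) For all $\varepsilon,h_0>0$ there are $C$ and $M>0$ such that for all $0<h\le h_0$, all $N$, and all $\lambda$ with $|\lambda|^{1/2}h\ge M$ and $|\arg\kappa_\pm|<\frac\pi2-\varepsilon$, $$\Bigl|E_D+\tfrac1{144}h^4\int_{-\infty}^{\infty}\phi'(x)^2\,dx\Bigr|\le C\bigl(|\lambda|^{-1/2}h^2+h^6+h^4e^{-bL}\bigr).$$ So for large $L$ (namely $L\ge \frac2b\log\frac1h$) one has $E_D=-\tfrac1{144}h^4\int_{-\infty}^\infty(\phi')^2\,dx+O(|\lambda|^{-1/2}h^2,\,h^6)$. 3. (The error does not decay as $|\lambda|\to\infty$.) If $\phi'\not\equiv0$, there is $\delta>0$ such that for every $\varepsilon>0$ there are $h_1>0$ and $L_1$ such that for every $0<h\le h_1$ there is $R$ with $|E_D|\ge\delta h^4$ for all $N$ with $Nh\ge L_1$ and all $\lambda$ with $|\lambda|\ge R$ and $|\arg\kappa_\pm|<\frac\pi2-\varepsilon$. -/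

import Mathlib

open Filter Topology
open scoped ContDiff Matrix

noncomputable section

namespace EvansMagnus

/-- `u` is the profile of a travelling wave `u(x - ct)` of `u_t = u_xx + f(u)`, with limits
`um` at `-∞` and `up` at `+∞`: it satisfies `u'' + c u' + f(u) = 0`. -/
structure IsTravellingWave (f : ℝ → ℝ) (c : ℝ) (u : ℝ → ℝ) (um up : ℝ) : Prop where
  contDiff : ContDiff ℝ 2 u
  profile : ∀ ξ, deriv (deriv u) ξ + c * deriv u ξ + f (u ξ) = 0
  tendsto_left : Tendsto u atBot (𝓝 um)
  tendsto_right : Tendsto u atTop (𝓝 up)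

/-- The function `φ(ξ) = f'(u(ξ))`. -/
def phi (f u : ℝ → ℝ) (ξ : ℝ) : ℝ := deriv f (u ξ)

/-- `φ` approaches its limits `f'(um)` and `f'(up)` exponentially fast. -/
def HasExponentialTails (f u : ℝ → ℝ) (um up : ℝ) : Prop :=
  ∃ K a : ℝ, 0 < a ∧
    (∀ ξ ≤ 0, |phi f u ξ - deriv f um| ≤ K * Real.exp (a * ξ)) ∧
    (∀ ξ ≥ 0, |phi f u ξ - deriv f up| ≤ K * Real.exp (-a * ξ))

/-- The coefficient matrix `A(ξ; λ)` of the eigenvalue problem `y' = A(ξ; λ) y`. -/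
def coeff (f : ℝ → ℝ) (c : ℝ) (u : ℝ → ℝ) (lam : ℂ) (ξ : ℝ) : Matrix (Fin 2) (Fin 2) ℂ :=
  !![0, 1; lam - ((phi f u ξ : ℝ) : ℂ), -(c : ℂ)]

/-- `κ = √(c² + 4(λ - f'(u∞)))` (principal branch), for a limit `uinf` of the wave. -/
def kappa (f : ℝ → ℝ) (c uinf : ℝ) (lam : ℂ) : ℂ :=
  Complex.sqrt ((c : ℂ) ^ 2 + 4 * (lam - ((deriv f uinf : ℝ) : ℂ)))

/-- The eigenvalue `(-c + κ)/2` of the limit of `A` at an end state `uinf`. -/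
def muPlus (f : ℝ → ℝ) (c uinf : ℝ) (lam : ℂ) : ℂ := (-(c : ℂ) + kappa f c uinf lam) / 2

/-- The eigenvalue `(-c - κ)/2` of the limit of `A` at an end state `uinf`. -/
def muMinus (f : ℝ → ℝ) (c uinf : ℝ) (lam : ℂ) : ℂ := (-(c : ℂ) - kappa f c uinf lam) / 2

/-- `y` solves `y' = A(ξ; λ) y` on `(-∞, 0]` and `y(ξ) ∼ exp(μ ξ) (1, μ)` as `ξ → -∞`, where
`μ = (-c + κ₋)/2`. Only the half-line `(-∞, 0]` matters for the Evans function. -/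
def IsLeftSolution (f : ℝ → ℝ) (c : ℝ) (u : ℝ → ℝ) (um : ℝ) (lam : ℂ)
    (y : ℝ → Fin 2 → ℂ) : Prop :=
  (∀ ξ ∈ Set.Iic (0 : ℝ),
    HasDerivWithinAt y (coeff f c u lam ξ *ᵥ y ξ) (Set.Iic 0) ξ) ∧
  Tendsto (fun ξ : ℝ => Complex.exp (-(muPlus f c um lam) * (ξ : ℂ)) • y ξ) atBot
    (𝓝 ![1, muPlus f c um lam])

/-- `y` solves `y' = A(ξ; λ) y` on `[0, ∞)` and `y(ξ) ∼ exp(μ ξ) (1, μ)` as `ξ → ∞`, where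
`μ = (-c - κ₊)/2`. -/
def IsRightSolution (f : ℝ → ℝ) (c : ℝ) (u : ℝ → ℝ) (up : ℝ) (lam : ℂ)
    (y : ℝ → Fin 2 → ℂ) : Prop :=
  (∀ ξ ∈ Set.Ici (0 : ℝ),
    HasDerivWithinAt y (coeff f c u lam ξ *ᵥ y ξ) (Set.Ici 0) ξ) ∧
  Tendsto (fun ξ : ℝ => Complex.exp (-(muMinus f c up lam) * (ξ : ℂ)) • y ξ) atTop
    (𝓝 ![1, muMinus f c up lam])

/-- The solution `y₋` (an arbitrary function if there is none). -/
def leftSolution (f : ℝ → ℝ) (c : ℝ) (u : ℝ → ℝ) (um : ℝ) (lam : ℂ) : ℝ → Fin 2 → ℂ :=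
  Classical.epsilon (IsLeftSolution f c u um lam)

/-- The solution `y₊` (an arbitrary function if there is none). -/
def rightSolution (f : ℝ → ℝ) (c : ℝ) (u : ℝ → ℝ) (up : ℝ) (lam : ℂ) : ℝ → Fin 2 → ℂ :=
  Classical.epsilon (IsRightSolution f c u up lam)

/-- `det [a | b]`. -/
def wedge (a b : Fin 2 → ℂ) : ℂ := Matrix.det !![a 0, b 0; a 1, b 1]

/-- The Evans function `D(λ) = det [y₋(0) | y₊(0)]`. -/
def evans (f : ℝ → ℝ) (c : ℝ) (u : ℝ → ℝ) (um up : ℝ) (lam : ℂ) : ℂ :=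
  wedge (leftSolution f c u um lam 0) (rightSolution f c u up lam 0)

/-- The first Gauss–Legendre point of the step from `ξ` to `ξ + s`
(`s < 0` for a backward step). -/
def gauss₁ (ξ s : ℝ) : ℝ := ξ + (1 / 2 - √3 / 6) * s

/-- The second Gauss–Legendre point of the step from `ξ` to `ξ + s`. -/
def gauss₂ (ξ s : ℝ) : ℝ := ξ + (1 / 2 + √3 / 6) * s

/-- The propagator of the fourth-order Magnus method for `y' = A(ξ) y` over the step from `ξ`
to `ξ + s`. -/
def magnusStep (A : ℝ → Matrix (Fin 2) (Fin 2) ℂ) (ξ s : ℝ) : Matrix (Fin 2) (Fin 2) ℂ :=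
  NormedSpace.exp
    ((s / 2) • (A (gauss₁ ξ s) + A (gauss₂ ξ s)) -
      (√3 / 12 * s ^ 2) •
        (A (gauss₁ ξ s) * A (gauss₂ ξ s) - A (gauss₂ ξ s) * A (gauss₁ ξ s)))

/-- The result of `k` steps of (signed) size `s` of the fourth-order Magnus method, started at
`ξ₀` from the value `y₀`. -/
def magnus (A : ℝ → Matrix (Fin 2) (Fin 2) ℂ) (ξ₀ s : ℝ) (y₀ : Fin 2 → ℂ) :
    ℕ → Fin 2 → ℂ
  | 0 => y₀
  | k + 1 => magnusStep A (ξ₀ + k * s) s *ᵥ magnus A ξ₀ s y₀ k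

/-- The numerical Evans function: `N` forward steps of size `h` from `-L` to `0`, and `N`
backward steps from `L` to `0`, where `L = N h`, starting from the exact values `y₋(-L)` and
`y₊(L)`. -/
def evansNum (f : ℝ → ℝ) (c : ℝ) (u : ℝ → ℝ) (um up : ℝ) (h : ℝ) (N : ℕ) (lam : ℂ) : ℂ :=
  wedge
    (magnus (coeff f c u lam) (-(N * h)) h (leftSolution f c u um lam (-(N * h))) N)
    (magnus (coeff f c u lam) (N * h) (-h) (rightSolution f c u up lam (N * h)) N)

/-- The error in the Evans function, numerical value minus exact value. -/
def evansError (f : ℝ → ℝ) (c : ℝ) (u : ℝ → ℝ) (um up : ℝ) (h : ℝ) (N : ℕ) (lam : ℂ) : ℂ :=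
  evansNum f c u um up h N lam - evans f c u um up lam

/-- The error of the composite two-point Gauss–Legendre quadrature on `[-L, L]`, `L = N h`. -/
def gaussError (g : ℝ → ℝ) (h : ℝ) (N : ℕ) : ℝ :=
  h / 2 * ∑ j ∈ Finset.Ico (-(N : ℤ)) (N : ℤ), (g (gauss₁ (j * h) h) + g (gauss₂ (j * h) h)) -
    ∫ x in (-(N * h))..(N * h), g x

/-- Both `κ₋` and `κ₊` lie in the sector `|arg κ| < π/2 - ε`. -/
def InSector (f : ℝ → ℝ) (c um up ε : ℝ) (lam : ℂ) : Prop :=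
  |(kappa f c um lam).arg| < Real.pi / 2 - ε ∧ |(kappa f c up lam).arg| < Real.pi / 2 - ε

end EvansMagnus

end

/-! Fix one end state, put `q = κ/2` and `φ = φinf + g`, where `g` decays exponentially at that end.
In the eigenbasis of the limit matrix, and after removal of `exp(μ ξ)`, the exact solution has
coordinates `(a, b)`: `a` varies slowly and `b` is slaved to it, `b ≈ g a/(4q²)`. Inserting this in
the equation for `a` gives a WKB law: over `[-L, 0]`, `a` is multiplied by `exp(-∫g/(2q) -
∫g²/(8q³))`, up to `O(|q|⁻⁴)` (`IsScaledSolution.norm_growth_sub_le`).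

A Magnus step can be diagonalised exactly (`magnusStep_mulVec`). Apart from the trace, its exponent
has eigenvalues `±h w` with `w² = q² - m + d²`, where `m` is the mean of `g` over the Gauss points
and `d ≈ h² g'/12` comes from the commutator. Expanding the root, the numerical growth exponent is
`Σh(-m/(2q) + d²/(2q) - m²/(8q³))`. The terms in `m` reproduce the exact law up to quadrature
errors; the commutator leaves the surplus `h⁴/(288q) ∫(g')²`. When `|q|h` is large, the second
eigenvector of each step is strongly damped, so the ratio of the coordinates stays within
`O(h²/|q|)` of `g/(4q²)`, and the corrections for the change of eigenvectors from step to step sum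
to `O(h²/|q|²)` (`norm_prod_defect_sub_one_le`). This gives the half-line result
`ExpDecay.half_line`; reflection transfers it to `[0, ∞)`.

The determinant of the two solutions is close to `-(κ₋ + κ₊)/2`, of size `2|q|`. It therefore turns
coordinate errors of size `1/|q|` into an absolute error that does not depend on `λ`
(`norm_wedge_error_le`): `-h⁴/144 ∫(φ')²` plus the quadrature error for `∫φ`. On each half-line the
latter has a boundary term in `h⁴ φ'''(0)/4320`; the two have opposite signs and cancel
(`exists_abs_gaussError_le`).

The decay of the derivatives of `φ` is not assumed. It follows from the decay of `φ` by
interpolation, because the profile equation bounds all derivatives of the wave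
(`IsTravellingWave.exists_expDecay`). -/

namespace EvansMagnus

/-! ### A priori bounds for the exact solution in scaled coordinates. -/

open Set

/-- `g` is smooth, and its derivatives up to order six are bounded by `K exp(b ξ)` on
`(-∞, 0]`. -/
structure ExpDecay (g : ℝ → ℝ) (K b : ℝ) : Prop where
  contDiff : ContDiff ℝ ∞ g
  rate_pos : 0 < b
  one_le : 1 ≤ K
  bound : ∀ k ≤ 6, ∀ ξ ≤ 0, |iteratedDeriv k g ξ| ≤ K * Real.exp (b * ξ)

/-- The coordinates of a solution of `y' = A(ξ; λ) y` in the eigenbasis of the limit of `A` at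
`-∞`, scaled by `exp(-μ ξ)`. -/
structure IsScaledSolution (g : ℝ → ℝ) (q : ℂ) (a b : ℝ → ℂ) : Prop where
  hasDeriv_fst : ∀ ξ ≤ 0,
    HasDerivWithinAt a (-((g ξ : ℂ) / (2 * q)) * (a ξ + b ξ)) (Iic 0) ξ
  hasDeriv_snd : ∀ ξ ≤ 0,
    HasDerivWithinAt b (-2 * q * b ξ + (g ξ : ℂ) / (2 * q) * (a ξ + b ξ)) (Iic 0) ξ
  tendsto_fst : Tendsto a atBot (𝓝 1)
  tendsto_snd : Tendsto b atBot (𝓝 0)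

lemma norm_sub_le_of_deriv_le_exp {F F' : ℝ → ℂ} {C k : ℝ} (hk : 0 < k)
    (hF : ∀ x ≤ 0, HasDerivWithinAt F (F' x) (Iic 0) x)
    (hb : ∀ x ≤ 0, ‖F' x‖ ≤ C * Real.exp (k * x)) {x y : ℝ} (hyx : y ≤ x) (hx : x ≤ 0) :
    ‖F x - F y‖ ≤ C / k * (Real.exp (k * x) - Real.exp (k * y)) := by
  have hB : ∀ t : ℝ, HasDerivAt (fun t => C / k * (Real.exp (k * t) - Real.exp (k * y)))
      (C * Real.exp (k * t)) t := by
    intro t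
    have h1 : HasDerivAt (fun t => Real.exp (k * t)) (Real.exp (k * t) * k) t := by
      simpa using ((hasDerivAt_id t).const_mul k).exp
    refine ((h1.sub_const (Real.exp (k * y))).const_mul (C / k)).congr_deriv ?_
    field_simp
  refine image_norm_le_of_norm_deriv_right_le_deriv_boundary (f := fun t => F t - F y)
    (f' := F') (a := y) (b := x) ?_ ?_ ?_ hB ?_ (right_mem_Icc.2 hyx)
  · refine ContinuousOn.sub (fun t ht => ?_) continuousOn_const
    exact ((hF t (ht.2.trans hx)).continuousWithinAt).mono (fun s hs => hs.2.trans hx)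
  · intro t ht
    have ht0 : t < 0 := ht.2.trans_le hx
    exact (((hF t ht0.le).hasDerivAt (Iic_mem_nhds ht0)).sub_const _).hasDerivWithinAt
  · simp
  · intro t ht
    exact hb t (ht.2.le.trans hx)

lemma nonneg_of_norm_le_mul_exp {z : ℂ} {C s : ℝ} (h : ‖z‖ ≤ C * Real.exp s) : 0 ≤ C :=
  nonneg_of_mul_nonneg_left ((norm_nonneg _).trans h) (Real.exp_pos _)

lemma norm_sub_le_of_deriv_le_exp' {F F' : ℝ → ℂ} {C k : ℝ} (hk : 0 < k)
    (hF : ∀ x ≤ 0, HasDerivWithinAt F (F' x) (Iic 0) x)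
    (hb : ∀ x ≤ 0, ‖F' x‖ ≤ C * Real.exp (k * x)) {x y : ℝ} (hy : y ≤ 0) (hx : x ≤ 0) :
    ‖F x - F y‖ ≤ C / k := by
  have hC : 0 ≤ C := nonneg_of_norm_le_mul_exp (hb 0 le_rfl)
  wlog hyx : y ≤ x generalizing x y
  · rw [norm_sub_rev]
    exact this hx hy (le_of_not_ge hyx)
  refine (norm_sub_le_of_deriv_le_exp hk hF hb hyx hx).trans ?_
  refine mul_le_of_le_one_right (by positivity) ?_
  have : Real.exp (k * x) ≤ 1 := Real.exp_le_one_iff.2 (mul_nonpos_of_nonneg_of_nonpos hk.le hx)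
  linarith [Real.exp_pos (k * y)]

lemma norm_sub_lim_le_of_deriv_le_exp {F F' : ℝ → ℂ} {C k : ℝ} {l : ℂ} (hk : 0 < k)
    (hF : ∀ x ≤ 0, HasDerivWithinAt F (F' x) (Iic 0) x)
    (hb : ∀ x ≤ 0, ‖F' x‖ ≤ C * Real.exp (k * x)) (hl : Tendsto F atBot (𝓝 l))
    {x : ℝ} (hx : x ≤ 0) : ‖F x - l‖ ≤ C / k * Real.exp (k * x) := by
  have hC : 0 ≤ C := nonneg_of_norm_le_mul_exp (hb 0 le_rfl)
  refine le_of_tendsto ((tendsto_const_nhds.sub hl).norm) ?_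
  filter_upwards [eventually_le_atBot x] with y hy
  refine (norm_sub_le_of_deriv_le_exp hk hF hb hy hx).trans ?_
  gcongr
  linarith [Real.exp_pos (k * y)]

/-- The integrating factor `exp(2qx)` removes the damping, and the limit at `-∞` excludes the
homogeneous solution `exp(-2qx)`. The gain `1/(2 Re q)` yields the extra power of `1/|q|` in the
bounds for `b` and for its deviation from `g a/(4q²)`. -/
lemma norm_le_of_damped {v f : ℝ → ℂ} {q : ℂ} {C k : ℝ} (hk : 0 < k) (hq : 0 < q.re)
    (hv : ∀ x ≤ 0, HasDerivWithinAt v (-2 * q * v x + f x) (Iic 0) x)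
    (hf : ∀ x ≤ 0, ‖f x‖ ≤ C * Real.exp (k * x)) (hl : Tendsto v atBot (𝓝 0))
    {x : ℝ} (hx : x ≤ 0) : ‖v x‖ ≤ C / (2 * q.re) * Real.exp (k * x) := by
  have hC : 0 ≤ C := nonneg_of_norm_le_mul_exp (hf 0 le_rfl)
  have hexp : ∀ x : ℝ, ‖Complex.exp (2 * q * x)‖ = Real.exp (2 * q.re * x) := by
    intro x
    rw [Complex.norm_exp]; simp
  have h1 : ∀ x : ℝ, x ≤ 0 → HasDerivWithinAt (fun x : ℝ => Complex.exp (2 * q * x) * v x)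
      (Complex.exp (2 * q * x) * f x) (Iic 0) x := by
    intro x hx
    have h2 : HasDerivAt (fun x : ℝ => Complex.exp (2 * q * x))
        (Complex.exp (2 * q * x) * (2 * q)) x := by
      have := ((Complex.ofRealCLM.hasDerivAt (x := x)).const_mul (2 * q)).cexp
      simpa using this
    refine (h2.hasDerivWithinAt.mul (hv x hx)).congr_deriv ?_
    ring
  have h3 := norm_sub_lim_le_of_deriv_le_exp (C := C) (k := 2 * q.re + k) (l := 0) (by positivity)
    h1 ?_ ?_ hx
  · rw [sub_zero, norm_mul, hexp, add_mul, Real.exp_add] at h3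
    have h4 : ‖v x‖ ≤ C / (2 * q.re + k) * Real.exp (k * x) := by
      have := Real.exp_pos (2 * q.re * x)
      refine le_of_mul_le_mul_left ?_ this
      linarith
    refine h4.trans ?_
    gcongr
    linarith
  · intro x hx
    rw [norm_mul, hexp, add_mul, Real.exp_add]
    nlinarith [hf x hx, Real.exp_pos (2 * q.re * x)]
  · refine squeeze_zero_norm' ?_ (tendsto_zero_iff_norm_tendsto_zero.1 hl)
    filter_upwards [eventually_le_atBot 0] with y hy
    rw [norm_mul, hexp]
    refine mul_le_of_le_one_left (norm_nonneg _) (Real.exp_le_one_iff.2 ?_)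
    exact mul_nonpos_of_nonneg_of_nonpos (by positivity) hy

namespace ExpDecay

variable {g : ℝ → ℝ} {K b : ℝ}

lemma abs_le (hg : ExpDecay g K b) {x : ℝ} (hx : x ≤ 0) : |g x| ≤ K * Real.exp (b * x) := by
  simpa using hg.bound 0 (by norm_num) x hx

lemma abs_deriv_le (hg : ExpDecay g K b) {x : ℝ} (hx : x ≤ 0) :
    |deriv g x| ≤ K * Real.exp (b * x) := by
  simpa using hg.bound 1 (by norm_num) x hx

lemma exp_le_one (hg : ExpDecay g K b) {x : ℝ} (hx : x ≤ 0) : Real.exp (b * x) ≤ 1 :=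
  Real.exp_le_one_iff.2 (mul_nonpos_of_nonneg_of_nonpos hg.rate_pos.le hx)

lemma pos (hg : ExpDecay g K b) : 0 < K := zero_lt_one.trans_le hg.one_le

lemma continuous (hg : ExpDecay g K b) : Continuous g := hg.contDiff.continuous

lemma hasDerivAt (hg : ExpDecay g K b) (x : ℝ) : HasDerivAt g (deriv g x) x :=
  (hg.contDiff.differentiable (by simp)).differentiableAt.hasDerivAt

lemma norm_le (hg : ExpDecay g K b) {x : ℝ} (hx : x ≤ 0) :
    ‖(g x : ℂ)‖ ≤ K * Real.exp (b * x) := by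
  rw [Complex.norm_real]; exact hg.abs_le hx

end ExpDecay

namespace IsScaledSolution

variable {g : ℝ → ℝ} {q : ℂ} {a b : ℝ → ℂ} {K β σ : ℝ}

lemma norm_fst_sub_one_le_of_bound (h : IsScaledSolution g q a b) (hg : ExpDecay g K β)
    {S : ℝ} (hS : ∀ x ≤ 0, ‖a x + b x‖ ≤ S) {x : ℝ} (hx : x ≤ 0) :
    ‖a x - 1‖ ≤ K * S / (2 * ‖q‖) / β * Real.exp (β * x) := by
  refine norm_sub_lim_le_of_deriv_le_exp hg.rate_pos h.hasDeriv_fst ?_ h.tendsto_fst hx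
  intro x hx
  rw [norm_mul, norm_neg, norm_div, norm_mul, Complex.norm_ofNat]
  calc ‖(g x : ℂ)‖ / (2 * ‖q‖) * ‖a x + b x‖
      ≤ (K * Real.exp (β * x)) / (2 * ‖q‖) * S := by
        gcongr
        · exact div_nonneg (mul_nonneg hg.pos.le (Real.exp_pos _).le) (by positivity)
        · exact hg.norm_le hx
        · exact hS x hx
    _ = _ := by ring

lemma norm_snd_le_of_bound (h : IsScaledSolution g q a b) (hg : ExpDecay g K β)
    (hq : 0 < q.re) {S : ℝ} (hS : ∀ x ≤ 0, ‖a x + b x‖ ≤ S) {x : ℝ} (hx : x ≤ 0) :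
    ‖b x‖ ≤ K * S / (2 * ‖q‖) / (2 * q.re) * Real.exp (β * x) := by
  refine norm_le_of_damped hg.rate_pos hq h.hasDeriv_snd ?_ h.tendsto_snd hx
  intro x hx
  rw [norm_mul, norm_div, norm_mul, Complex.norm_ofNat]
  calc ‖(g x : ℂ)‖ / (2 * ‖q‖) * ‖a x + b x‖
      ≤ (K * Real.exp (β * x)) / (2 * ‖q‖) * S := by
        gcongr
        · exact div_nonneg (mul_nonneg hg.pos.le (Real.exp_pos _).le) (by positivity)
        · exact hg.norm_le hx
        · exact hS x hx
    _ = _ := by ring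

/-- Purely qualitative: it makes the supremum in `norm_add_le_two` finite. -/
lemma exists_bound (h : IsScaledSolution g q a b) : ∃ S, ∀ x ≤ 0, ‖a x + b x‖ ≤ S := by
  have ht : Tendsto (fun x => a x + b x) atBot (𝓝 (1 + 0)) := h.tendsto_fst.add h.tendsto_snd
  have h1 : ∀ᶠ x in atBot, ‖a x + b x‖ ≤ 2 := by
    exact ht.norm.eventually (ge_mem_nhds (by norm_num))
  obtain ⟨y, hy⟩ := eventually_atBot.1 h1
  have hc : ContinuousOn (fun x => a x + b x) (Icc y 0) := fun x hx =>
    (((h.hasDeriv_fst x hx.2).continuousWithinAt).add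
      ((h.hasDeriv_snd x hx.2).continuousWithinAt)).mono fun s hs => hs.2
  obtain ⟨C, hC⟩ := isCompact_Icc.exists_bound_of_continuousOn hc
  refine ⟨max C 2, fun x hx => ?_⟩
  rcases le_total x y with hxy | hxy
  · exact (hy x hxy).trans (le_max_right _ _)
  · exact (hC x ⟨hxy, hx⟩).trans (le_max_left _ _)

/-- Bootstrap: a bound `S`, put back into both equations, returns `1 + S/2` once `|q|` is large.
Hence the supremum `T` satisfies `T ≤ 1 + T/2`. -/
lemma norm_add_le_two (h : IsScaledSolution g q a b) (hg : ExpDecay g K β)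
    (hσ : 0 < σ) (hq : σ * ‖q‖ ≤ q.re) (hq1 : 1 ≤ ‖q‖) (hq2 : K * (1 / β + 1 / σ) ≤ ‖q‖) :
    ∀ x ≤ 0, ‖a x + b x‖ ≤ 2 := by
  have hβ := hg.rate_pos
  have hK := hg.pos
  have hq0 : 0 < ‖q‖ := by linarith
  have hre : 0 < q.re := lt_of_lt_of_le (by positivity) hq
  have key : ∀ S, (∀ x ≤ 0, ‖a x + b x‖ ≤ S) → ∀ x ≤ 0, ‖a x + b x‖ ≤ 1 + S / 2 := by
    intro S hS x hx
    have hS0 : 0 ≤ S := (norm_nonneg _).trans (hS 0 le_rfl)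
    have h1 := h.norm_fst_sub_one_le_of_bound hg hS hx
    have h2 := h.norm_snd_le_of_bound hg hre hS hx
    have h3 : ‖a x + b x‖ ≤ 1 + ‖a x - 1‖ + ‖b x‖ := by
      have : a x + b x = 1 + (a x - 1) + b x := by ring
      rw [this]
      refine (norm_add_le _ _).trans ?_
      gcongr
      refine (norm_add_le _ _).trans ?_
      simp
    have he := hg.exp_le_one hx
    have h1' : ‖a x - 1‖ ≤ S / (2 * ‖q‖) * (K * (1 / β)) := by
      refine h1.trans ((mul_le_of_le_one_right (by positivity) he).trans (le_of_eq ?_))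
      field_simp
    have h2' : ‖b x‖ ≤ S / (2 * ‖q‖) * (K * (1 / σ)) := by
      refine h2.trans ((mul_le_of_le_one_right (by positivity) he).trans ?_)
      have : K * S / (2 * ‖q‖) / (2 * q.re) ≤ K * S / (2 * ‖q‖) / σ := by
        gcongr
        nlinarith
      refine this.trans (le_of_eq ?_)
      field_simp
    have h4 : S / (2 * ‖q‖) * (K * (1 / β)) + S / (2 * ‖q‖) * (K * (1 / σ)) ≤ S / 2 := by
      calc _ = S / (2 * ‖q‖) * (K * (1 / β + 1 / σ)) := by ring
        _ ≤ S / (2 * ‖q‖) * ‖q‖ := by gcongr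
        _ = S / 2 := by field_simp
    linarith
  obtain ⟨S₀, hS₀⟩ := h.exists_bound
  set T := ⨆ x : Iic (0 : ℝ), ‖a x + b x‖
  have hbdd : BddAbove (range fun x : Iic (0 : ℝ) => ‖a x + b x‖) :=
    ⟨S₀, by rintro _ ⟨x, rfl⟩; exact hS₀ x x.2⟩
  have hT : ∀ x ≤ 0, ‖a x + b x‖ ≤ T := fun x hx => le_ciSup hbdd ⟨x, hx⟩
  have : Nonempty (Iic (0 : ℝ)) := ⟨⟨0, self_mem_Iic⟩⟩
  have hT2 : T ≤ 1 + T / 2 := ciSup_le fun x => key T hT x x.2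
  intro x hx
  linarith [hT x hx]

/-- Bounds for the scaled solution. -/
lemma bounds (h : IsScaledSolution g q a b) (hg : ExpDecay g K β)
    (hσ : 0 < σ) (hq : σ * ‖q‖ ≤ q.re) (hq1 : 1 ≤ ‖q‖) (hq2 : K * (1 / β + 1 / σ) ≤ ‖q‖)
    {x : ℝ} (hx : x ≤ 0) :
    ‖a x - 1‖ ≤ K / β / ‖q‖ * Real.exp (β * x) ∧ ‖a x‖ ≤ 2 ∧
    ‖b x‖ ≤ K / σ / ‖q‖ ^ 2 * Real.exp (β * x) ∧
    ‖b x - g x / (4 * q ^ 2) * a x‖ ≤ K ^ 2 * (1 + 1 / σ) / σ / ‖q‖ ^ 3 * Real.exp (β * x) := by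
  have hβ := hg.rate_pos
  have hK := hg.pos
  have hK1 := hg.one_le
  have hq0 : 0 < ‖q‖ := by linarith
  have hqne : q ≠ 0 := norm_pos_iff.1 hq0
  have hre : 0 < q.re := lt_of_lt_of_le (by positivity) hq
  have hS := h.norm_add_le_two hg hσ hq hq1 hq2
  have A : ∀ x ≤ 0, ‖a x - 1‖ ≤ K / β / ‖q‖ * Real.exp (β * x) := fun x hx => by
    refine (h.norm_fst_sub_one_le_of_bound hg hS hx).trans (le_of_eq ?_)
    field_simp
  have A2 : ∀ x ≤ 0, ‖a x‖ ≤ 2 := fun x hx => by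
    have h1 : ‖a x‖ ≤ ‖a x - 1‖ + 1 := by
      simpa using norm_add_le (a x - 1) 1
    have h2 : K / β / ‖q‖ * Real.exp (β * x) ≤ 1 := by
      refine (mul_le_of_le_one_right (by positivity) (hg.exp_le_one hx)).trans ?_
      rw [div_le_one hq0]
      refine le_trans ?_ hq2
      rw [mul_add, mul_one_div, mul_one_div]
      have : 0 < K / σ := by positivity
      linarith
    linarith [A x hx]
  have B : ∀ x ≤ 0, ‖b x‖ ≤ K / σ / ‖q‖ ^ 2 * Real.exp (β * x) := fun x hx => by
    refine (h.norm_snd_le_of_bound hg hre hS hx).trans ?_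
    refine mul_le_mul_of_nonneg_right ?_ (Real.exp_pos _).le
    rw [div_div, div_div, div_le_div_iff₀ (by positivity) (by positivity)]
    nlinarith [mul_le_mul_of_nonneg_left hq (by positivity : 0 ≤ K * ‖q‖),
      (by positivity : 0 ≤ K * ‖q‖ * q.re)]
  refine ⟨A x hx, A2 x hx, B x hx, ?_⟩
  -- Subtracting the slaved value cancels the leading forcing `g a/(2q)`. The remaining forcing is
  -- `O(|q|⁻²)`, and the damping improves it to `O(|q|⁻³)`.
  have hv := norm_le_of_damped (v := fun x => b x - g x / (4 * q ^ 2) * a x)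
    (f := fun x => (g x : ℂ) / (2 * q) * b x - (deriv g x : ℝ) / (4 * q ^ 2) * a x +
      (g x : ℂ) ^ 2 / (8 * q ^ 3) * (a x + b x)) (q := q) (C := K ^ 2 * (1 + 1 / σ) / ‖q‖ ^ 2)
      hβ hre ?_ ?_ ?_ hx
  · refine hv.trans ?_
    refine mul_le_mul_of_nonneg_right ?_ (Real.exp_pos _).le
    rw [div_div, div_div, div_le_div_iff₀ (by positivity) (by positivity)]
    have h1 : σ * ‖q‖ ^ 3 ≤ ‖q‖ ^ 2 * (2 * q.re) := by nlinarith [pow_pos hq0 2]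
    exact mul_le_mul_of_nonneg_left h1 (by positivity)
  · intro x hx
    have h1 : HasDerivAt (fun x => (g x : ℂ)) ((deriv g x : ℝ) : ℂ) x := (hg.hasDerivAt x).ofReal_comp
    refine ((h.hasDeriv_snd x hx).sub ((h1.div_const (4 * q ^ 2)).hasDerivWithinAt.mul
      (h.hasDeriv_fst x hx))).congr_deriv ?_
    field_simp
    ring
  · intro x hx
    have hg0 := hg.norm_le hx
    have hg1 : ‖((deriv g x : ℝ) : ℂ)‖ ≤ K * Real.exp (β * x) := by
      rw [Complex.norm_real]; exact hg.abs_deriv_le hx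
    set e := Real.exp (β * x) with he
    have he0 : 0 < e := Real.exp_pos _
    have he1 : e ≤ 1 := hg.exp_le_one hx
    have t1 : ‖(g x : ℂ) / (2 * q) * b x‖ ≤ K * e / (2 * 1) * (K / σ / ‖q‖ ^ 2 * 1) := by
      rw [norm_mul, norm_div, norm_mul, Complex.norm_ofNat]
      gcongr
      refine (B x hx).trans ?_
      gcongr
    have t2 : ‖((deriv g x : ℝ) : ℂ) / (4 * q ^ 2) * a x‖ ≤ K * e / (4 * ‖q‖ ^ 2) * 2 := by
      rw [norm_mul, norm_div, norm_mul, norm_pow, Complex.norm_ofNat]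
      gcongr
      exact A2 x hx
    have t3 : ‖(g x : ℂ) ^ 2 / (8 * q ^ 3) * (a x + b x)‖ ≤ (K * e) * (K * 1) / (8 * ‖q‖ ^ 2) * 2 := by
      rw [norm_mul, norm_div, norm_mul, norm_pow, norm_pow, Complex.norm_ofNat, sq ‖(g x : ℂ)‖]
      gcongr
      · exact hg0.trans (by gcongr)
      · norm_num
      · exact hS x hx
    refine (norm_add_le _ _).trans ((add_le_add ((norm_sub_le _ _).trans (add_le_add t1 t2))
      t3).trans ?_)
    have : K ≤ K ^ 2 := by nlinarith
    calc _ = (K ^ 2 * (1 / σ) / 2 + K / 2 + K ^ 2 / 4) * (e / ‖q‖ ^ 2) := by field_simp; ring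
      _ ≤ (K ^ 2 * (1 + 1 / σ)) * (e / ‖q‖ ^ 2) := by
        gcongr
        have : 0 < K ^ 2 * (1 / σ) := by positivity
        nlinarith
      _ = _ := by ring
  · have hgt : Tendsto (fun x => (g x : ℂ)) atBot (𝓝 0) := by
      have hexp : Tendsto (fun x => K * Real.exp (β * x)) atBot (𝓝 0) := by
        have : Tendsto (fun x => Real.exp (β * x)) atBot (𝓝 0) :=
          Real.tendsto_exp_atBot.comp (tendsto_id.const_mul_atBot hβ)
        simpa using this.const_mul K
      refine squeeze_zero_norm' ?_ hexp
      filter_upwards [eventually_le_atBot 0] with y hy using hg.norm_le hy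
    simpa using h.tendsto_snd.sub ((hgt.div_const (4 * q ^ 2)).mul h.tendsto_fst)

end IsScaledSolution

end EvansMagnus

/-! ### WKB growth of the exact solution. -/

namespace EvansMagnus

open Set

/-- The exponent of the growth factor of the exact solution on `[ξ₀, x]`, up to higher order. -/
noncomputable def growthExponent (g : ℝ → ℝ) (q : ℂ) (ξ₀ x : ℝ) : ℂ :=
  ((∫ s in ξ₀..x, g s : ℝ) : ℂ) / (2 * q) + ((∫ s in ξ₀..x, g s ^ 2 : ℝ) : ℂ) / (8 * q ^ 3)

lemma ExpDecay.hasDerivAt_growthExponent {g : ℝ → ℝ} {K β : ℝ} (hg : ExpDecay g K β) (q : ℂ)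
    (ξ₀ x : ℝ) :
    HasDerivAt (growthExponent g q ξ₀) ((g x : ℂ) / (2 * q) + (g x : ℂ) ^ 2 / (8 * q ^ 3)) x := by
  have h1 : HasDerivAt (fun x => ∫ s in ξ₀..x, g s) (g x) x :=
    intervalIntegral.integral_hasDerivAt_right (hg.continuous.intervalIntegrable _ _)
      (hg.continuous.stronglyMeasurableAtFilter _ _) hg.continuous.continuousAt
  have hc : Continuous fun s => g s ^ 2 := hg.continuous.pow 2
  have h2 : HasDerivAt (fun x => ∫ s in ξ₀..x, g s ^ 2) (g x ^ 2) x :=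
    intervalIntegral.integral_hasDerivAt_right (hc.intervalIntegrable _ _)
      (hc.stronglyMeasurableAtFilter _ _) hc.continuousAt
  refine ((h1.ofReal_comp.div_const (2 * q)).add (h2.ofReal_comp.div_const (8 * q ^ 3))).congr_deriv
    ?_
  push_cast
  rfl

lemma ExpDecay.norm_growthExponent_le {g : ℝ → ℝ} {K β : ℝ} (hg : ExpDecay g K β) {q : ℂ}
    (hq1 : 1 ≤ ‖q‖) {ξ₀ x : ℝ} (hξ : ξ₀ ≤ 0) (hx : x ≤ 0) :
    ‖growthExponent g q ξ₀ x‖ ≤ K ^ 2 / β / ‖q‖ := by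
  have hK := hg.pos
  have hK1 := hg.one_le
  have h := norm_sub_le_of_deriv_le_exp' (C := K ^ 2 / ‖q‖) hg.rate_pos
    (fun x _ => (hg.hasDerivAt_growthExponent q ξ₀ x).hasDerivWithinAt) ?_ hξ hx
  · have h0 : growthExponent g q ξ₀ ξ₀ = 0 := by simp [growthExponent]
    rw [h0, sub_zero] at h
    exact h.trans (le_of_eq (by ring))
  · intro x hx
    have hg0 := hg.norm_le hx
    have he1 := hg.exp_le_one hx
    set e := Real.exp (β * x)
    have he0 : 0 < e := Real.exp_pos _
    have t1 : ‖(g x : ℂ) / (2 * q)‖ ≤ K * e / (2 * ‖q‖) := by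
      rw [norm_div, norm_mul, Complex.norm_ofNat]
      gcongr
    have t3 : ‖(g x : ℂ) ^ 2 / (8 * q ^ 3)‖ ≤ (K * e) * (K * 1) / (8 * ‖q‖) := by
      rw [norm_div, norm_mul, norm_pow, norm_pow, Complex.norm_ofNat, sq ‖(g x : ℂ)‖]
      gcongr
      · exact hg0.trans (by gcongr)
      · exact le_self_pow₀ hq1 (by norm_num)
    refine (norm_add_le _ _).trans ((add_le_add t1 t3).trans ?_)
    calc _ = (K / 2 + K ^ 2 / 8) * (e / ‖q‖) := by field_simp
      _ ≤ K ^ 2 * (e / ‖q‖) := by gcongr; nlinarith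
      _ = _ := by ring

/-- With `Ψ` the growth exponent, the derivative of `a exp Ψ` contains only `b - g a/(4q²)`, since
the term `g²/(8q³)` of `Ψ'` accounts for the slaved part of `b`. This difference is `O(|q|⁻³)`, and
its prefactor `g/(2q)` supplies the fourth power. -/
lemma IsScaledSolution.norm_growth_sub_le {g : ℝ → ℝ} {q : ℂ} {a b : ℝ → ℂ} {K β σ : ℝ}
    (h : IsScaledSolution g q a b) (hg : ExpDecay g K β)
    (hσ : 0 < σ) (hq : σ * ‖q‖ ≤ q.re) (hq1 : 1 ≤ ‖q‖) (hq2 : K * (1 / β + 1 / σ) ≤ ‖q‖)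
    (hq3 : K ^ 2 / β ≤ ‖q‖) {ξ₀ : ℝ} (hξ : ξ₀ ≤ 0) :
    ‖a 0 * Complex.exp (growthExponent g q ξ₀ 0) - a ξ₀‖ ≤
      3 * K ^ 3 * (1 + 1 / σ) / σ / β / ‖q‖ ^ 4 := by
  have hβ := hg.rate_pos
  have hK := hg.pos
  have hq0 : 0 < ‖q‖ := by linarith
  have hqne : q ≠ 0 := norm_pos_iff.1 hq0
  have hk := norm_sub_le_of_deriv_le_exp' (C := 3 * K ^ 3 * (1 + 1 / σ) / σ / ‖q‖ ^ 4) hβ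
    (F := fun x => a x * Complex.exp (growthExponent g q ξ₀ x))
    (F' := fun x => Complex.exp (growthExponent g q ξ₀ x) * (-((g x : ℂ) / (2 * q)) *
      (b x - g x / (4 * q ^ 2) * a x))) ?_ ?_ hξ le_rfl
  · have h0 : growthExponent g q ξ₀ ξ₀ = 0 := by simp [growthExponent]
    simp only [h0, Complex.exp_zero, mul_one] at hk
    exact hk.trans (le_of_eq (by ring))
  · intro x hx
    refine ((h.hasDeriv_fst x hx).mul
      (hg.hasDerivAt_growthExponent q ξ₀ x).cexp.hasDerivWithinAt).congr_deriv ?_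
    field_simp
    ring
  · intro x hx
    obtain ⟨-, -, -, hv⟩ := h.bounds hg hσ hq hq1 hq2 hx
    have hE : ‖Complex.exp (growthExponent g q ξ₀ x)‖ ≤ 3 := by
      rw [Complex.norm_exp]
      have h1 : (growthExponent g q ξ₀ x).re ≤ 1 := by
        refine (Complex.re_le_norm _).trans ((hg.norm_growthExponent_le hq1 hξ hx).trans ?_)
        rwa [div_le_one hq0]
      exact (Real.exp_le_exp.2 h1).trans (Real.exp_one_lt_three.le)
    have hg0 : ‖(g x : ℂ)‖ ≤ K := (hg.norm_le hx).trans
      (mul_le_of_le_one_right hK.le (hg.exp_le_one hx))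
    set e := Real.exp (β * x)
    have he0 : 0 < e := Real.exp_pos _
    rw [norm_mul, norm_mul, norm_neg, norm_div, norm_mul, Complex.norm_ofNat]
    calc _ ≤ 3 * (K / (2 * ‖q‖) * (K ^ 2 * (1 + 1 / σ) / σ / ‖q‖ ^ 3 * e)) := by gcongr
      _ = 3 * K ^ 3 * (1 + 1 / σ) / σ / ‖q‖ ^ 4 * e / 2 := by field_simp
      _ ≤ _ := half_le_self (by positivity)

/-! ### Existence of the exact solution by a Volterra equation. -/

section Existence

variable {E : Type*} [NormedAddCommGroup E] {F : ℝ → E} {C k : ℝ}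

lemma integrableOn_Iic_of_le_exp (hF : Continuous F) (hk : 0 < k)
    (hb : ∀ s ≤ 0, ‖F s‖ ≤ C * Real.exp (k * s)) (x : ℝ) :
    MeasureTheory.IntegrableOn F (Iic x) := by
  have h0 : MeasureTheory.IntegrableOn F (Iic 0) := by
    refine MeasureTheory.Integrable.mono' ((integrableOn_exp_mul_Iic hk 0).const_mul C)
      hF.aestronglyMeasurable ?_
    filter_upwards [MeasureTheory.ae_restrict_mem measurableSet_Iic] with s hs using hb s hs
  have h1 : MeasureTheory.IntegrableOn F (Icc 0 x) := hF.continuousOn.integrableOn_Icc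
  refine (h0.union h1).mono_set fun s hs => ?_
  rcases le_total s 0 with h | h
  · exact Or.inl h
  · exact Or.inr ⟨h, hs⟩

variable [NormedSpace ℝ E]

lemma hasDerivAt_integral_Iic [CompleteSpace E] (hF : Continuous F) (hk : 0 < k)
    (hb : ∀ s ≤ 0, ‖F s‖ ≤ C * Real.exp (k * s)) (x : ℝ) :
    HasDerivAt (fun x => ∫ s in Iic x, F s) (F x) x := by
  have hi := integrableOn_Iic_of_le_exp hF hk hb
  have h1 : HasDerivAt (fun x => (∫ s in Iic 0, F s) + ∫ s in (0:ℝ)..x, F s) (F x) x :=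
    (intervalIntegral.integral_hasDerivAt_right (hF.intervalIntegrable _ _)
      (hF.stronglyMeasurableAtFilter _ _) hF.continuousAt).const_add _
  convert! h1 using 2 with y
  rw [← intervalIntegral.integral_Iic_sub_Iic (hi 0) (hi y)]
  abel

lemma norm_integral_Iic_le (hk : 0 < k)
    (hb : ∀ s ≤ 0, ‖F s‖ ≤ C * Real.exp (k * s)) {x : ℝ} (hx : x ≤ 0) :
    ‖∫ s in Iic x, F s‖ ≤ C / k * Real.exp (k * x) := by
  refine (MeasureTheory.norm_integral_le_of_norm_le
    ((integrableOn_exp_mul_Iic hk x).const_mul C) ?_).trans (le_of_eq ?_)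
  · filter_upwards [MeasureTheory.ae_restrict_mem measurableSet_Iic] with s hs
      using hb s (le_trans hs hx)
  · rw [MeasureTheory.integral_const_mul, integral_exp_mul_Iic hk]
    ring

variable {g : ℝ → ℝ} {K β : ℝ}

lemma ExpDecay.norm_mul_le (hg : ExpDecay g K β) (q : ℂ) (m : BoundedContinuousFunction ℝ ℂ)
    {s : ℝ} (hs : s ≤ 0) :
    ‖(g s : ℂ) / (2 * q) * m s‖ ≤ K * ‖m‖ / (2 * ‖q‖) * Real.exp (β * s) := by
  rw [norm_mul, norm_div, norm_mul, Complex.norm_ofNat]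
  calc _ ≤ K * Real.exp (β * s) / (2 * ‖q‖) * ‖m‖ := by
        have hK := hg.pos
        gcongr
        · exact hg.norm_le hs
        · exact m.norm_coe_le_norm s
    _ = _ := by ring

lemma norm_cexp_mul_ofReal (q : ℂ) (s : ℝ) :
    ‖Complex.exp (q * s)‖ = Real.exp (q.re * s) := by
  rw [Complex.norm_exp]; simp

lemma ExpDecay.norm_exp_mul_mul_le (hg : ExpDecay g K β) (q : ℂ)
    (m : BoundedContinuousFunction ℝ ℂ) {s : ℝ} (hs : s ≤ 0) :
    ‖Complex.exp (2 * q * s) * ((g s : ℂ) / (2 * q) * m s)‖ ≤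
      K * ‖m‖ / (2 * ‖q‖) * Real.exp ((2 * q.re + β) * s) := by
  have h := hg.norm_mul_le q m hs
  rw [norm_mul, norm_cexp_mul_ofReal, add_mul, Real.exp_add]
  have h2 : (2 * q).re = 2 * q.re := by simp
  rw [h2]
  calc _ ≤ Real.exp (2 * q.re * s) * (K * ‖m‖ / (2 * ‖q‖) * Real.exp (β * s)) := by gcongr
    _ = _ := by ring

/-- The Volterra operator of the scaled system. -/
noncomputable def volterra (g : ℝ → ℝ) (q : ℂ) (m : ℝ → ℂ) (x : ℝ) : ℂ :=
  -(∫ s in Iic x, (g s : ℂ) / (2 * q) * m s) +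
    Complex.exp (-(2 * q) * x) * ∫ s in Iic x, Complex.exp (2 * q * s) * ((g s : ℂ) / (2 * q) * m s)

variable {q : ℂ} (m : BoundedContinuousFunction ℝ ℂ)

lemma ExpDecay.continuous_mul (hg : ExpDecay g K β) :
    Continuous fun s => (g s : ℂ) / (2 * q) * m s :=
  ((Complex.continuous_ofReal.comp hg.continuous).div_const _).mul m.continuous

lemma ExpDecay.continuous_exp_mul_mul (hg : ExpDecay g K β) :
    Continuous fun s : ℝ => Complex.exp (2 * q * s) * ((g s : ℂ) / (2 * q) * m s) :=
  (Complex.continuous_exp.comp (continuous_const.mul Complex.continuous_ofReal)).mul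
    (hg.continuous_mul m)

lemma hasDerivAt_cexp_mul_ofReal (q : ℂ) (x : ℝ) :
    HasDerivAt (fun x : ℝ => Complex.exp (q * x)) (Complex.exp (q * x) * q) x := by
  have := ((Complex.ofRealCLM.hasDerivAt (x := x)).const_mul q).cexp
  simpa using this

/-- The growing factor `exp(-2qx)` is compensated by the rate `2 Re q + β` of the integral. Keeping
only `β` in the denominator is enough for a contraction. -/
lemma ExpDecay.norm_snd_volterra_le (hg : ExpDecay g K β) (hq : 0 < q.re) {x : ℝ} (hx : x ≤ 0) :
    ‖Complex.exp (-(2 * q) * x) *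
      ∫ s in Iic x, Complex.exp (2 * q * s) * ((g s : ℂ) / (2 * q) * m s)‖ ≤
      K * ‖m‖ / (2 * ‖q‖) / β * Real.exp (β * x) := by
  have hβ := hg.rate_pos
  have hK := hg.pos
  have hk : 0 < 2 * q.re + β := by positivity
  have h := norm_integral_Iic_le hk (fun s hs => hg.norm_exp_mul_mul_le q m hs) hx
  rw [norm_mul, norm_cexp_mul_ofReal]
  have h2 : (-(2 * q)).re = -(2 * q.re) := by simp
  rw [h2]
  calc _ ≤ Real.exp (-(2 * q.re) * x) *
        (K * ‖m‖ / (2 * ‖q‖) / (2 * q.re + β) * Real.exp ((2 * q.re + β) * x)) := by gcongr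
    _ = K * ‖m‖ / (2 * ‖q‖) / (2 * q.re + β) * Real.exp (β * x) := by
      rw [mul_left_comm, ← Real.exp_add]; ring_nf
    _ ≤ _ := by
      gcongr
      linarith

lemma ExpDecay.norm_volterra_le (hg : ExpDecay g K β) (hq : 0 < q.re) {x : ℝ} (hx : x ≤ 0) :
    ‖volterra g q m x‖ ≤ K / β / ‖q‖ * ‖m‖ := by
  have hβ := hg.rate_pos
  have hK := hg.pos
  have h1 := norm_integral_Iic_le hβ (fun s hs => hg.norm_mul_le q m hs) hx
  have h2 := hg.norm_snd_volterra_le m hq hx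
  rw [volterra]
  refine (norm_add_le _ _).trans ?_
  rw [norm_neg]
  refine (add_le_add h1 h2).trans ?_
  rw [← two_mul]
  calc _ ≤ 2 * (K * ‖m‖ / (2 * ‖q‖) / β * 1) := by
        gcongr
        exact hg.exp_le_one hx
    _ = _ := by ring

lemma ExpDecay.continuous_volterra (hg : ExpDecay g K β) (hq : 0 < q.re) :
    Continuous (volterra g q m) := by
  have hβ := hg.rate_pos
  have hk : 0 < 2 * q.re + β := by positivity
  refine continuous_iff_continuousAt.2 fun x => ?_
  exact ((hasDerivAt_integral_Iic (hg.continuous_mul m) hβ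
    (fun s hs => hg.norm_mul_le q m hs) x).neg.add
    ((hasDerivAt_cexp_mul_ofReal (-(2 * q)) x).mul (hasDerivAt_integral_Iic
      (hg.continuous_exp_mul_mul m) hk
      (fun s hs => hg.norm_exp_mul_mul_le q m hs) x))).continuousAt

lemma ExpDecay.volterra_sub (hg : ExpDecay g K β) (hq : 0 < q.re)
    (m₁ m₂ : BoundedContinuousFunction ℝ ℂ) (x : ℝ) :
    volterra g q m₁ x - volterra g q m₂ x = volterra g q (m₁ - m₂ : BoundedContinuousFunction ℝ ℂ) x := by
  have hβ := hg.rate_pos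
  have hk : 0 < 2 * q.re + β := by positivity
  have i1 := fun m => integrableOn_Iic_of_le_exp (hg.continuous_mul (q := q) m) hβ
    (fun s hs => hg.norm_mul_le q m hs) x
  have i2 := fun m => integrableOn_Iic_of_le_exp (hg.continuous_exp_mul_mul (q := q) m) hk
    (fun s hs => hg.norm_exp_mul_mul_le q m hs) x
  have e1 : ∫ s in Iic x, (g s : ℂ) / (2 * q) * (m₁ - m₂) s =
      (∫ s in Iic x, (g s : ℂ) / (2 * q) * m₁ s) - ∫ s in Iic x, (g s : ℂ) / (2 * q) * m₂ s := by
    rw [← MeasureTheory.integral_sub (i1 m₁) (i1 m₂)]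
    refine MeasureTheory.integral_congr_ae (MeasureTheory.ae_of_all _ fun s => ?_)
    simp only [BoundedContinuousFunction.coe_sub, Pi.sub_apply]
    ring
  have e2 : ∫ s in Iic x, Complex.exp (2 * q * s) * ((g s : ℂ) / (2 * q) * (m₁ - m₂) s) =
      (∫ s in Iic x, Complex.exp (2 * q * s) * ((g s : ℂ) / (2 * q) * m₁ s)) -
        ∫ s in Iic x, Complex.exp (2 * q * s) * ((g s : ℂ) / (2 * q) * m₂ s) := by
    rw [← MeasureTheory.integral_sub (i2 m₁) (i2 m₂)]
    refine MeasureTheory.integral_congr_ae (MeasureTheory.ae_of_all _ fun s => ?_)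
    simp only [BoundedContinuousFunction.coe_sub, Pi.sub_apply]
    ring
  rw [volterra, volterra, volterra, e1, e2]
  ring

/-- The fixed point plays the role of `a + b`, the only combination through which `g` couples the
two equations. -/
lemma ExpDecay.exists_fixedPoint (hg : ExpDecay g K β) (hq : 0 < q.re)
    (hq3 : 2 * (K / β) ≤ ‖q‖) :
    ∃ m : BoundedContinuousFunction ℝ ℂ, ∀ x ≤ 0, m x = 1 + volterra g q m x := by
  have hβ := hg.rate_pos
  have hK := hg.pos
  have hq0 : 0 < ‖q‖ := lt_of_lt_of_le (by positivity) hq3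
  -- Freezing the argument at `min x 0` gives bounded functions on all of `ℝ`, although `g` is not
  -- controlled on the right; nothing changes on `(-∞, 0]`.
  let T : BoundedContinuousFunction ℝ ℂ → BoundedContinuousFunction ℝ ℂ := fun m =>
    BoundedContinuousFunction.ofNormedAddCommGroup (fun x => 1 + volterra g q m (min x 0))
      (continuous_const.add ((hg.continuous_volterra m hq).comp
        (continuous_id.min continuous_const))) (1 + K / β / ‖q‖ * ‖m‖) fun x => by
          refine (norm_add_le _ _).trans ?_
          rw [norm_one]
          gcongr
          exact hg.norm_volterra_le m hq (min_le_right _ _)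
  have hT : ContractingWith (1 / 2) T := by
    refine ⟨by norm_num, LipschitzWith.of_dist_le_mul fun m₁ m₂ => ?_⟩
    rw [BoundedContinuousFunction.dist_le (by positivity)]
    intro x
    have h1 : dist (T m₁ x) (T m₂ x) =
        ‖volterra g q (m₁ - m₂ : BoundedContinuousFunction ℝ ℂ) (min x 0)‖ := by
      rw [dist_eq_norm, ← hg.volterra_sub hq]
      simp [T]
    rw [h1, dist_eq_norm]
    refine (hg.norm_volterra_le _ hq (min_le_right _ _)).trans ?_
    gcongr
    rw [div_le_iff₀ hq0]
    push_cast
    linarith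
  refine ⟨hT.fixedPoint, fun x hx => ?_⟩
  have h := DFunLike.congr_fun hT.fixedPoint_isFixedPt x
  rw [← h]
  simp [T, min_eq_left hx]

/-- The two summands of the Volterra operator at the fixed point are `a - 1` and `b`. Uniqueness is
not needed, because the estimates hold for every scaled solution. -/
lemma ExpDecay.exists_isScaledSolution (hg : ExpDecay g K β) (hq : 0 < q.re)
    (hq3 : 2 * (K / β) ≤ ‖q‖) : ∃ a b, IsScaledSolution g q a b := by
  have hβ := hg.rate_pos
  have hk : 0 < 2 * q.re + β := by positivity
  obtain ⟨m, hm⟩ := hg.exists_fixedPoint hq hq3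
  have hexp : ∀ C : ℝ, Tendsto (fun x => C * Real.exp (β * x)) atBot (𝓝 0) := fun C => by
    have : Tendsto (fun x => Real.exp (β * x)) atBot (𝓝 0) :=
      Real.tendsto_exp_atBot.comp (tendsto_id.const_mul_atBot hβ)
    simpa using this.const_mul C
  refine ⟨fun x => 1 - ∫ s in Iic x, (g s : ℂ) / (2 * q) * m s,
    fun x => Complex.exp (-(2 * q) * x) *
      ∫ s in Iic x, Complex.exp (2 * q * s) * ((g s : ℂ) / (2 * q) * m s), ?_, ?_, ?_, ?_⟩
  · intro x hx
    refine ((hasDerivAt_integral_Iic (hg.continuous_mul m) hβ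
      (fun s hs => hg.norm_mul_le q m hs) x).const_sub 1).hasDerivWithinAt.congr_deriv ?_
    rw [hm x hx, volterra]
    ring
  · intro x hx
    refine ((hasDerivAt_cexp_mul_ofReal (-(2 * q)) x).mul (hasDerivAt_integral_Iic
      (hg.continuous_exp_mul_mul m) hk
      (fun s hs => hg.norm_exp_mul_mul_le q m hs) x)).hasDerivWithinAt.congr_deriv ?_
    have h1 : Complex.exp (-(2 * q) * x) * Complex.exp (2 * q * x) = 1 := by
      rw [← Complex.exp_add]; simp
    have h2 := hm x hx
    rw [volterra] at h2
    linear_combination (g x : ℂ) / (2 * q) * m x * h1 + (g x : ℂ) / (2 * q) * h2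
  · have h : Tendsto (fun x => ∫ s in Iic x, (g s : ℂ) / (2 * q) * m s) atBot (𝓝 0) := by
      refine squeeze_zero_norm' ?_ (hexp (K * ‖m‖ / (2 * ‖q‖) / β))
      filter_upwards [eventually_le_atBot 0] with y hy
      exact norm_integral_Iic_le hβ (fun s hs => hg.norm_mul_le q m hs) hy
    simpa using h.const_sub 1
  · refine squeeze_zero_norm' ?_ (hexp (K * ‖m‖ / (2 * ‖q‖) / β))
    filter_upwards [eventually_le_atBot 0] with y hy
    exact hg.norm_snd_volterra_le m hq hy

end Existence

end EvansMagnus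

/-! ### Exact diagonalisation of one Magnus step. -/

namespace EvansMagnus

open Set

/-- The coefficient matrix for a general potential `φ`. -/
noncomputable def potentialCoeff (c : ℝ) (φ : ℝ → ℝ) (lam : ℂ) (ξ : ℝ) :
    Matrix (Fin 2) (Fin 2) ℂ :=
  !![0, 1; lam - (φ ξ : ℂ), -(c : ℂ)]

/-- The vector with coordinates `a`, `b` in the basis `(1, -c/2 + q)`, `(1, -c/2 - q)`. -/
noncomputable def eigenVec (c : ℝ) (q a b : ℂ) : Fin 2 → ℂ :=
  ![a + b, (q - c / 2) * a + (-q - c / 2) * b]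

/-- The mean of `g` over the Gauss points. -/
noncomputable def gaussMean (g : ℝ → ℝ) (ξ h : ℝ) : ℝ := (g (gauss₁ ξ h) + g (gauss₂ ξ h)) / 2

/-- The scaled difference of `g` over the Gauss points. -/
noncomputable def gaussDiff (g : ℝ → ℝ) (ξ h : ℝ) : ℝ :=
  √3 / 12 * h * (g (gauss₂ ξ h) - g (gauss₁ ξ h))

/-- With this, the eigenvectors of the Magnus exponent determine the step, and no closed form of the
matrix exponential is needed. The norm on matrices serves only to sum the series. -/
lemma exp_mulVec_of_mulVec_eq_smul {n : Type*} [Fintype n] [DecidableEq n] {M : Matrix n n ℂ}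
    {v : n → ℂ} {μ : ℂ} (h : M *ᵥ v = μ • v) :
    NormedSpace.exp M *ᵥ v = Complex.exp μ • v := by
  let _ : NormedRing (Matrix n n ℂ) := Matrix.linftyOpNormedRing
  let _ : NormedAlgebra ℂ (Matrix n n ℂ) := Matrix.linftyOpNormedAlgebra
  have h1 : HasSum (fun k : ℕ => ((k.factorial : ℂ)⁻¹) • M ^ k) (NormedSpace.exp M) :=
    NormedSpace.exp_series_hasSum_exp' M
  have hpow : ∀ k : ℕ, M ^ k *ᵥ v = μ ^ k • v := by
    intro k
    induction k with
    | zero => simp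
    | succ k ih => rw [pow_succ, ← Matrix.mulVec_mulVec, h, Matrix.mulVec_smul, ih, smul_smul,
        pow_succ, mul_comm]
  let T : Matrix n n ℂ →ₗ[ℂ] (n → ℂ) :=
    { toFun := fun A => A *ᵥ v
      map_add' := fun A B => Matrix.add_mulVec A B v
      map_smul' := fun r A => Matrix.smul_mulVec r A v }
  have hT : Continuous T := LinearMap.continuous_of_finiteDimensional T
  have h2 := h1.map T hT
  have h3 : HasSum (fun k : ℕ => (((k.factorial : ℂ)⁻¹) • μ ^ k)) (NormedSpace.exp μ) :=
    NormedSpace.exp_series_hasSum_exp' μ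
  have h4 := h3.smul_const v
  rw [← Complex.exp_eq_exp_ℂ] at h4
  refine h2.unique ?_
  convert h4 using 2 with k
  simp [T, Matrix.smul_mulVec, hpow, smul_smul]

section Step

variable {c : ℝ} {φ g : ℝ → ℝ} {φinf : ℝ} {lam q w : ℂ} {ξ h : ℝ}

/-- The commutator depends only on the difference of the potential at the two nodes, and in the
eigenbasis it exchanges the two basis vectors, with weight `d = gaussDiff`. The mean enters through
the vector `(0, 1)`. -/
lemma magnus_exponent_mulVec (hφ : ∀ x, φ x = φinf + g x)
    (hq : q ^ 2 = (c : ℂ) ^ 2 / 4 + lam - φinf) (a b : ℂ) :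
    ((h / 2) • (potentialCoeff c φ lam (gauss₁ ξ h) + potentialCoeff c φ lam (gauss₂ ξ h)) -
      (√3 / 12 * h ^ 2) •
        (potentialCoeff c φ lam (gauss₁ ξ h) * potentialCoeff c φ lam (gauss₂ ξ h) -
          potentialCoeff c φ lam (gauss₂ ξ h) * potentialCoeff c φ lam (gauss₁ ξ h))) *ᵥ
      (eigenVec c q a b) =
    (h : ℂ) • ((-(c : ℂ) / 2) • eigenVec c q a b + eigenVec c q (q * a + gaussDiff g ξ h * b)
      (gaussDiff g ξ h * a - q * b) - (gaussMean g ξ h * (a + b)) • ![0, 1]) := by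
  have hlam : lam = q ^ 2 - (c : ℂ) ^ 2 / 4 + φinf := by rw [hq]; ring
  ext i
  fin_cases i
  · simp [eigenVec, gaussDiff, gaussMean, potentialCoeff, Matrix.mulVec, dotProduct,
      Fin.sum_univ_two, hφ]
    ring
  · simp [eigenVec, gaussDiff, gaussMean, potentialCoeff, Matrix.mulVec, dotProduct,
      Fin.sum_univ_two, hφ, hlam]
    ring

/-- The ratio of the coordinates of the dominant eigenvector of a step. -/
noncomputable def stepRatio (g : ℝ → ℝ) (q w : ℂ) (ξ h : ℝ) : ℂ :=
  (gaussDiff g ξ h + gaussMean g ξ h / (2 * q)) / (w + q - gaussMean g ξ h / (2 * q))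

/-- The inverse ratio of the coordinates of the other eigenvector of a step. -/
noncomputable def stepRatio' (g : ℝ → ℝ) (q w : ℂ) (ξ h : ℝ) : ℂ :=
  -(gaussDiff g ξ h - gaussMean g ξ h / (2 * q)) / (w + q - gaussMean g ξ h / (2 * q))

/-- The relative deviation of the growth of a step from `exp(h w)`. -/
noncomputable def stepDefect (g : ℝ → ℝ) (q w : ℂ) (ξ h : ℝ) (r : ℂ) : ℂ :=
  -(1 - Complex.exp (-(2 * h * w))) * stepRatio' g q w ξ h * (r - stepRatio g q w ξ h) /
    (1 - stepRatio g q w ξ h * stepRatio' g q w ξ h)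

/-- The ratio of the coordinates after a step. -/
noncomputable def nextRatio (g : ℝ → ℝ) (q w : ℂ) (ξ h : ℝ) (r : ℂ) : ℂ :=
  stepRatio g q w ξ h +
    Complex.exp (-(2 * h * w)) * (r - stepRatio g q w ξ h) / (1 + stepDefect g q w ξ h r)

lemma eigenVec_add (a b a' b' : ℂ) :
    eigenVec c q (a + a') (b + b') = eigenVec c q a b + eigenVec c q a' b' := by
  ext i; fin_cases i <;> simp [eigenVec] <;> ring

lemma smul_eigenVec (s a b : ℂ) : s • eigenVec c q a b = eigenVec c q (s * a) (s * b) := by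
  ext i; fin_cases i <;> simp [eigenVec] <;> ring

lemma eigenVec_snd (hq : q ≠ 0) (s : ℂ) :
    s • ![0, 1] = eigenVec c q (s / (2 * q)) (-(s / (2 * q))) := by
  ext i
  fin_cases i
  · simp [eigenVec]
  · simp [eigenVec]; field_simp; ring

/-- The vector is split along the eigenvectors `(1, R)` and `(S, 1)` of the exponent. The defect
records the effect on the first coordinate of the part along `(S, 1)`, which is multiplied by
`exp(-2hw)` relative to the dominant part. -/
lemma magnusStep_mulVec (hφ : ∀ x, φ x = φinf + g x)
    (hq : q ^ 2 = (c : ℂ) ^ 2 / 4 + lam - φinf) (hq0 : q ≠ 0)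
    (hw : w ^ 2 = q ^ 2 - gaussMean g ξ h + gaussDiff g ξ h ^ 2)
    (hden : w + q - gaussMean g ξ h / (2 * q) ≠ 0)
    (hdet : 1 - stepRatio g q w ξ h * stepRatio' g q w ξ h ≠ 0) (r : ℂ)
    (hdef : 1 + stepDefect g q w ξ h r ≠ 0) :
    magnusStep (potentialCoeff c φ lam) ξ h *ᵥ eigenVec c q 1 r =
      (Complex.exp (h * (w - c / 2)) * (1 + stepDefect g q w ξ h r)) •
        eigenVec c q 1 (nextRatio g q w ξ h r) := by
  set R := stepRatio g q w ξ h with hR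
  set S := stepRatio' g q w ξ h with hS
  set η : ℂ := gaussMean g ξ h / (2 * q) with hη
  have hηm : (gaussMean g ξ h : ℂ) = 2 * q * η := by rw [hη]; field_simp
  have hR' : R * (w + q - η) = gaussDiff g ξ h + η := by
    rw [hR, stepRatio, div_mul_cancel₀ _ hden]
  have hS' : S * (w + q - η) = -(gaussDiff g ξ h - η) := by
    rw [hS, stepRatio', div_mul_cancel₀ _ hden]
  rw [hηm] at hw
  have e1 : magnusStep (potentialCoeff c φ lam) ξ h *ᵥ eigenVec c q 1 R =
      Complex.exp (h * (w - c / 2)) • eigenVec c q 1 R := by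
    refine exp_mulVec_of_mulVec_eq_smul ?_
    rw [magnus_exponent_mulVec hφ hq, eigenVec_snd (c := c) hq0, hηm, mul_smul]
    congr 1
    have h1 : (2 * q * η * (1 + R)) / (2 * q) = η * (1 + R) := by field_simp
    rw [h1, sub_eq_add_neg, ← neg_one_smul ℂ (eigenVec c q (η * (1 + R)) _)]
    simp only [smul_eigenVec, ← eigenVec_add]
    -- The characteristic equation in factored form: with trace removed and step divided out, the
    -- matrix has diagonal `±(q - η)` and off-diagonal entries `d - η`, `d + η`.
    have hw' : (w - (q - η)) * (w + q - η) = (gaussDiff g ξ h - η) * (gaussDiff g ξ h + η) := by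
      linear_combination hw
    congr 1
    · apply mul_right_cancel₀ hden
      linear_combination (gaussDiff g ξ h - η) * hR' - hw'
    · apply mul_right_cancel₀ hden
      linear_combination (-(w + q - η)) * hR'
  have e2 : magnusStep (potentialCoeff c φ lam) ξ h *ᵥ eigenVec c q S 1 =
      Complex.exp (h * (-w - c / 2)) • eigenVec c q S 1 := by
    refine exp_mulVec_of_mulVec_eq_smul ?_
    rw [magnus_exponent_mulVec hφ hq, eigenVec_snd (c := c) hq0, hηm, mul_smul]
    congr 1
    have h1 : (2 * q * η * (S + 1)) / (2 * q) = η * (S + 1) := by field_simp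
    rw [h1, sub_eq_add_neg, ← neg_one_smul ℂ (eigenVec c q (η * (S + 1)) _)]
    simp only [smul_eigenVec, ← eigenVec_add]
    have hw' : (w - (q - η)) * (w + q - η) = (gaussDiff g ξ h - η) * (gaussDiff g ξ h + η) := by
      linear_combination hw
    congr 1
    · apply mul_right_cancel₀ hden
      linear_combination (w + q - η) * hS'
    · apply mul_right_cancel₀ hden
      linear_combination (gaussDiff g ξ h + η) * hS' + hw'
  set y := (r - R) / (1 - R * S) with hy
  have hy' : y * (1 - R * S) = r - R := by rw [hy, div_mul_cancel₀ _ hdet]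
  have hdefy : stepDefect g q w ξ h r = -(1 - Complex.exp (-(2 * h * w))) * S * y := by
    rw [stepDefect, ← hR, ← hS, hy]; ring
  have hv : eigenVec c q 1 r = (1 - S * y) • eigenVec c q 1 R + y • eigenVec c q S 1 := by
    simp only [smul_eigenVec, ← eigenVec_add]
    congr 1
    · ring
    · linear_combination (-1 : ℂ) * hy'
  have hexp : Complex.exp (h * (-w - c / 2)) =
      Complex.exp (h * (w - c / 2)) * Complex.exp (-(2 * h * w)) := by
    rw [← Complex.exp_add]; congr 1; ring
  rw [hv, Matrix.mulVec_add, Matrix.mulVec_smul, Matrix.mulVec_smul, e1, e2, hexp]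
  rw [mul_smul, mul_smul, smul_comm, smul_comm y, ← smul_add]
  congr 1
  rw [nextRatio, ← hR]
  have hn : (1 + stepDefect g q w ξ h r) * (R + Complex.exp (-(2 * h * w)) * (r - R) /
      (1 + stepDefect g q w ξ h r)) =
      (1 + stepDefect g q w ξ h r) * R + Complex.exp (-(2 * h * w)) * (r - R) := by
    field_simp
  simp only [smul_eigenVec, ← eigenVec_add]
  rw [hn, hdefy, ← hy']
  congr 1
  · ring
  · ring

end Step

end EvansMagnus

/-! ### The principal root and estimates for a single stiff step. -/

namespace EvansMagnus

open Set

lemma complex_sqrt_sq (z : ℂ) : Complex.sqrt z ^ 2 = z := by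
  rw [Complex.sqrt]
  exact_mod_cast Complex.cpow_nat_inv_pow z (n := 2) (by norm_num)

lemma complex_sqrt_re_nonneg (z : ℂ) : 0 ≤ (Complex.sqrt z).re := by
  rw [Complex.sqrt]
  rw [Complex.cpow_inv_two_re]
  positivity

lemma one_le_norm_sqrt_add_one (z : ℂ) : 1 ≤ ‖Complex.sqrt z + 1‖ := by
  refine le_trans ?_ (Complex.re_le_norm _)
  have := complex_sqrt_re_nonneg z
  simp only [Complex.add_re, Complex.one_re]
  linarith

/-- No smallness is needed: the principal root has nonnegative real part, so the conjugate factor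
`√(1 + z) + 1` has norm at least one. -/
lemma norm_sqrt_one_add_sub_one_le (z : ℂ) : ‖Complex.sqrt (1 + z) - 1‖ ≤ ‖z‖ := by
  have h1 := one_le_norm_sqrt_add_one (1 + z)
  have h2 : (Complex.sqrt (1 + z) - 1) * (Complex.sqrt (1 + z) + 1) = z := by
    linear_combination complex_sqrt_sq (1 + z)
  calc ‖Complex.sqrt (1 + z) - 1‖ ≤ ‖Complex.sqrt (1 + z) - 1‖ * ‖Complex.sqrt (1 + z) + 1‖ :=
        le_mul_of_one_le_right (norm_nonneg _) h1
    _ = ‖z‖ := by rw [← norm_mul, h2]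

/-- For `s² = 1 + z` the remainder is exactly `(s - 1)³ (s + 3)/8`, so no power series is involved.
-/
lemma norm_sqrt_one_add_sub_taylor_le {z : ℂ} (hz : ‖z‖ ≤ 1) :
    ‖Complex.sqrt (1 + z) - 1 - z / 2 + z ^ 2 / 8‖ ≤ ‖z‖ ^ 3 := by
  set s := Complex.sqrt (1 + z) with hs
  have h1 : 1 ≤ ‖s + 1‖ := one_le_norm_sqrt_add_one (1 + z)
  have h0 : s + 1 ≠ 0 := norm_pos_iff.1 (by linarith)
  have hs2 : s ^ 2 = 1 + z := complex_sqrt_sq (1 + z)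
  have h3 : ‖s - 1‖ ≤ ‖z‖ := norm_sqrt_one_add_sub_one_le z
  have hz' : z = s ^ 2 - 1 := by rw [hs2]; ring
  have e : s - 1 - z / 2 + z ^ 2 / 8 = (s - 1) ^ 3 * (s + 3) / 8 := by
    rw [hz']; ring
  have h4 : ‖s + 3‖ ≤ 5 := by
    have : s + 3 = (s - 1) + 4 := by ring
    rw [this]
    refine (norm_add_le _ _).trans ?_
    have : ‖(4 : ℂ)‖ = 4 := by simp
    rw [this]; linarith
  rw [e, norm_div, norm_mul, norm_pow, Complex.norm_ofNat]
  have h5 : ‖s - 1‖ ^ 3 ≤ ‖z‖ ^ 3 := by gcongr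
  have h6 : 0 ≤ ‖s - 1‖ ^ 3 := by positivity
  nlinarith

/-- The dominant eigenvalue of a step, without the trace part and divided by the step size. -/
noncomputable def stepFreq (g : ℝ → ℝ) (q : ℂ) (ξ h : ℝ) : ℂ :=
  q * Complex.sqrt (1 + ((gaussDiff g ξ h : ℂ) ^ 2 - gaussMean g ξ h) / q ^ 2)

lemma stepFreq_sq {g : ℝ → ℝ} {q : ℂ} {ξ h : ℝ} (hq : q ≠ 0) :
    stepFreq g q ξ h ^ 2 = q ^ 2 - gaussMean g ξ h + gaussDiff g ξ h ^ 2 := by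
  rw [stepFreq, mul_pow, complex_sqrt_sq]
  field_simp
  ring

/-- Bounds on a potential over one step of the method, and on the step size. -/
structure StepBounds (g : ℝ → ℝ) (q : ℂ) (σ H γ ξ h : ℝ) : Prop where
  one_le : 1 ≤ H
  gamma_pos : 0 < γ
  gamma_le : γ ≤ 1
  step_pos : 0 < h
  step_le : h ≤ H
  mean_le : |gaussMean g ξ h| ≤ H * γ
  diff_le : |gaussDiff g ξ h| ≤ H * h ^ 2 * γ
  mean_sub_le : |gaussMean g ξ h - g ξ| ≤ H * h * γ
  sub_le : |g (ξ + h) - g ξ| ≤ H * h * γ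
  sector_pos : 0 < σ
  sector : σ * ‖q‖ ≤ q.re
  stiff : 2 ≤ σ * h * ‖q‖
  inv_le : ‖q‖⁻¹ ≤ h
  large : 200 * H ^ 18 ≤ ‖q‖
  large' : 4 * H ^ 6 ≤ σ * ‖q‖ ^ 2

namespace StepBounds

variable {g : ℝ → ℝ} {q : ℂ} {σ H γ ξ h : ℝ}

lemma norm_pos (B : StepBounds g q σ H γ ξ h) : 0 < ‖q‖ := by
  have := B.one_le
  refine lt_of_lt_of_le ?_ B.large
  positivity

lemma inv_small (B : StepBounds g q σ H γ ξ h) : 200 * H ^ 18 * ‖q‖⁻¹ ≤ 1 := by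
  have := B.norm_pos
  rw [← div_eq_mul_inv, div_le_one this]
  exact B.large

/-- The eighteenth power is needed for the cubic remainder of the root, whose argument is bounded by
`2 H⁶ γ |q|⁻²`. -/
lemma pow_mul_inv_le (B : StepBounds g q σ H γ ξ h) {n : ℕ} (hn : n ≤ 18) :
    H ^ n * ‖q‖⁻¹ ≤ 1 / 200 := by
  have h1 : H ^ n ≤ H ^ 18 := pow_le_pow_right₀ B.one_le hn
  have h2 : H ^ n * ‖q‖⁻¹ ≤ H ^ 18 * ‖q‖⁻¹ :=
    mul_le_mul_of_nonneg_right h1 (inv_nonneg.2 (norm_nonneg _))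
  linarith [B.inv_small]

lemma norm_diff_sq_sub_le (B : StepBounds g q σ H γ ξ h) :
    ‖(gaussDiff g ξ h : ℂ) ^ 2 - gaussMean g ξ h‖ ≤ 2 * H ^ 6 * γ := by
  have hH := B.one_le
  have hγ := B.gamma_pos
  have hh := B.step_pos
  refine (norm_sub_le _ _).trans ?_
  rw [norm_pow, Complex.norm_real, Complex.norm_real, Real.norm_eq_abs, Real.norm_eq_abs]
  have h1 : |gaussDiff g ξ h| ^ 2 ≤ (H * H ^ 2 * 1) * (H * H ^ 2 * γ) := by
    rw [sq]
    gcongr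
    · exact B.diff_le.trans (by gcongr; exacts [B.step_le, B.gamma_le])
    · exact B.diff_le.trans (by gcongr; exacts [B.step_le])
  have h2 : H * γ ≤ H ^ 6 * γ := by
    gcongr
    exact le_self_pow₀ hH (by norm_num)
  nlinarith [B.mean_le]

lemma norm_eta_le (B : StepBounds g q σ H γ ξ h) :
    ‖(gaussMean g ξ h : ℂ) / (2 * q)‖ ≤ H * γ * ‖q‖⁻¹ / 2 := by
  have hq := B.norm_pos
  rw [norm_div, norm_mul, Complex.norm_real, Real.norm_eq_abs, Complex.norm_ofNat]
  have := B.mean_le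
  calc _ ≤ H * γ / (2 * ‖q‖) := by gcongr
    _ = _ := by field_simp

lemma norm_arg_le (B : StepBounds g q σ H γ ξ h) :
    ‖((gaussDiff g ξ h : ℂ) ^ 2 - gaussMean g ξ h) / q ^ 2‖ ≤ 2 * H ^ 6 * γ * ‖q‖⁻¹ ^ 2 := by
  rw [norm_div, norm_pow, div_eq_mul_inv, inv_pow]
  have := B.norm_diff_sq_sub_le
  gcongr

lemma norm_freq_sub_le (B : StepBounds g q σ H γ ξ h) :
    ‖stepFreq g q ξ h - q‖ ≤ 2 * H ^ 6 * γ * ‖q‖⁻¹ := by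
  have hq := B.norm_pos
  have : stepFreq g q ξ h - q = q * (Complex.sqrt (1 + ((gaussDiff g ξ h : ℂ) ^ 2 -
    gaussMean g ξ h) / q ^ 2) - 1) := by rw [stepFreq]; ring
  rw [this, norm_mul]
  calc _ ≤ ‖q‖ * (2 * H ^ 6 * γ * ‖q‖⁻¹ ^ 2) := by
        gcongr
        exact (norm_sqrt_one_add_sub_one_le _).trans B.norm_arg_le
    _ = _ := by field_simp

lemma norm_den_sub_le (B : StepBounds g q σ H γ ξ h) :
    ‖stepFreq g q ξ h + q - gaussMean g ξ h / (2 * q) - 2 * q‖ ≤ 3 * H ^ 6 * ‖q‖⁻¹ := by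
  have hH := B.one_le
  have hγ := B.gamma_pos
  have hq := B.norm_pos
  have : stepFreq g q ξ h + q - gaussMean g ξ h / (2 * q) - 2 * q =
    (stepFreq g q ξ h - q) - gaussMean g ξ h / (2 * q) := by ring
  rw [this]
  refine (norm_sub_le _ _).trans ((add_le_add B.norm_freq_sub_le B.norm_eta_le).trans ?_)
  have h1 : H * γ * ‖q‖⁻¹ / 2 ≤ H ^ 6 * 1 * ‖q‖⁻¹ := by
    have : H * γ * ‖q‖⁻¹ ≤ H ^ 6 * 1 * ‖q‖⁻¹ := by
      gcongr
      · exact le_self_pow₀ hH (by norm_num)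
      · exact B.gamma_le
    have h2 : 0 ≤ H * γ * ‖q‖⁻¹ := by positivity
    linarith
  have h2 : 2 * H ^ 6 * γ * ‖q‖⁻¹ ≤ 2 * H ^ 6 * 1 * ‖q‖⁻¹ := by
    gcongr
    exact B.gamma_le
  linarith

lemma le_norm_den (B : StepBounds g q σ H γ ξ h) :
    ‖q‖ ≤ ‖stepFreq g q ξ h + q - gaussMean g ξ h / (2 * q)‖ := by
  have hq := B.norm_pos
  have h1 := B.norm_den_sub_le
  have h2 : 3 * H ^ 6 * ‖q‖⁻¹ ≤ 1 := by linarith [B.pow_mul_inv_le (n := 6) (by norm_num)]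
  have h3 : (1 : ℝ) ≤ ‖q‖ := by
    have := one_le_pow₀ B.one_le (n := 18)
    linarith [B.large]
  have h4 := norm_sub_norm_le (2 * q) (2 * q - (stepFreq g q ξ h + q -
    gaussMean g ξ h / (2 * q)))
  rw [norm_sub_rev (2 * q) (stepFreq g q ξ h + q - gaussMean g ξ h / (2 * q)), sub_sub_cancel,
    norm_mul, Complex.norm_ofNat] at h4
  linarith

lemma norm_num_le (B : StepBounds g q σ H γ ξ h) :
    ‖(gaussDiff g ξ h : ℂ)‖ + ‖(gaussMean g ξ h : ℂ) / (2 * q)‖ ≤ 2 * H ^ 2 * h * γ := by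
  have hH := B.one_le
  have hγ := B.gamma_pos
  have hh := B.step_pos
  have h1 := B.norm_eta_le
  have h2 : ‖(gaussDiff g ξ h : ℂ)‖ ≤ H * (H * h) * γ := by
    rw [Complex.norm_real, Real.norm_eq_abs]
    refine B.diff_le.trans ?_
    rw [sq]
    gcongr
    exact B.step_le
  have h3 : H * γ * ‖q‖⁻¹ ≤ H ^ 2 * γ * h := by
    gcongr
    · exact le_self_pow₀ hH (by norm_num)
    · exact B.inv_le
  have h4 : 0 ≤ H ^ 2 * γ * h := by positivity
  linarith

lemma norm_ratio_le (B : StepBounds g q σ H γ ξ h) :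
    ‖stepRatio g q (stepFreq g q ξ h) ξ h‖ ≤ 2 * H ^ 2 * h * γ * ‖q‖⁻¹ := by
  have hq := B.norm_pos
  rw [stepRatio, norm_div, div_eq_mul_inv]
  have h0 := le_trans (by positivity) B.norm_num_le
  exact mul_le_mul ((norm_add_le _ _).trans B.norm_num_le)
    (inv_anti₀ hq B.le_norm_den) (by positivity) h0

lemma norm_ratio'_le (B : StepBounds g q σ H γ ξ h) :
    ‖stepRatio' g q (stepFreq g q ξ h) ξ h‖ ≤ 2 * H ^ 2 * h * γ * ‖q‖⁻¹ := by
  have hq := B.norm_pos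
  rw [stepRatio', norm_div, norm_neg, div_eq_mul_inv]
  have h0 := le_trans (by positivity) B.norm_num_le
  exact mul_le_mul ((norm_sub_le _ _).trans B.norm_num_le)
    (inv_anti₀ hq B.le_norm_den) (by positivity) h0

lemma ratio_bound_le (B : StepBounds g q σ H γ ξ h) :
    2 * H ^ 2 * h * γ * ‖q‖⁻¹ ≤ 1 / 100 := by
  have hH := B.one_le
  have hγ := B.gamma_pos
  have hh := B.step_pos
  have hq := B.norm_pos
  calc _ ≤ 2 * H ^ 2 * H * 1 * ‖q‖⁻¹ := by gcongr; exacts [B.step_le, B.gamma_le]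
    _ = 2 * (H ^ 3 * ‖q‖⁻¹) := by ring
    _ ≤ _ := by linarith [B.pow_mul_inv_le (n := 3) (by norm_num)]

lemma norm_ratio_mul_le (B : StepBounds g q σ H γ ξ h) :
    ‖stepRatio g q (stepFreq g q ξ h) ξ h * stepRatio' g q (stepFreq g q ξ h) ξ h‖ ≤ 1 / 2 := by
  rw [norm_mul]
  have h1 := B.norm_ratio_le.trans B.ratio_bound_le
  have h2 := B.norm_ratio'_le.trans B.ratio_bound_le
  nlinarith [norm_nonneg (stepRatio g q (stepFreq g q ξ h) ξ h),
    norm_nonneg (stepRatio' g q (stepFreq g q ξ h) ξ h)]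

lemma half_le_norm_det (B : StepBounds g q σ H γ ξ h) :
    1 / 2 ≤ ‖1 - stepRatio g q (stepFreq g q ξ h) ξ h *
      stepRatio' g q (stepFreq g q ξ h) ξ h‖ := by
  have h1 := B.norm_ratio_mul_le
  have h2 := norm_sub_norm_le 1 (stepRatio g q (stepFreq g q ξ h) ξ h *
    stepRatio' g q (stepFreq g q ξ h) ξ h)
  rw [norm_one] at h2
  linarith

/-- The dominant eigenvector of the step follows the slaved value of the exact solution. The
commutator part is already of order `h² γ/|q|`; replacing the mean by `g ξ` costs `h γ/|q|²`, where
one `1/|q|` is traded for `h`. -/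
lemma norm_ratio_sub_le (B : StepBounds g q σ H γ ξ h) :
    ‖stepRatio g q (stepFreq g q ξ h) ξ h - g ξ / (4 * q ^ 2)‖ ≤
      3 * H * h ^ 2 * γ * ‖q‖⁻¹ := by
  have hH := B.one_le
  have hγ := B.gamma_pos
  have hh := B.step_pos
  have hq := B.norm_pos
  have hqne : q ≠ 0 := norm_pos_iff.1 hq
  have hD := B.le_norm_den
  have hD2 := B.norm_den_sub_le
  have hη := B.norm_eta_le
  rw [stepRatio]
  set D := stepFreq g q ξ h + q - gaussMean g ξ h / (2 * q) with hDdef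
  have hDne : D ≠ 0 := norm_pos_iff.1 (hq.trans_le hD)
  have hDi : ‖D‖⁻¹ ≤ ‖q‖⁻¹ := inv_anti₀ hq hD
  set t := ‖q‖⁻¹ with ht
  have ht0 : 0 < t := inv_pos.2 hq
  have e : ((gaussDiff g ξ h : ℂ) + gaussMean g ξ h / (2 * q)) / D - g ξ / (4 * q ^ 2) =
      (gaussDiff g ξ h : ℂ) / D - (gaussMean g ξ h : ℂ) / (2 * q) * ((D - 2 * q) / (2 * q * D)) +
      ((gaussMean g ξ h - g ξ : ℝ) : ℂ) / (4 * q ^ 2) := by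
    push_cast
    field_simp
    ring
  rw [e]
  have t1 : ‖(gaussDiff g ξ h : ℂ) / D‖ ≤ H * h ^ 2 * γ * t := by
    rw [norm_div, div_eq_mul_inv, Complex.norm_real, Real.norm_eq_abs]
    gcongr
    exact B.diff_le
  have t2 : ‖(gaussMean g ξ h : ℂ) / (2 * q) * ((D - 2 * q) / (2 * q * D))‖ ≤ h ^ 2 * γ * t := by
    have h1 : ‖(D - 2 * q) / (2 * q * D)‖ ≤ 3 * H ^ 6 * t * (t * t) := by
      rw [norm_div, norm_mul, norm_mul, Complex.norm_ofNat, div_eq_mul_inv, mul_inv, mul_inv]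
      gcongr
      rw [← ht]
      linarith
    have htt : t * t ≤ h * h := by gcongr <;> exact B.inv_le
    rw [norm_mul]
    calc _ ≤ (H * γ * t / 2) * (3 * H ^ 6 * t * (t * t)) := by gcongr
      _ ≤ (H * γ * t / 2) * (3 * H ^ 6 * t * (h * h)) := by gcongr
      _ = (3 / 2 * (H ^ 7 * t)) * (h ^ 2 * γ * t) := by ring
      _ ≤ 1 * (h ^ 2 * γ * t) := by
        gcongr
        linarith [B.pow_mul_inv_le (n := 7) (by norm_num)]
      _ = _ := by ring
  have t3 : ‖((gaussMean g ξ h - g ξ : ℝ) : ℂ) / (4 * q ^ 2)‖ ≤ H * h ^ 2 * γ * t := by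
    rw [norm_div, norm_mul, norm_pow, Complex.norm_real, Real.norm_eq_abs, Complex.norm_ofNat,
      div_eq_mul_inv, mul_inv, ← inv_pow, ← ht]
    have h1 : t ^ 2 ≤ h * t := by rw [sq]; gcongr; exact B.inv_le
    calc _ ≤ (H * h * γ) * (4⁻¹ * (h * t)) := by gcongr; exact B.mean_sub_le
      _ = (H * h ^ 2 * γ * t) * 4⁻¹ := by ring
      _ ≤ _ := mul_le_of_le_one_right (by positivity) (by norm_num)
  refine (norm_add_le _ _).trans ((add_le_add ((norm_sub_le _ _).trans (add_le_add t1 t2))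
      t3).trans ?_)
  have : h ^ 2 * γ * t ≤ H * (h ^ 2 * γ * t) := le_mul_of_one_le_left (by positivity) hH
  linarith

/-- Here stiffness enters: `w` differs from `q` by at most `σ|q|/2`, so `2h Re w ≥ σ h |q| ≥ 2`, and
`exp(-2) ≤ 1/4`. -/
lemma norm_exp_le (B : StepBounds g q σ H γ ξ h) :
    ‖Complex.exp (-(2 * h * stepFreq g q ξ h))‖ ≤ 1 / 4 := by
  have hH := B.one_le
  have hγ := B.gamma_pos
  have hh := B.step_pos
  have hq := B.norm_pos
  have hσ := B.sector_pos
  rw [Complex.norm_exp]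
  have h1 : q.re - 2 * H ^ 6 * ‖q‖⁻¹ ≤ (stepFreq g q ξ h).re := by
    have h2 := (Complex.abs_re_le_norm _).trans B.norm_freq_sub_le
    rw [Complex.sub_re] at h2
    have h3 : 2 * H ^ 6 * γ * ‖q‖⁻¹ ≤ 2 * H ^ 6 * 1 * ‖q‖⁻¹ := by
      gcongr; exact B.gamma_le
    linarith [(abs_le.1 h2).1]
  have h4 : 2 * H ^ 6 * ‖q‖⁻¹ ≤ σ * ‖q‖ / 2 := by
    rw [← div_eq_mul_inv, div_le_iff₀ hq]
    nlinarith [B.large']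
  have h5 : σ * ‖q‖ / 2 ≤ (stepFreq g q ξ h).re := by linarith [B.sector]
  have h6 : 2 ≤ 2 * h * (stepFreq g q ξ h).re := by
    have := mul_le_mul_of_nonneg_left h5 (by positivity : 0 ≤ 2 * h)
    nlinarith [B.stiff]
  have h7 : (-(2 * (h : ℂ) * stepFreq g q ξ h)).re = -(2 * h * (stepFreq g q ξ h).re) := by
    have : (2 * (h : ℂ) * stepFreq g q ξ h) = ((2 * h : ℝ) : ℂ) * stepFreq g q ξ h := by
      push_cast; ring
    rw [Complex.neg_re, this, Complex.re_ofReal_mul]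
  rw [h7]
  have h8 : Real.exp (-(2 * h * (stepFreq g q ξ h).re)) ≤ Real.exp (-1) * Real.exp (-1) := by
    rw [← Real.exp_add]
    exact Real.exp_le_exp.2 (by linarith)
  have h9 : Real.exp (-1) ≤ 1 / 2 := by
    rw [Real.exp_neg, inv_le_comm₀ (Real.exp_pos _) (by norm_num)]
    linarith [Real.exp_one_gt_d9]
  nlinarith [Real.exp_pos (-1)]

/-- A product of two small factors: the slope `S` of the second eigenvector is `O(h γ/|q|)` and `r -
R` is `O(h² γ/|q|)`. One factor `γ` suffices for summation over the steps; the other is dropped. -/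
lemma norm_defect_le (B : StepBounds g q σ H γ ξ h) {r : ℂ}
    (hr : ‖r - stepRatio g q (stepFreq g q ξ h) ξ h‖ ≤ 18 * H * h ^ 2 * γ * ‖q‖⁻¹) :
    ‖stepDefect g q (stepFreq g q ξ h) ξ h r‖ ≤ 90 * H ^ 3 * h ^ 3 * γ * ‖q‖⁻¹ ^ 2 := by
  have hH := B.one_le
  have hγ := B.gamma_pos
  have hh := B.step_pos
  have hq := B.norm_pos
  have hE : ‖1 - Complex.exp (-(2 * h * stepFreq g q ξ h))‖ ≤ 5 / 4 := by
    refine (norm_sub_le _ _).trans ?_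
    rw [norm_one]
    linarith [B.norm_exp_le]
  rw [stepDefect, norm_div, norm_mul, norm_mul, norm_neg]
  calc _ ≤ 5 / 4 * (2 * H ^ 2 * h * γ * ‖q‖⁻¹) * (18 * H * h ^ 2 * γ * ‖q‖⁻¹) / (1 / 2) := by
        gcongr
        · exact B.norm_ratio'_le
        · exact B.half_le_norm_det
    _ = 90 * H ^ 3 * h ^ 3 * γ * ‖q‖⁻¹ ^ 2 * γ := by ring
    _ ≤ _ := mul_le_of_le_one_right (by positivity) B.gamma_le

lemma norm_defect_le_half (B : StepBounds g q σ H γ ξ h) {r : ℂ}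
    (hr : ‖r - stepRatio g q (stepFreq g q ξ h) ξ h‖ ≤ 18 * H * h ^ 2 * γ * ‖q‖⁻¹) :
    ‖stepDefect g q (stepFreq g q ξ h) ξ h r‖ ≤ 1 / 2 := by
  have hH := B.one_le
  have hγ := B.gamma_pos
  have hh := B.step_pos
  have hq := B.norm_pos
  refine (B.norm_defect_le hr).trans ?_
  have h3 := B.pow_mul_inv_le (n := 3) (by norm_num)
  calc _ ≤ 90 * H ^ 3 * H ^ 3 * 1 * ‖q‖⁻¹ ^ 2 := by gcongr; exacts [B.step_le, B.gamma_le]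
    _ = 90 * (H ^ 3 * ‖q‖⁻¹) ^ 2 := by ring
    _ ≤ 90 * (1 / 200) ^ 2 := by gcongr
    _ ≤ _ := by norm_num

lemma half_le_norm_one_add_defect (B : StepBounds g q σ H γ ξ h) {r : ℂ}
    (hr : ‖r - stepRatio g q (stepFreq g q ξ h) ξ h‖ ≤ 18 * H * h ^ 2 * γ * ‖q‖⁻¹) :
    1 / 2 ≤ ‖1 + stepDefect g q (stepFreq g q ξ h) ξ h r‖ := by
  have h1 := B.norm_defect_le_half hr
  have h2 := norm_sub_le (1 + stepDefect g q (stepFreq g q ξ h) ξ h r)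
    (stepDefect g q (stepFreq g q ξ h) ξ h r)
  rw [add_sub_cancel_right, norm_one] at h2
  linarith

lemma norm_sub_ratio_le (B : StepBounds g q σ H γ ξ h) {r : ℂ}
    (hr : ‖r - g ξ / (4 * q ^ 2)‖ ≤ 15 * H * h ^ 2 * γ * ‖q‖⁻¹) :
    ‖r - stepRatio g q (stepFreq g q ξ h) ξ h‖ ≤ 18 * H * h ^ 2 * γ * ‖q‖⁻¹ := by
  have h1 := norm_sub_le (r - g ξ / (4 * q ^ 2))
    (stepRatio g q (stepFreq g q ξ h) ξ h - g ξ / (4 * q ^ 2))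
  rw [sub_sub_sub_cancel_right] at h1
  linarith [B.norm_ratio_sub_le]

/-- The constant 15 reproduces itself: the distance to `R` is at most `15 + 3`, damping by `1/4`
over a denominator at least `1/2` leaves 9, and returning to `g/(4q²)` and moving on to `ξ + h` add
3 and 1. -/
lemma norm_nextRatio_sub_le (B : StepBounds g q σ H γ ξ h) {r : ℂ}
    (hr : ‖r - g ξ / (4 * q ^ 2)‖ ≤ 15 * H * h ^ 2 * γ * ‖q‖⁻¹) :
    ‖nextRatio g q (stepFreq g q ξ h) ξ h r - g (ξ + h) / (4 * q ^ 2)‖ ≤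
      15 * H * h ^ 2 * γ * ‖q‖⁻¹ := by
  have hH := B.one_le
  have hγ := B.gamma_pos
  have hh := B.step_pos
  have hq := B.norm_pos
  have hr' := B.norm_sub_ratio_le hr
  have h1 := B.half_le_norm_one_add_defect hr'
  have t1 : ‖Complex.exp (-(2 * h * stepFreq g q ξ h)) *
      (r - stepRatio g q (stepFreq g q ξ h) ξ h) /
      (1 + stepDefect g q (stepFreq g q ξ h) ξ h r)‖ ≤ 9 * H * h ^ 2 * γ * ‖q‖⁻¹ := by
    rw [norm_div, norm_mul]
    calc _ ≤ 1 / 4 * (18 * H * h ^ 2 * γ * ‖q‖⁻¹) / (1 / 2) := by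
          gcongr
          exact B.norm_exp_le
      _ = _ := by ring
  have t2 := B.norm_ratio_sub_le
  have t3 : ‖((g ξ - g (ξ + h) : ℝ) : ℂ) / (4 * q ^ 2)‖ ≤ H * h ^ 2 * γ * ‖q‖⁻¹ := by
    rw [norm_div, norm_mul, norm_pow, Complex.norm_real, Real.norm_eq_abs, Complex.norm_ofNat,
      div_eq_mul_inv, mul_inv, ← inv_pow, abs_sub_comm]
    have h1 : ‖q‖⁻¹ ^ 2 ≤ h * ‖q‖⁻¹ := by rw [sq]; gcongr; exact B.inv_le
    calc _ ≤ (H * h * γ) * (4⁻¹ * (h * ‖q‖⁻¹)) := by gcongr; exact B.sub_le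
      _ = (H * h ^ 2 * γ * ‖q‖⁻¹) * 4⁻¹ := by ring
      _ ≤ _ := mul_le_of_le_one_right (by positivity) (by norm_num)
  have e : nextRatio g q (stepFreq g q ξ h) ξ h r - g (ξ + h) / (4 * q ^ 2) =
      Complex.exp (-(2 * h * stepFreq g q ξ h)) * (r - stepRatio g q (stepFreq g q ξ h) ξ h) /
      (1 + stepDefect g q (stepFreq g q ξ h) ξ h r) +
      (stepRatio g q (stepFreq g q ξ h) ξ h - g ξ / (4 * q ^ 2)) +
      ((g ξ - g (ξ + h) : ℝ) : ℂ) / (4 * q ^ 2) := by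
    rw [nextRatio]; push_cast; ring
  rw [e]
  refine (norm_add_le _ _).trans ((add_le_add ((norm_add_le _ _).trans (add_le_add t1 t2))
      t3).trans ?_)
  have : 0 ≤ H * h ^ 2 * γ * ‖q‖⁻¹ := by positivity
  linarith

/-- Second-order expansion of `w = q √(1 + z)` with `z = (d² - m)/q²`. The cubic remainder and the
terms of `z²` that contain `d²` go into the error, surplus powers of `1/|q|` in the remainder being
exchanged for powers of `h`. -/
lemma norm_exponent_sub_le (B : StepBounds g q σ H γ ξ h) :
    ‖h * (stepFreq g q ξ h - q) - (-((h * gaussMean g ξ h : ℝ) : ℂ) / (2 * q) +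
      ((h * gaussDiff g ξ h ^ 2 : ℝ) : ℂ) / (2 * q) -
      ((h * gaussMean g ξ h ^ 2 : ℝ) : ℂ) / (8 * q ^ 3))‖ ≤ h ^ 3 * γ * ‖q‖⁻¹ ^ 2 := by
  have hH := B.one_le
  have hγ := B.gamma_pos
  have hh := B.step_pos
  have hq := B.norm_pos
  have hqne : q ≠ 0 := norm_pos_iff.1 hq
  have hz := B.norm_arg_le
  set z : ℂ := ((gaussDiff g ξ h : ℂ) ^ 2 - gaussMean g ξ h) / q ^ 2 with hzdef
  have hz1 : ‖z‖ ≤ 1 := by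
    refine hz.trans ?_
    have h6 := B.pow_mul_inv_le (n := 6) (by norm_num)
    have h0 := B.pow_mul_inv_le (n := 0) (by norm_num)
    calc _ ≤ 2 * H ^ 6 * 1 * ‖q‖⁻¹ ^ 2 := by gcongr; exact B.gamma_le
      _ = 2 * (H ^ 6 * ‖q‖⁻¹) * (H ^ 0 * ‖q‖⁻¹) := by ring
      _ ≤ 2 * (1 / 200) * (1 / 200) := by gcongr
      _ ≤ _ := by norm_num
  have hs := norm_sqrt_one_add_sub_taylor_le hz1
  set s := Complex.sqrt (1 + z) with hsdef
  have hw : stepFreq g q ξ h = q * s := rfl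
  have hzq : z * q ^ 2 = (gaussDiff g ξ h : ℂ) ^ 2 - gaussMean g ξ h := by
    rw [hzdef]; field_simp
  have e : h * (stepFreq g q ξ h - q) - (-((h * gaussMean g ξ h : ℝ) : ℂ) / (2 * q) +
      ((h * gaussDiff g ξ h ^ 2 : ℝ) : ℂ) / (2 * q) -
      ((h * gaussMean g ξ h ^ 2 : ℝ) : ℂ) / (8 * q ^ 3)) =
      h * q * (s - 1 - z / 2 + z ^ 2 / 8) -
      h * ((gaussDiff g ξ h ^ 2 * (gaussDiff g ξ h ^ 2 - 2 * gaussMean g ξ h) : ℝ) : ℂ) /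
        (8 * q ^ 3) := by
    have h1 : (gaussMean g ξ h : ℂ) = (gaussDiff g ξ h : ℂ) ^ 2 - z * q ^ 2 := by
      rw [hzq]; ring
    rw [hw]
    push_cast
    rw [h1]
    field_simp
    ring
  rw [e]
  set t := ‖q‖⁻¹ with ht
  have ht0 : 0 < t := inv_pos.2 hq
  have htt : t ^ 2 ≤ h ^ 2 := by gcongr; exact B.inv_le
  have hγ3 : γ ^ 3 ≤ γ := pow_le_of_le_one hγ.le B.gamma_le (by norm_num)
  have t1 : ‖(h : ℂ) * q * (s - 1 - z / 2 + z ^ 2 / 8)‖ ≤ h ^ 3 * γ * t ^ 2 / 2 := by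
    rw [norm_mul, norm_mul, Complex.norm_real, Real.norm_eq_abs, abs_of_pos hh]
    calc _ ≤ h * ‖q‖ * (2 * H ^ 6 * γ * t ^ 2) ^ 3 := by
          gcongr
          exact hs.trans (by gcongr)
      _ = (‖q‖ * t) * (8 * h * (H ^ 18 * t) * γ ^ 3 * t ^ 2 * t ^ 2) := by ring
      _ = (8 * h * (H ^ 18 * t) * γ ^ 3 * t ^ 2 * t ^ 2) := by
        rw [ht, mul_inv_cancel₀ hq.ne', one_mul]
      _ ≤ (8 * h * (1 / 200) * γ * t ^ 2 * h ^ 2) := by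
        gcongr
        exact B.pow_mul_inv_le le_rfl
      _ = (h ^ 3 * γ * t ^ 2) * (8 / 200) := by ring
      _ ≤ (h ^ 3 * γ * t ^ 2) * (1 / 2) :=
        mul_le_mul_of_nonneg_left (by norm_num) (by positivity)
      _ = _ := by ring
  have hd2 : |gaussDiff g ξ h ^ 2| ≤ H ^ 4 * h ^ 2 := by
    rw [abs_pow]
    calc _ ≤ (H * h ^ 2 * 1) ^ 2 := by
          gcongr
          exact B.diff_le.trans (by gcongr; exact B.gamma_le)
      _ = H ^ 2 * h ^ 2 * h ^ 2 := by ring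
      _ ≤ H ^ 2 * h ^ 2 * H ^ 2 := by gcongr; exact B.step_le
      _ = _ := by ring
  have hdm : |gaussDiff g ξ h ^ 2 - 2 * gaussMean g ξ h| ≤ 4 * H ^ 6 * γ := by
    have h1 := B.norm_diff_sq_sub_le
    have h2 : |gaussDiff g ξ h ^ 2 - gaussMean g ξ h| ≤ 2 * H ^ 6 * γ := by
      rw [← Real.norm_eq_abs, ← Complex.norm_real]; push_cast; exact h1
    have h3 : H * γ ≤ H ^ 6 * γ := by
      gcongr
      exact le_self_pow₀ hH (by norm_num)
    have h4 := B.mean_le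
    rw [abs_le] at h2 h4 ⊢
    have : 0 < H ^ 6 * γ := by positivity
    constructor <;> linarith
  have t2 : ‖(h : ℂ) * ((gaussDiff g ξ h ^ 2 * (gaussDiff g ξ h ^ 2 - 2 * gaussMean g ξ h) : ℝ) : ℂ)
      / (8 * q ^ 3)‖ ≤ h ^ 3 * γ * t ^ 2 / 2 := by
    rw [norm_div, norm_mul, norm_mul, norm_pow, Complex.norm_real, Complex.norm_real,
      Complex.norm_ofNat, Real.norm_eq_abs, Real.norm_eq_abs, abs_of_pos hh, abs_mul,
      div_eq_mul_inv, mul_inv, ← inv_pow, ← ht]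
    calc _ ≤ h * (H ^ 4 * h ^ 2 * (4 * H ^ 6 * γ)) * (8⁻¹ * t ^ 3) := by gcongr
      _ = (h ^ 3 * γ * t ^ 2 / 2) * (H ^ 10 * t) := by ring
      _ ≤ (h ^ 3 * γ * t ^ 2 / 2) * 1 := by
        gcongr
        linarith [B.pow_mul_inv_le (n := 10) (by norm_num)]
      _ = _ := by ring
  refine (norm_sub_le _ _).trans ((add_le_add t1 t2).trans (le_of_eq (by ring)))

end StepBounds

end EvansMagnus

/-! ### Bounds along the grid and accumulation over a run. -/

namespace EvansMagnus

open Set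

lemma gauss₁_mem {ξ h : ℝ} (hh : 0 < h) : gauss₁ ξ h ∈ Icc ξ (ξ + h) := by
  have h1 : √3 ≤ 2 := Real.sqrt_le_iff.2 ⟨by norm_num, by norm_num⟩
  have h2 : 0 ≤ √3 := Real.sqrt_nonneg _
  constructor <;> rw [gauss₁] <;> nlinarith

lemma gauss₂_mem {ξ h : ℝ} (hh : 0 < h) : gauss₂ ξ h ∈ Icc ξ (ξ + h) := by
  have h1 : √3 ≤ 2 := Real.sqrt_le_iff.2 ⟨by norm_num, by norm_num⟩
  have h2 : 0 ≤ √3 := Real.sqrt_nonneg _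
  constructor <;> rw [gauss₂] <;> nlinarith

/-- The grid points `-N h + k h`. -/
def grid (h : ℝ) (N k : ℕ) : ℝ := -(N * h) + k * h

lemma grid_succ (h : ℝ) (N k : ℕ) : grid h N (k + 1) = grid h N k + h := by
  simp only [grid]; push_cast; ring

lemma grid_zero (h : ℝ) (N : ℕ) : grid h N 0 = -(N * h) := by simp [grid]

lemma grid_self (h : ℝ) (N : ℕ) : grid h N N = 0 := by simp [grid]

lemma grid_nonpos {h : ℝ} (hh : 0 < h) {N k : ℕ} (hk : k ≤ N) : grid h N k ≤ 0 := by
  have : (k : ℝ) ≤ N := by exact_mod_cast hk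
  rw [grid]; nlinarith

section Sums

variable {β h : ℝ}

lemma mul_exp_le_sub (hβ : 0 < β) (x : ℝ) :
    h * Real.exp (β * x) ≤ (Real.exp (β * (x + h)) - Real.exp (β * x)) / β := by
  rw [le_div_iff₀ hβ, mul_add, Real.exp_add]
  nlinarith [Real.add_one_le_exp (β * h), Real.exp_pos (β * x)]

/-- A left Riemann sum of an increasing exponential lies below its integral. The bound is uniform in
`h` and `N`, so local errors weighted by `exp(β ξ)` accumulate without a factor `L`. -/
lemma sum_mul_exp_grid_le (hβ : 0 < β) (N : ℕ) :
    ∑ k ∈ Finset.range N, h * Real.exp (β * grid h N k) ≤ 1 / β := by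
  calc _ ≤ ∑ k ∈ Finset.range N,
        (Real.exp (β * grid h N (k + 1)) / β - Real.exp (β * grid h N k) / β) := by
        refine Finset.sum_le_sum fun k _ => ?_
        rw [grid_succ, ← sub_div]
        exact mul_exp_le_sub hβ _
    _ = Real.exp (β * grid h N N) / β - Real.exp (β * grid h N 0) / β :=
        Finset.sum_range_sub (fun k => Real.exp (β * grid h N k) / β) N
    _ ≤ _ := by
        rw [grid_self]
        have : 0 < Real.exp (β * grid h N 0) / β := by positivity
        simp only [mul_zero, Real.exp_zero]
        linarith

end Sums

namespace ExpDecay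

variable {g : ℝ → ℝ} {K β h₀ h ξ : ℝ}

lemma abs_iteratedDeriv_le_step (hg : ExpDecay g K β) (hh : h ≤ h₀) (hξ : ξ + h ≤ 0) {k : ℕ}
    (hk : k ≤ 6) {x : ℝ} (hx : x ∈ Icc ξ (ξ + h)) :
    |iteratedDeriv k g x| ≤ K * Real.exp (β * h₀) * Real.exp (β * ξ) := by
  refine (hg.bound k hk x (hx.2.trans hξ)).trans ?_
  rw [mul_assoc, ← Real.exp_add]
  have := hg.pos
  have := hg.rate_pos
  gcongr
  nlinarith [hx.2]

lemma abs_le_step (hg : ExpDecay g K β) (hh : h ≤ h₀) (hξ : ξ + h ≤ 0)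
    {x : ℝ} (hx : x ∈ Icc ξ (ξ + h)) :
    |g x| ≤ K * Real.exp (β * h₀) * Real.exp (β * ξ) := by
  simpa using hg.abs_iteratedDeriv_le_step hh hξ (k := 0) (by norm_num) hx

lemma abs_sub_le_step (hg : ExpDecay g K β) (hh : h ≤ h₀) (hξ : ξ + h ≤ 0)
    {x y : ℝ} (hx : x ∈ Icc ξ (ξ + h)) (hy : y ∈ Icc ξ (ξ + h)) :
    |g x - g y| ≤ K * Real.exp (β * h₀) * Real.exp (β * ξ) * |x - y| := by
  have := Convex.norm_image_sub_le_of_norm_deriv_le (f := g)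
    (C := K * Real.exp (β * h₀) * Real.exp (β * ξ)) (s := Icc ξ (ξ + h))
    (fun z _ => (hg.hasDerivAt z).differentiableAt) (fun z hz => ?_) (convex_Icc _ _) hy hx
  · exact this
  · simpa using hg.abs_iteratedDeriv_le_step hh hξ (k := 1) (by norm_num) hz

lemma abs_sub_le_step' (hg : ExpDecay g K β) (hh : h ≤ h₀) (hξ : ξ + h ≤ 0)
    {x y : ℝ} (hx : x ∈ Icc ξ (ξ + h)) (hy : y ∈ Icc ξ (ξ + h)) :
    |g x - g y| ≤ K * Real.exp (β * h₀) * h * Real.exp (β * ξ) := by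
  have hK := hg.pos
  refine (hg.abs_sub_le_step hh hξ hx hy).trans ?_
  rw [mul_right_comm _ h]
  gcongr
  rw [_root_.abs_le]
  constructor <;> linarith [hx.1, hx.2, hy.1, hy.2]

lemma abs_gaussDiff_le (hg : ExpDecay g K β) (h0 : 0 < h) (hh : h ≤ h₀) (hξ : ξ + h ≤ 0) :
    |gaussDiff g ξ h| ≤ K * Real.exp (β * h₀) * h ^ 2 * Real.exp (β * ξ) := by
  have hK := hg.pos
  have h3 : √3 ≤ 2 := Real.sqrt_le_iff.2 ⟨by norm_num, by norm_num⟩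
  have h3' : 0 ≤ √3 := Real.sqrt_nonneg _
  rw [gaussDiff, abs_mul, abs_of_nonneg (by positivity)]
  calc _ ≤ √3 / 12 * h * (K * Real.exp (β * h₀) * h * Real.exp (β * ξ)) := by
        gcongr
        exact hg.abs_sub_le_step' hh hξ (gauss₂_mem h0) (gauss₁_mem h0)
    _ = (K * Real.exp (β * h₀) * h ^ 2 * Real.exp (β * ξ)) * (√3 / 12) := by ring
    _ ≤ _ := mul_le_of_le_one_right (by positivity) (by linarith)

lemma abs_gaussMean_le (hg : ExpDecay g K β) (h0 : 0 < h) (hh : h ≤ h₀) (hξ : ξ + h ≤ 0) :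
    |gaussMean g ξ h| ≤ K * Real.exp (β * h₀) * Real.exp (β * ξ) := by
  have h1 := hg.abs_le_step hh hξ (gauss₁_mem h0)
  have h2 := hg.abs_le_step hh hξ (gauss₂_mem h0)
  rw [gaussMean, _root_.abs_le]
  rw [_root_.abs_le] at h1 h2
  constructor <;> linarith [h1.1, h1.2, h2.1, h2.2]

lemma abs_gaussMean_sub_le (hg : ExpDecay g K β) (h0 : 0 < h) (hh : h ≤ h₀) (hξ : ξ + h ≤ 0)
    {x : ℝ} (hx : x ∈ Icc ξ (ξ + h)) :
    |gaussMean g ξ h - g x| ≤ K * Real.exp (β * h₀) * h * Real.exp (β * ξ) := by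
  have h1 := hg.abs_sub_le_step' hh hξ (gauss₁_mem h0) hx
  have h2 := hg.abs_sub_le_step' hh hξ (gauss₂_mem h0) hx
  rw [gaussMean, _root_.abs_le]
  rw [_root_.abs_le] at h1 h2
  constructor <;> linarith [h1.1, h1.2, h2.1, h2.2]

lemma stepBounds (hg : ExpDecay g K β) (h0 : 0 < h) (hh : h ≤ h₀) (hξ : ξ + h ≤ 0) {H σ : ℝ}
    {q : ℂ} (hH : 1 ≤ H) (hKH : K * Real.exp (β * h₀) ≤ H) (hhH : h₀ ≤ H) (hσ : 0 < σ)
    (hq : σ * ‖q‖ ≤ q.re) (hM : 2 ≤ σ * h * ‖q‖) (hi : ‖q‖⁻¹ ≤ h) (hl : 200 * H ^ 18 ≤ ‖q‖)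
    (hl' : 4 * H ^ 6 ≤ σ * ‖q‖ ^ 2) :
    StepBounds g q σ H (Real.exp (β * ξ)) ξ h where
  one_le := hH
  gamma_pos := Real.exp_pos _
  gamma_le := hg.exp_le_one (by linarith)
  step_pos := h0
  step_le := hh.trans hhH
  mean_le := (hg.abs_gaussMean_le h0 hh hξ).trans (by gcongr)
  diff_le := (hg.abs_gaussDiff_le h0 hh hξ).trans (by gcongr)
  mean_sub_le := (hg.abs_gaussMean_sub_le h0 hh hξ ⟨le_rfl, by linarith⟩).trans (by gcongr)
  sub_le := (hg.abs_sub_le_step' hh hξ ⟨by linarith, le_rfl⟩ ⟨le_rfl, by linarith⟩).trans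
    (by gcongr)
  sector_pos := hσ
  sector := hq
  stiff := hM
  inv_le := hi
  large := hl
  large' := hl'

end ExpDecay

section Run

variable {g : ℝ → ℝ} {q : ℂ} {σ H β h : ℝ} {N : ℕ}

/-- The ratios of the coordinates along a run of the method. -/
noncomputable def ratioSeq (g : ℝ → ℝ) (q : ℂ) (h : ℝ) (N : ℕ) (r₀ : ℂ) : ℕ → ℂ
  | 0 => r₀
  | k + 1 => nextRatio g q (stepFreq g q (grid h N k) h) (grid h N k) h (ratioSeq g q h N r₀ k)

/-- The defects along a run of the method. -/
noncomputable def defectSeq (g : ℝ → ℝ) (q : ℂ) (h : ℝ) (N : ℕ) (r₀ : ℂ) (k : ℕ) : ℂ :=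
  stepDefect g q (stepFreq g q (grid h N k) h) (grid h N k) h (ratioSeq g q h N r₀ k)

/-- The one-step bound carries the weight at the left end of the step; since the weight increases
along the run, it propagates. -/
lemma norm_ratioSeq_sub_le (hh : 0 < h) (hβ : 0 < β)
    (B : ∀ k < N, StepBounds g q σ H (Real.exp (β * grid h N k)) (grid h N k) h) {r₀ : ℂ}
    (hH : 0 ≤ H)
    (hr : ‖r₀ - g (-(N * h)) / (4 * q ^ 2)‖ ≤
      15 * H * h ^ 2 * Real.exp (β * -(N * h)) * ‖q‖⁻¹) {k : ℕ} (hk : k ≤ N) :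
    ‖ratioSeq g q h N r₀ k - g (grid h N k) / (4 * q ^ 2)‖ ≤
      15 * H * h ^ 2 * Real.exp (β * grid h N k) * ‖q‖⁻¹ := by
  induction k with
  | zero => simpa [ratioSeq, grid_zero] using hr
  | succ k ih =>
    have h1 := (B k (by omega)).norm_nextRatio_sub_le (ih (by omega))
    rw [← grid_succ] at h1
    refine h1.trans ?_
    have : grid h N k ≤ grid h N (k + 1) := by rw [grid_succ]; linarith
    gcongr

lemma magnus_eq_smul {c : ℝ} {φ : ℝ → ℝ} {φinf : ℝ} {lam : ℂ} (hφ : ∀ x, φ x = φinf + g x)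
    (hq : q ^ 2 = (c : ℂ) ^ 2 / 4 + lam - φinf) (hh : 0 < h) (hβ : 0 < β)
    (B : ∀ k < N, StepBounds g q σ H (Real.exp (β * grid h N k)) (grid h N k) h) {r₀ : ℂ}
    (hH : 0 ≤ H)
    (hr : ‖r₀ - g (-(N * h)) / (4 * q ^ 2)‖ ≤
      15 * H * h ^ 2 * Real.exp (β * -(N * h)) * ‖q‖⁻¹) (s : ℂ) {k : ℕ} (hk : k ≤ N) :
    magnus (potentialCoeff c φ lam) (-(N * h)) h (s • eigenVec c q 1 r₀) k =
      (s * ∏ i ∈ Finset.range k, (Complex.exp (h * (stepFreq g q (grid h N i) h - c / 2)) *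
        (1 + defectSeq g q h N r₀ i))) • eigenVec c q 1 (ratioSeq g q h N r₀ k) := by
  induction k with
  | zero => simp [magnus, ratioSeq]
  | succ k ih =>
    have Bk := B k (by omega)
    have hq0 : q ≠ 0 := norm_pos_iff.1 Bk.norm_pos
    have hr' := Bk.norm_sub_ratio_le (norm_ratioSeq_sub_le hh hβ B hH hr (by omega))
    have hden : stepFreq g q (grid h N k) h + q - gaussMean g (grid h N k) h / (2 * q) ≠ 0 :=
      norm_pos_iff.1 (Bk.norm_pos.trans_le Bk.le_norm_den)
    have hdet := norm_pos_iff.1 (lt_of_lt_of_le (by norm_num) Bk.half_le_norm_det)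
    have hdef := norm_pos_iff.1 (lt_of_lt_of_le (by norm_num)
      (Bk.half_le_norm_one_add_defect hr'))
    rw [magnus, ih (by omega), Matrix.mulVec_smul,
      show -(N * h) + k * h = grid h N k from rfl,
      magnusStep_mulVec hφ hq hq0 (stepFreq_sq hq0) hden hdet _ hdef, smul_smul,
      Finset.prod_range_succ, ratioSeq, mul_assoc s]
    rfl

/-- The defects sum to `O(h²/|q|²)`, and `exp s - 1 ≤ 2s` for `0 ≤ s ≤ 1` passes from the sum to the
product. -/
lemma norm_prod_defect_sub_one_le (hh : 0 < h) (hβ : 0 < β)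
    (B : ∀ k < N, StepBounds g q σ H (Real.exp (β * grid h N k)) (grid h N k) h) {r₀ : ℂ}
    (hH : 1 ≤ H) (hβH : 1 / β ≤ H) (hhH : h ≤ H) (hl : 200 * H ^ 18 ≤ ‖q‖)
    (hr : ‖r₀ - g (-(N * h)) / (4 * q ^ 2)‖ ≤
      15 * H * h ^ 2 * Real.exp (β * -(N * h)) * ‖q‖⁻¹) :
    ‖∏ i ∈ Finset.range N, (1 + defectSeq g q h N r₀ i) - 1‖ ≤
      180 * H ^ 4 * h ^ 2 * ‖q‖⁻¹ ^ 2 := by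
  have hq : 0 < ‖q‖ := lt_of_lt_of_le (by positivity) hl
  have hsum : ∑ i ∈ Finset.range N, ‖defectSeq g q h N r₀ i‖ ≤ 90 * H ^ 4 * h ^ 2 * ‖q‖⁻¹ ^ 2 := by
    calc _ ≤ ∑ i ∈ Finset.range N, (90 * H ^ 3 * h ^ 2 * ‖q‖⁻¹ ^ 2) *
          (h * Real.exp (β * grid h N i)) := by
          refine Finset.sum_le_sum fun i hi => ?_
          have hi' := Finset.mem_range.1 hi
          have Bi := B i hi'
          refine (Bi.norm_defect_le (Bi.norm_sub_ratio_le
            (norm_ratioSeq_sub_le hh hβ B (by linarith) hr hi'.le))).trans (le_of_eq ?_)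
          ring
      _ ≤ (90 * H ^ 3 * h ^ 2 * ‖q‖⁻¹ ^ 2) * H := by
          rw [← Finset.mul_sum]
          gcongr
          exact (sum_mul_exp_grid_le hβ N).trans hβH
      _ = _ := by ring
  have hsmall : 90 * H ^ 4 * h ^ 2 * ‖q‖⁻¹ ^ 2 ≤ 1 := by
    have h1 : H ^ 18 * ‖q‖⁻¹ ≤ 1 / 200 := by
      rw [← div_eq_mul_inv, div_le_iff₀ hq]; linarith
    have h2 : H ^ 3 * ‖q‖⁻¹ ≤ 1 / 200 := by
      refine le_trans ?_ h1
      gcongr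
      norm_num
    calc _ ≤ 90 * H ^ 4 * H ^ 2 * ‖q‖⁻¹ ^ 2 := by gcongr
      _ = 90 * (H ^ 3 * ‖q‖⁻¹) ^ 2 := by ring
      _ ≤ 90 * (1 / 200) ^ 2 := by gcongr
      _ ≤ 1 := by norm_num
  refine (Finset.norm_prod_one_add_sub_one_le _ _).trans ?_
  have h0 : 0 ≤ ∑ i ∈ Finset.range N, ‖defectSeq g q h N r₀ i‖ :=
    Finset.sum_nonneg fun _ _ => norm_nonneg _
  have h1 := Real.abs_exp_sub_one_le (x := ∑ i ∈ Finset.range N, ‖defectSeq g q h N r₀ i‖)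
    (by rw [abs_of_nonneg h0]; linarith)
  rw [abs_of_nonneg h0] at h1
  linarith [le_abs_self (Real.exp (∑ i ∈ Finset.range N, ‖defectSeq g q h N r₀ i‖) - 1)]

lemma norm_sum_exponent_sub_le (hβ : 0 < β)
    (B : ∀ k < N, StepBounds g q σ H (Real.exp (β * grid h N k)) (grid h N k) h)
    (hβH : 1 / β ≤ H) :
    ‖∑ i ∈ Finset.range N, h * (stepFreq g q (grid h N i) h - q) -
      (-((∑ i ∈ Finset.range N, h * gaussMean g (grid h N i) h : ℝ) : ℂ) / (2 * q) +
      ((∑ i ∈ Finset.range N, h * gaussDiff g (grid h N i) h ^ 2 : ℝ) : ℂ) / (2 * q) -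
      ((∑ i ∈ Finset.range N, h * gaussMean g (grid h N i) h ^ 2 : ℝ) : ℂ) / (8 * q ^ 3))‖ ≤
      H * h ^ 2 * ‖q‖⁻¹ ^ 2 := by
  have e : ∑ i ∈ Finset.range N, h * (stepFreq g q (grid h N i) h - q) -
      (-((∑ i ∈ Finset.range N, h * gaussMean g (grid h N i) h : ℝ) : ℂ) / (2 * q) +
      ((∑ i ∈ Finset.range N, h * gaussDiff g (grid h N i) h ^ 2 : ℝ) : ℂ) / (2 * q) -
      ((∑ i ∈ Finset.range N, h * gaussMean g (grid h N i) h ^ 2 : ℝ) : ℂ) / (8 * q ^ 3)) =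
      ∑ i ∈ Finset.range N, (h * (stepFreq g q (grid h N i) h - q) -
        (-((h * gaussMean g (grid h N i) h : ℝ) : ℂ) / (2 * q) +
        ((h * gaussDiff g (grid h N i) h ^ 2 : ℝ) : ℂ) / (2 * q) -
        ((h * gaussMean g (grid h N i) h ^ 2 : ℝ) : ℂ) / (8 * q ^ 3))) := by
    rw [Finset.sum_sub_distrib, Finset.sum_sub_distrib, Finset.sum_add_distrib,
      ← Finset.sum_div, ← Finset.sum_div, ← Finset.sum_div, Finset.sum_neg_distrib,
      ← Complex.ofReal_sum, ← Complex.ofReal_sum, ← Complex.ofReal_sum]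
  rw [e]
  refine (norm_sum_le _ _).trans ?_
  calc _ ≤ ∑ i ∈ Finset.range N, (h ^ 2 * ‖q‖⁻¹ ^ 2) * (h * Real.exp (β * grid h N i)) := by
        refine Finset.sum_le_sum fun i hi => ?_
        refine ((B i (Finset.mem_range.1 hi)).norm_exponent_sub_le).trans (le_of_eq ?_)
        ring
    _ ≤ (h ^ 2 * ‖q‖⁻¹ ^ 2) * H := by
        rw [← Finset.mul_sum]
        gcongr
        exact (sum_mul_exp_grid_le hβ N).trans hβH
    _ = _ := by ring

end Run

end EvansMagnus

/-! ### Taylor expansion of the Gauss sums on `[-L, 0]`. -/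

namespace EvansMagnus

open Set

/-- Giving up the factor `1/n!` reduces the induction to the mean value inequality for the shifted
sequence. A sequence of derivatives, rather than `iteratedDeriv`, allows it to begin with a
primitive. -/
lemma abs_sub_taylor_le {F : ℕ → ℝ → ℝ} (hF : ∀ k x, HasDerivAt (F k) (F (k + 1) x) x)
    {ξ h B : ℝ} (n : ℕ) (hB : ∀ x ∈ Icc ξ (ξ + h), |F n x| ≤ B) {x : ℝ}
    (hx : x ∈ Icc ξ (ξ + h)) :
    |F 0 x - ∑ k ∈ Finset.range n, F k ξ * ((x - ξ) ^ k / k.factorial)| ≤ B * h ^ n := by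
  induction n generalizing F x with
  | zero => simpa using hB x hx
  | succ n ih =>
    have hh : 0 ≤ h := by linarith [hx.1, hx.2]
    have hB0 : 0 ≤ B := (abs_nonneg _).trans (hB x hx)
    have hd : ∀ y, HasDerivAt (fun y => F 0 y - ∑ k ∈ Finset.range (n + 1),
        F k ξ * ((y - ξ) ^ k / k.factorial))
        (F 1 y - ∑ k ∈ Finset.range n, F (k + 1) ξ * ((y - ξ) ^ k / k.factorial)) y := by
      intro y
      refine (hF 0 y).sub ?_
      have h1 : HasDerivAt (fun y => ∑ k ∈ Finset.range (n + 1),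
          F k ξ * ((y - ξ) ^ k / k.factorial)) (∑ k ∈ Finset.range (n + 1),
          F k ξ * (k * (y - ξ) ^ (k - 1) * 1 / k.factorial)) y := by
        refine HasDerivAt.fun_sum fun k _ => ?_
        exact ((((hasDerivAt_id y).sub_const ξ).pow k).div_const _).const_mul _
      refine h1.congr_deriv ?_
      rw [Finset.sum_range_succ']
      simp only [Nat.cast_zero, zero_mul, zero_div, mul_zero, add_zero]
      refine Finset.sum_congr rfl fun k _ => ?_
      rw [Nat.factorial_succ]
      push_cast
      have : ((k : ℝ) + 1) ≠ 0 := by positivity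
      field_simp
    have h2 := norm_image_sub_le_of_norm_deriv_right_le_segment (C := B * h ^ n)
      (a := ξ) (b := ξ + h) (fun y _ => (hd y).continuousAt.continuousWithinAt)
      (fun y _ => (hd y).hasDerivWithinAt) (fun y hy => ?_) x hx
    · rw [Finset.sum_range_succ' _ n, Finset.sum_range_succ' (fun k => F k ξ * ((ξ - ξ) ^ k / _)) n]
        at h2
      simp only [sub_self, ne_eq, Nat.add_eq_zero_iff, one_ne_zero, and_false, not_false_eq_true,
        zero_pow, zero_div, mul_zero, Finset.sum_const_zero, pow_zero, Nat.factorial_zero,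
        Nat.cast_one, div_one, mul_one, zero_add, sub_zero, Real.norm_eq_abs] at h2
      rw [Finset.sum_range_succ']
      simp only [pow_zero, Nat.factorial_zero, Nat.cast_one, div_one, mul_one]
      refine h2.trans ?_
      rw [pow_succ, ← mul_assoc]
      gcongr
      linarith [hx.2]
    · exact ih (F := fun k => F (k + 1)) (fun k x => hF (k + 1) x) hB ⟨hy.1, hy.2.le⟩

/-- With `F 0` a primitive of the integrand, the quadrature error begins with `-h⁵ F 5/4320 - h⁶ F
6/8640`. Both terms are contained in the difference of `F 4` at the end points, which telescopes
over the grid. -/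
lemma abs_gauss_step_le {F : ℕ → ℝ → ℝ} (hF : ∀ k x, HasDerivAt (F k) (F (k + 1) x) x)
    {ξ h B : ℝ} (hh : 0 < h) (hB : ∀ x ∈ Icc ξ (ξ + h), |F 7 x| ≤ B) :
    |h * gaussMean (F 1) ξ h - (F 0 (ξ + h) - F 0 ξ) + h ^ 4 / 4320 * (F 4 (ξ + h) - F 4 ξ)| ≤
      3 * B * h ^ 7 := by
  have hB0 : 0 ≤ B := (abs_nonneg _).trans (hB ξ ⟨le_rfl, by linarith⟩)
  have hr : ξ + h ∈ Icc ξ (ξ + h) := ⟨by linarith, le_rfl⟩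
  have t0 := abs_sub_taylor_le hF 7 hB hr
  have t1 := abs_sub_taylor_le (F := fun k => F (k + 1)) (fun k x => hF (k + 1) x) 6 hB
    (gauss₁_mem (ξ := ξ) hh)
  have t2 := abs_sub_taylor_le (F := fun k => F (k + 1)) (fun k x => hF (k + 1) x) 6 hB
    (gauss₂_mem (ξ := ξ) hh)
  have t4 := abs_sub_taylor_le (F := fun k => F (k + 4)) (fun k x => hF (k + 4) x) 3 hB hr
  have e1 : gauss₁ ξ h - ξ = (1 / 2 - √3 / 6) * h := by rw [gauss₁]; ring
  have e2 : gauss₂ ξ h - ξ = (1 / 2 + √3 / 6) * h := by rw [gauss₂]; ring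
  rw [e1] at t1
  rw [e2] at t2
  simp only [Finset.sum_range_succ, Finset.sum_range_zero, Nat.factorial, add_sub_cancel_left]
    at t0 t1 t2 t4
  norm_num at t0 t1 t2 t4
  have s2 : √3 ^ 2 = 3 := Real.sq_sqrt (by norm_num)
  set u := √3 with hu
  -- With the Taylor remainders as free variables, the cancellation is a polynomial identity modulo
  -- `u² = 3`.
  have key : ∀ R0 R1 R2 R4 : ℝ,
      F 0 (ξ + h) = R0 + (F 0 ξ + F 1 ξ * h + F 2 ξ * (h ^ 2 / 2) + F 3 ξ * (h ^ 3 / 6) +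
        F 4 ξ * (h ^ 4 / 24) + F 5 ξ * (h ^ 5 / 120) + F 6 ξ * (h ^ 6 / 720)) →
      F 1 (gauss₁ ξ h) = R1 + (F 1 ξ + F 2 ξ * ((1 / 2 - u / 6) * h) +
        F 3 ξ * (((1 / 2 - u / 6) * h) ^ 2 / 2) + F 4 ξ * (((1 / 2 - u / 6) * h) ^ 3 / 6) +
        F 5 ξ * (((1 / 2 - u / 6) * h) ^ 4 / 24) + F 6 ξ * (((1 / 2 - u / 6) * h) ^ 5 / 120)) →
      F 1 (gauss₂ ξ h) = R2 + (F 1 ξ + F 2 ξ * ((1 / 2 + u / 6) * h) +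
        F 3 ξ * (((1 / 2 + u / 6) * h) ^ 2 / 2) + F 4 ξ * (((1 / 2 + u / 6) * h) ^ 3 / 6) +
        F 5 ξ * (((1 / 2 + u / 6) * h) ^ 4 / 24) + F 6 ξ * (((1 / 2 + u / 6) * h) ^ 5 / 120)) →
      F 4 (ξ + h) = R4 + (F 4 ξ + F 5 ξ * h + F 6 ξ * (h ^ 2 / 2)) →
      h * gaussMean (F 1) ξ h - (F 0 (ξ + h) - F 0 ξ) + h ^ 4 / 4320 * (F 4 (ξ + h) - F 4 ξ) =
        h * (R1 + R2) / 2 - R0 + h ^ 4 / 4320 * R4 := by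
    intro R0 R1 R2 R4 h0 h1 h2 h4
    rw [gaussMean, h0, h1, h2, h4]
    have s3 : u ^ 4 = 9 := by rw [show u ^ 4 = (u ^ 2) ^ 2 by ring, s2]; norm_num
    ring_nf
    rw [s2, s3]
    ring
  have K := key _ _ _ _ (sub_add_cancel _ _).symm (sub_add_cancel _ _).symm
    (sub_add_cancel _ _).symm (sub_add_cancel _ _).symm
  rw [K]
  rw [abs_le] at t0 t1 t2 t4
  have h4 : 0 ≤ B * h ^ 7 := by positivity
  have b1 := mul_le_mul_of_nonneg_left t1.1 hh.le
  have b1' := mul_le_mul_of_nonneg_left t1.2 hh.le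
  have b2 := mul_le_mul_of_nonneg_left t2.1 hh.le
  have b2' := mul_le_mul_of_nonneg_left t2.2 hh.le
  have b4 := mul_le_mul_of_nonneg_left t4.1 (by positivity : 0 ≤ h ^ 4 / 4320)
  have b4' := mul_le_mul_of_nonneg_left t4.2 (by positivity : 0 ≤ h ^ 4 / 4320)
  have m1 : h * (B * h ^ 6) = B * h ^ 7 := by ring
  have m4 : h ^ 4 / 4320 * (B * h ^ 3) = B * h ^ 7 / 4320 := by ring
  rw [mul_neg, m1] at b1 b2
  rw [m1] at b1' b2'
  rw [mul_neg, m4] at b4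
  rw [m4] at b4'
  rw [abs_le]
  constructor <;> linarith [t0.1, t0.2]

/-- The prefactor `√3 h/12` times the distance `h/√3` of the nodes is `h²/12`. The nodes are
symmetric about the midpoint, which is why the slope there appears. -/
lemma abs_sub_gaussDiff_le {F : ℕ → ℝ → ℝ} (hF : ∀ k x, HasDerivAt (F k) (F (k + 1) x) x)
    {ξ h B : ℝ} (hh : 0 < h) (hB : ∀ x ∈ Icc ξ (ξ + h), |F 3 x| ≤ B) :
    |gaussDiff (F 0) ξ h - h ^ 2 / 12 * (F 1 ξ + F 2 ξ * h / 2)| ≤ B * h ^ 4 := by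
  have hB0 : 0 ≤ B := (abs_nonneg _).trans (hB ξ ⟨le_rfl, by linarith⟩)
  have t1 := abs_sub_taylor_le hF 3 hB (gauss₁_mem (ξ := ξ) hh)
  have t2 := abs_sub_taylor_le hF 3 hB (gauss₂_mem (ξ := ξ) hh)
  have e1 : gauss₁ ξ h - ξ = (1 / 2 - √3 / 6) * h := by rw [gauss₁]; ring
  have e2 : gauss₂ ξ h - ξ = (1 / 2 + √3 / 6) * h := by rw [gauss₂]; ring
  rw [e1] at t1
  rw [e2] at t2
  simp only [Finset.sum_range_succ, Finset.sum_range_zero, Nat.factorial] at t1 t2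
  norm_num at t1 t2
  have s2 : √3 ^ 2 = 3 := Real.sq_sqrt (by norm_num)
  have s0 : 0 ≤ √3 := Real.sqrt_nonneg _
  have s1 : √3 ≤ 2 := Real.sqrt_le_iff.2 ⟨by norm_num, by norm_num⟩
  have key : ∀ R1 R2 : ℝ,
      F 0 (gauss₁ ξ h) = R1 + (F 0 ξ + F 1 ξ * ((1 / 2 - √3 / 6) * h) +
        F 2 ξ * (((1 / 2 - √3 / 6) * h) ^ 2 / 2)) →
      F 0 (gauss₂ ξ h) = R2 + (F 0 ξ + F 1 ξ * ((1 / 2 + √3 / 6) * h) +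
        F 2 ξ * (((1 / 2 + √3 / 6) * h) ^ 2 / 2)) →
      gaussDiff (F 0) ξ h - h ^ 2 / 12 * (F 1 ξ + F 2 ξ * h / 2) = √3 / 12 * h * (R2 - R1) := by
    intro R1 R2 h1 h2
    rw [gaussDiff, h1, h2]
    linear_combination (h ^ 2 / 36 * (F 1 ξ + F 2 ξ * h / 2)) * s2
  have K := key _ _ (sub_add_cancel _ _).symm (sub_add_cancel _ _).symm
  rw [K, abs_mul, abs_of_nonneg (by positivity)]
  calc _ ≤ 2 / 12 * h * (B * h ^ 3 + B * h ^ 3) := by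
        gcongr
        exact (abs_sub _ _).trans (add_le_add t2 t1)
    _ = B * h ^ 4 / 3 := by ring
    _ ≤ _ := by
      have : 0 ≤ B * h ^ 4 := by positivity
      linarith

/-- To leading order `h d²` is `h⁴/144` times the midpoint rule for the squared derivative. For a
linear derivative with slope `A2`, the rule differs from the integral by `A2² h³/12`, hence the term
`A2² h⁷/1728`. -/
lemma abs_gaussDiff_sq_step_le {F : ℕ → ℝ → ℝ} (hF : ∀ k x, HasDerivAt (F k) (F (k + 1) x) x)
    {ξ h B : ℝ} (hh : 0 < h) (hB : ∀ k ≤ 3, ∀ x ∈ Icc ξ (ξ + h), |F k x| ≤ B) :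
    |h * gaussDiff (F 0) ξ h ^ 2 - h ^ 4 / 144 * ∫ x in ξ..(ξ + h), F 1 x ^ 2| ≤
      3 * B ^ 2 * h ^ 7 * (1 + h + h ^ 2) := by
  have hm : ξ ∈ Icc ξ (ξ + h) := ⟨le_rfl, by linarith⟩
  have hB0 : 0 ≤ B := (abs_nonneg _).trans (hB 0 (by norm_num) ξ hm)
  have hA := hB 1 (by norm_num) ξ hm
  have hA2 := hB 2 (by norm_num) ξ hm
  have hd := abs_sub_gaussDiff_le hF hh (hB 3 le_rfl)
  set A := F 1 ξ
  set A2 := F 2 ξ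
  have hAx : ∀ s, 0 ≤ s → s ≤ h → |A + A2 * s| ≤ B * (1 + h) := by
    intro s hs hsh
    calc |A + A2 * s| ≤ |A| + |A2| * |s| := by rw [← abs_mul]; exact abs_add_le _ _
      _ ≤ B + B * h := by
        rw [abs_of_nonneg hs]
        gcongr
      _ = _ := by ring
  have hint : |∫ x in ξ..(ξ + h), (F 1 x ^ 2 - (A + A2 * (x - ξ)) ^ 2)| ≤
      (B * h ^ 2) * (2 * (B * (1 + h)) + B * h ^ 2) * h := by
    have := intervalIntegral.norm_integral_le_of_norm_le_const (a := ξ) (b := ξ + h)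
      (f := fun x => F 1 x ^ 2 - (A + A2 * (x - ξ)) ^ 2)
      (C := (B * h ^ 2) * (2 * (B * (1 + h)) + B * h ^ 2)) (fun x hx => ?_)
    · rwa [add_sub_cancel_left, abs_of_pos hh, Real.norm_eq_abs] at this
    · rw [uIoc_of_le (by linarith)] at hx
      have t := abs_sub_taylor_le (F := fun k => F (k + 1)) (fun k x => hF (k + 1) x) 2
        (hB 3 le_rfl) ⟨hx.1.le, hx.2⟩
      simp only [Finset.sum_range_succ, Finset.sum_range_zero, Nat.factorial] at t
      norm_num at t
      have e : F 1 x ^ 2 - (A + A2 * (x - ξ)) ^ 2 = (F 1 x - (A + A2 * (x - ξ))) *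
        (2 * (A + A2 * (x - ξ)) + (F 1 x - (A + A2 * (x - ξ)))) := by ring
      rw [e, norm_mul, Real.norm_eq_abs, Real.norm_eq_abs]
      gcongr
      refine (abs_add_le _ _).trans (add_le_add ?_ t)
      rw [abs_mul, abs_two]
      gcongr
      exact hAx _ (by linarith [hx.1]) (by linarith [hx.2])
  have hpoly : ∫ x in ξ..(ξ + h), (A + A2 * (x - ξ)) ^ 2 =
      A ^ 2 * h + A * A2 * h ^ 2 + A2 ^ 2 * h ^ 3 / 3 := by
    have hc : Continuous fun x => (A + A2 * (x - ξ)) ^ 2 := by fun_prop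
    rw [intervalIntegral.integral_eq_sub_of_hasDerivAt
      (f := fun x => A ^ 2 * (x - ξ) + A * A2 * (x - ξ) ^ 2 + A2 ^ 2 * ((x - ξ) ^ 3 / 3))
      (fun x _ => ?_) (hc.intervalIntegrable _ _)]
    · ring
    · have h1 := (hasDerivAt_id x).sub_const ξ
      refine (((h1.const_mul (A ^ 2)).add ((h1.pow 2).const_mul (A * A2))).add
        (((h1.pow 3).div_const 3).const_mul (A2 ^ 2))).congr_deriv ?_
      simp only [id]
      push_cast
      ring
  have hc1 : Continuous fun x => F 1 x ^ 2 :=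
    (continuous_iff_continuousAt.2 fun x => (hF 1 x).continuousAt).pow 2
  have hc : Continuous fun x => (A + A2 * (x - ξ)) ^ 2 := by fun_prop
  rw [intervalIntegral.integral_sub (hc1.intervalIntegrable _ _)
    (hc.intervalIntegrable _ _), hpoly] at hint
  set I := ∫ x in ξ..(ξ + h), F 1 x ^ 2
  set e := gaussDiff (F 0) ξ h - h ^ 2 / 12 * (A + A2 * h / 2) with he
  have hde : gaussDiff (F 0) ξ h = e + h ^ 2 / 12 * (A + A2 * (h / 2)) := by rw [he]; ring
  have hAh := hAx (h / 2) (by positivity) (by linarith)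
  have eq : h * gaussDiff (F 0) ξ h ^ 2 - h ^ 4 / 144 * I =
      h * (e * (e + h ^ 2 / 6 * (A + A2 * (h / 2)))) -
      h ^ 4 / 144 * (I - (A ^ 2 * h + A * A2 * h ^ 2 + A2 ^ 2 * h ^ 3 / 3)) -
      A2 ^ 2 * (h ^ 7 / 1728) := by
    rw [hde]; ring
  rw [eq]
  have p1 : |h * (e * (e + h ^ 2 / 6 * (A + A2 * (h / 2))))| ≤
      h * ((B * h ^ 4) * (B * h ^ 4 + h ^ 2 / 6 * (B * (1 + h)))) := by
    rw [abs_mul, abs_mul, abs_of_pos hh]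
    gcongr
    refine (abs_add_le _ _).trans (add_le_add hd ?_)
    rw [abs_mul, abs_of_nonneg (by positivity : 0 ≤ h ^ 2 / 6)]
    gcongr
  have p2 : |h ^ 4 / 144 * (I - (A ^ 2 * h + A * A2 * h ^ 2 + A2 ^ 2 * h ^ 3 / 3))| ≤
      h ^ 4 / 144 * ((B * h ^ 2) * (2 * (B * (1 + h)) + B * h ^ 2) * h) := by
    rw [abs_mul, abs_of_nonneg (by positivity : 0 ≤ h ^ 4 / 144)]
    gcongr
  have p3 : |A2 ^ 2 * (h ^ 7 / 1728)| ≤ B ^ 2 * (h ^ 7 / 1728) := by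
    rw [abs_mul, abs_of_nonneg (by positivity : 0 ≤ h ^ 7 / 1728), abs_pow]
    gcongr
  refine (abs_sub _ _).trans ((add_le_add ((abs_sub _ _).trans (add_le_add p1 p2)) p3).trans ?_)
  have q0 : 0 ≤ B ^ 2 * h ^ 7 := by positivity
  have q1 : 0 ≤ B ^ 2 * h ^ 8 := by positivity
  have q2 : 0 ≤ B ^ 2 * h ^ 9 := by positivity
  nlinarith

namespace ExpDecay

variable {g : ℝ → ℝ} {K β h₀ h ξ : ℝ}

lemma hasDerivAt_iteratedDeriv (hg : ExpDecay g K β) (k : ℕ) (x : ℝ) :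
    HasDerivAt (iteratedDeriv k g) (iteratedDeriv (k + 1) g x) x := by
  rw [iteratedDeriv_succ]
  exact ((hg.contDiff.differentiable_iteratedDeriv k
    (by exact_mod_cast WithTop.coe_lt_top _)).differentiableAt).hasDerivAt

lemma sum_integral_grid {F : ℝ → ℝ} (hF : Continuous F) (h : ℝ) (N : ℕ) :
    ∑ k ∈ Finset.range N, ∫ x in grid h N k..(grid h N k + h), F x = ∫ x in (-(N * h))..0, F x := by
  have := intervalIntegral.sum_integral_adjacent_intervals (f := F) (a := grid h N) (n := N)
    (μ := MeasureTheory.volume) (fun k _ => hF.intervalIntegrable _ _)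
  rw [grid_zero, grid_self] at this
  rw [← this]
  exact Finset.sum_congr rfl fun k _ => by rw [grid_succ]

lemma grid_add_nonpos (hh : 0 < h) {N k : ℕ} (hk : k < N) : grid h N k + h ≤ 0 := by
  rw [← grid_succ]; exact grid_nonpos hh hk

lemma abs_sum_le_of_step {h β C : ℝ} (hβ : 0 < β) (hC : 0 ≤ C) {N : ℕ} {f : ℕ → ℝ}
    (hf : ∀ k < N, |f k| ≤ C * (h * Real.exp (β * grid h N k))) :
    |∑ k ∈ Finset.range N, f k| ≤ C * (1 / β) := by
  refine (Finset.abs_sum_le_sum_abs _ _).trans ?_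
  refine (Finset.sum_le_sum fun k hk => hf k (Finset.mem_range.1 hk)).trans ?_
  rw [← Finset.mul_sum]
  gcongr
  exact sum_mul_exp_grid_le hβ N

/-- The error of composite Gauss quadrature on `[-N h, 0]`. -/
lemma abs_sum_gaussMean_sub_le (hg : ExpDecay g K β) (h₀ : ℝ) :
    ∃ C, 0 ≤ C ∧ ∀ (h : ℝ) (N : ℕ), 0 < h → h ≤ h₀ →
      |∑ k ∈ Finset.range N, h * gaussMean g (grid h N k) h - (∫ x in (-(N * h))..0, g x) +
        h ^ 4 / 4320 * iteratedDeriv 3 g 0| ≤ C * (h ^ 6 + h ^ 4 * Real.exp (-β * (N * h))) := by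
  have hβ := hg.rate_pos
  have hK := hg.pos
  refine ⟨3 * (K * Real.exp (β * h₀)) * (1 / β) + K, by positivity, fun h N hh hh₀ => ?_⟩
  have hstep : ∀ k < N, |h * gaussMean g (grid h N k) h -
      (∫ x in grid h N k..(grid h N k + h), g x) + h ^ 4 / 4320 *
      (iteratedDeriv 3 g (grid h N (k + 1)) - iteratedDeriv 3 g (grid h N k))| ≤
      (3 * (K * Real.exp (β * h₀)) * h ^ 6) * (h * Real.exp (β * grid h N k)) := by
    intro k hk
    rw [grid_succ]
    set ξ := grid h N k with hξ
    -- The shift by a primitive makes `F 7` the sixth derivative of `g`, the last one that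
    -- `ExpDecay` controls.
    let F : ℕ → ℝ → ℝ
      | 0 => fun x => ∫ s in ξ..x, g s
      | m + 1 => iteratedDeriv m g
    have hF : ∀ n x, HasDerivAt (F n) (F (n + 1) x) x := by
      intro n x
      cases n with
      | zero =>
        have : HasDerivAt (fun x => ∫ s in ξ..x, g s) (g x) x :=
          intervalIntegral.integral_hasDerivAt_right (hg.continuous.intervalIntegrable _ _)
            (hg.continuous.stronglyMeasurableAtFilter _ _) hg.continuous.continuousAt
        simpa [F] using this
      | succ m => exact hg.hasDerivAt_iteratedDeriv m x
    have h1 : |h * gaussMean (iteratedDeriv 0 g) ξ h -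
        ((∫ s in ξ..(ξ + h), g s) - ∫ s in ξ..ξ, g s) +
        h ^ 4 / 4320 * (iteratedDeriv 3 g (ξ + h) - iteratedDeriv 3 g ξ)| ≤
        3 * (K * Real.exp (β * h₀) * Real.exp (β * ξ)) * h ^ 7 :=
      abs_gauss_step_le hF hh fun x hx =>
        hg.abs_iteratedDeriv_le_step hh₀ (grid_add_nonpos hh hk) (k := 6) le_rfl hx
    rw [iteratedDeriv_zero, intervalIntegral.integral_same, sub_zero] at h1
    exact h1.trans (le_of_eq (by ring))
  have hsum := abs_sum_le_of_step hβ (by positivity) hstep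
  -- The third derivatives telescope. The value at `-L` is exponentially small; the one at `0` stays
  -- in the statement, to be cancelled by the other half-line.
  rw [Finset.sum_add_distrib, Finset.sum_sub_distrib, ← Finset.mul_sum _ _ (h ^ 4 / 4320),
    Finset.sum_range_sub (fun k => iteratedDeriv 3 g (grid h N k)), sum_integral_grid hg.continuous, grid_self, grid_zero] at hsum
  have hlast := hg.bound 3 (by norm_num) (-(N * h)) (by
    have : 0 ≤ (N : ℝ) * h := by positivity
    linarith)
  set S := ∑ k ∈ Finset.range N, h * gaussMean g (grid h N k) h
  have e : S - (∫ x in (-(N * h))..0, g x) + h ^ 4 / 4320 * iteratedDeriv 3 g 0 =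
    (S - (∫ x in (-(N * h))..0, g x) + h ^ 4 / 4320 *
      (iteratedDeriv 3 g 0 - iteratedDeriv 3 g (-(N * h)))) +
      h ^ 4 / 4320 * iteratedDeriv 3 g (-(N * h)) := by ring
  rw [e]
  have p2 : |h ^ 4 / 4320 * iteratedDeriv 3 g (-(N * h))| ≤
      K * (h ^ 4 * Real.exp (-β * (N * h))) := by
    rw [abs_mul, abs_of_nonneg (by positivity)]
    calc _ ≤ h ^ 4 / 1 * (K * Real.exp (β * -(N * h))) := by gcongr; norm_num
      _ = _ := by rw [mul_neg, ← neg_mul]; ring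
  refine (abs_add_le _ _).trans ((add_le_add hsum p2).trans ?_)
  have q1 : 0 ≤ 3 * (K * Real.exp (β * h₀)) * (1 / β) * (h ^ 4 * Real.exp (-β * (N * h))) := by
    positivity
  have q2 : 0 ≤ K * h ^ 6 := by positivity
  nlinarith

/-- The sum of the squares of the scaled differences over the Gauss points. -/
lemma abs_sum_gaussDiff_sq_sub_le (hg : ExpDecay g K β) (h₀ : ℝ) :
    ∃ C, 0 ≤ C ∧ ∀ (h : ℝ) (N : ℕ), 0 < h → h ≤ h₀ →
      |∑ k ∈ Finset.range N, h * gaussDiff g (grid h N k) h ^ 2 -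
        h ^ 4 / 144 * ∫ x in Iic 0, deriv g x ^ 2| ≤
          C * (h ^ 6 + h ^ 4 * Real.exp (-β * (N * h))) := by
  have hβ := hg.rate_pos
  have hK := hg.pos
  set H := K * Real.exp (β * h₀) with hH
  have hcd : Continuous fun x => deriv g x ^ 2 := by
    have : Continuous (deriv g) := by
      have := hg.contDiff.continuous_iteratedDeriv 1 (by exact_mod_cast le_top)
      simpa using this
    exact this.pow 2
  refine ⟨3 * H ^ 2 * (1 + |h₀| + |h₀| ^ 2) * (1 / β) + K ^ 2 / β, by positivity,
    fun h N hh hh₀ => ?_⟩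
  have habs : h ≤ |h₀| := hh₀.trans (le_abs_self _)
  have hstep : ∀ k < N, |h * gaussDiff g (grid h N k) h ^ 2 -
      h ^ 4 / 144 * ∫ x in grid h N k..(grid h N k + h), deriv g x ^ 2| ≤
      (3 * H ^ 2 * (1 + |h₀| + |h₀| ^ 2) * h ^ 6) * (h * Real.exp (β * grid h N k)) := by
    intro k hk
    have hle1 := hg.exp_le_one (grid_nonpos hh hk.le)
    have h1 := abs_gaussDiff_sq_step_le hg.hasDerivAt_iteratedDeriv hh (ξ := grid h N k)
      fun j hj x hx => hg.abs_iteratedDeriv_le_step hh₀ (grid_add_nonpos hh hk) (k := j)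
        (by omega) hx
    simp only [iteratedDeriv_zero, iteratedDeriv_one] at h1
    refine h1.trans ?_
    rw [← hH]
    have h2 : (H * Real.exp (β * grid h N k)) ^ 2 ≤ H ^ 2 * Real.exp (β * grid h N k) := by
      rw [mul_pow]
      gcongr
      exact pow_le_of_le_one (Real.exp_pos _).le hle1 (by norm_num)
    calc _ ≤ 3 * (H ^ 2 * Real.exp (β * grid h N k)) * h ^ 7 * (1 + |h₀| + |h₀| ^ 2) := by gcongr
      _ = _ := by ring
  have hsum := abs_sum_le_of_step hβ (by positivity) hstep
  rw [Finset.sum_sub_distrib, ← Finset.mul_sum _ _ (h ^ 4 / 144), sum_integral_grid hcd] at hsum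
  have hb : ∀ s ≤ 0, ‖deriv g s ^ 2‖ ≤ K ^ 2 * Real.exp (β * s) := by
    intro s hs
    rw [norm_pow, Real.norm_eq_abs]
    calc _ ≤ (K * Real.exp (β * s)) ^ 2 := by gcongr; exact hg.abs_deriv_le hs
      _ ≤ _ := by
        rw [mul_pow]
        gcongr
        exact pow_le_of_le_one (Real.exp_pos _).le (hg.exp_le_one hs) (by norm_num)
  have hL : -(N * h : ℝ) ≤ 0 := by
    have : 0 ≤ (N : ℝ) * h := by positivity
    linarith
  have hi := integrableOn_Iic_of_le_exp hcd hβ hb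
  have htail := norm_integral_Iic_le hβ hb hL
  have hsplit := intervalIntegral.integral_Iic_sub_Iic (hi (-(N * h))) (hi 0)
  rw [← hsplit] at hsum
  set S := ∑ k ∈ Finset.range N, h * gaussDiff g (grid h N k) h ^ 2
  set I := ∫ x in Iic 0, deriv g x ^ 2
  set J := ∫ x in Iic (-(N * h : ℝ)), deriv g x ^ 2
  have e : S - h ^ 4 / 144 * I = (S - h ^ 4 / 144 * (I - J)) - h ^ 4 / 144 * J := by ring
  rw [e]
  have p2 : |h ^ 4 / 144 * J| ≤ K ^ 2 / β * (h ^ 4 * Real.exp (-β * (N * h))) := by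
    rw [abs_mul, abs_of_nonneg (by positivity)]
    calc _ ≤ h ^ 4 / 1 * (K ^ 2 / β * Real.exp (β * -(N * h))) := by
          gcongr
          · norm_num
          · exact htail
      _ = _ := by rw [mul_neg, ← neg_mul]; ring
  refine (abs_sub _ _).trans ((add_le_add hsum p2).trans ?_)
  have q1 : 0 ≤ 3 * H ^ 2 * (1 + |h₀| + |h₀| ^ 2) * (1 / β) *
    (h ^ 4 * Real.exp (-β * (N * h))) := by positivity
  have q2 : 0 ≤ K ^ 2 / β * h ^ 6 := by positivity
  nlinarith

/-- The Riemann sum of the squares of the means over the Gauss points. -/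
lemma abs_sum_gaussMean_sq_sub_le (hg : ExpDecay g K β) (h₀ : ℝ) :
    ∃ C, 0 ≤ C ∧ ∀ (h : ℝ) (N : ℕ), 0 < h → h ≤ h₀ →
      |∑ k ∈ Finset.range N, h * gaussMean g (grid h N k) h ^ 2 -
        ∫ x in (-(N * h))..0, g x ^ 2| ≤ C * h := by
  have hβ := hg.rate_pos
  have hK := hg.pos
  set H := K * Real.exp (β * h₀) with hH
  have hcd : Continuous fun x => g x ^ 2 := hg.continuous.pow 2
  -- First order is enough: this sum enters divided by `q³`, and `|q|⁻¹ ≤ h` supplies a second power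
  -- of `h`.
  refine ⟨2 * H ^ 2 * (1 / β), by positivity, fun h N hh hh₀ => ?_⟩
  have hstep : ∀ k < N, |h * gaussMean g (grid h N k) h ^ 2 -
      ∫ x in grid h N k..(grid h N k + h), g x ^ 2| ≤
      (2 * H ^ 2 * h) * (h * Real.exp (β * grid h N k)) := by
    intro k hk
    have hle1 := hg.exp_le_one (grid_nonpos hh hk.le)
    have hξ := grid_add_nonpos hh hk
    set ξ := grid h N k
    have e : h * gaussMean g ξ h ^ 2 - ∫ x in ξ..(ξ + h), g x ^ 2 =
        ∫ x in ξ..(ξ + h), (gaussMean g ξ h ^ 2 - g x ^ 2) := by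
      rw [intervalIntegral.integral_sub (by simp) (hcd.intervalIntegrable _ _)]
      simp
    have hn := intervalIntegral.norm_integral_le_of_norm_le_const (a := ξ) (b := ξ + h)
      (f := fun x => gaussMean g ξ h ^ 2 - g x ^ 2)
      (C := H * h * Real.exp (β * ξ) * (H * 1 + H * 1)) (fun x hx => ?_)
    · rw [← e, add_sub_cancel_left, abs_of_pos hh, Real.norm_eq_abs] at hn
      exact hn.trans (le_of_eq (by ring))
    · rw [uIoc_of_le (by linarith)] at hx
      have hx' : x ∈ Icc ξ (ξ + h) := ⟨hx.1.le, hx.2⟩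
      rw [sq_sub_sq, mul_comm, norm_mul, Real.norm_eq_abs, Real.norm_eq_abs]
      have hHp : 0 < H := by positivity
      gcongr
      · exact hg.abs_gaussMean_sub_le hh hh₀ hξ hx'
      · refine (abs_add_le _ _).trans (add_le_add ?_ ?_)
        · exact (hg.abs_gaussMean_le hh hh₀ hξ).trans (by gcongr)
        · exact (hg.abs_le_step hh₀ hξ hx').trans (by gcongr)
  have hsum := abs_sum_le_of_step hβ (by positivity) hstep
  rw [Finset.sum_sub_distrib, sum_integral_grid hcd] at hsum
  exact hsum.trans (le_of_eq (by ring))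

end ExpDecay

end EvansMagnus

/-! ### Passage between the system and its scaled coordinates. -/

namespace EvansMagnus

open Set

/-- `y` solves `y' = A(ξ; λ) y` on `(-∞, 0]`, and `y(ξ) ∼ exp(μ ξ) (1, μ)` as `ξ → -∞`. -/
def IsHalfSolution (c : ℝ) (φ : ℝ → ℝ) (lam μ : ℂ) (y : ℝ → Fin 2 → ℂ) : Prop :=
  (∀ ξ ∈ Iic (0 : ℝ),
    HasDerivWithinAt y (potentialCoeff c φ lam ξ *ᵥ y ξ) (Iic 0) ξ) ∧
  Tendsto (fun ξ : ℝ => Complex.exp (-μ * (ξ : ℂ)) • y ξ) atBot (𝓝 ![1, μ])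

section Scaled

variable {c : ℝ} {φ g : ℝ → ℝ} {φinf : ℝ} {lam q : ℂ} {y : ℝ → Fin 2 → ℂ} {a b : ℝ → ℂ}

lemma IsScaledSolution.isHalfSolution (h : IsScaledSolution g q a b)
    (hφ : ∀ x, φ x = φinf + g x) (hq : q ^ 2 = (c : ℂ) ^ 2 / 4 + lam - φinf) (hq0 : q ≠ 0) :
    IsHalfSolution c φ lam (q - c / 2)
      (fun ξ => Complex.exp ((q - c / 2) * ξ) • eigenVec c q (a ξ) (b ξ)) := by
  have hlam : lam = q ^ 2 - (c : ℂ) ^ 2 / 4 + φinf := by rw [hq]; ring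
  constructor
  · intro ξ hξ
    have ha := h.hasDeriv_fst ξ hξ
    have hb := h.hasDeriv_snd ξ hξ
    have he := (hasDerivAt_cexp_mul_ofReal (q - c / 2) ξ).hasDerivWithinAt (s := Iic 0)
    rw [hasDerivWithinAt_pi]
    intro i
    fin_cases i
    · refine (he.mul (ha.add hb)).congr_deriv ?_
      simp [potentialCoeff, eigenVec, Matrix.mulVec, dotProduct, Fin.sum_univ_two]
      ring
    · refine (he.mul ((ha.const_mul (q - c / 2)).add (hb.const_mul (-q - c / 2)))).congr_deriv ?_
      simp [potentialCoeff, eigenVec, Matrix.mulVec, dotProduct, Fin.sum_univ_two, hφ, hlam]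
      field_simp
      ring
  · have h1 : ∀ ξ : ℝ, Complex.exp (-(q - c / 2) * ξ) •
        (Complex.exp ((q - c / 2) * ξ) • eigenVec c q (a ξ) (b ξ)) = eigenVec c q (a ξ) (b ξ) := by
      intro ξ
      rw [smul_smul, ← Complex.exp_add, neg_mul, neg_add_cancel, Complex.exp_zero, one_smul]
    simp only [h1]
    rw [tendsto_pi_nhds]
    intro i
    fin_cases i
    · simpa [eigenVec] using h.tendsto_fst.add h.tendsto_snd
    · simpa [eigenVec] using (h.tendsto_fst.const_mul (q - c / 2 : ℂ)).add
        (h.tendsto_snd.const_mul (-q - c / 2 : ℂ))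

/-- Any solution with the right asymptotics is covered, so the later estimates apply to whichever
one the choice operator selects. -/
lemma IsHalfSolution.exists_scaled (h : IsHalfSolution c φ lam (q - c / 2) y)
    (hφ : ∀ x, φ x = φinf + g x) (hq : q ^ 2 = (c : ℂ) ^ 2 / 4 + lam - φinf) (hq0 : q ≠ 0) :
    ∃ a b, IsScaledSolution g q a b ∧
      ∀ ξ, y ξ = Complex.exp ((q - c / 2) * ξ) • eigenVec c q (a ξ) (b ξ) := by
  have hlam : lam = q ^ 2 - (c : ℂ) ^ 2 / 4 + φinf := by rw [hq]; ring
  have hexp : ∀ ξ : ℝ, Complex.exp ((q - c / 2) * ξ) * Complex.exp (-(q - c / 2) * ξ) = 1 := by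
    intro ξ
    rw [← Complex.exp_add, neg_mul, add_neg_cancel, Complex.exp_zero]
  refine ⟨fun ξ => Complex.exp (-(q - c / 2) * ξ) * ((y ξ 1 + (q + c / 2) * y ξ 0) / (2 * q)),
    fun ξ => Complex.exp (-(q - c / 2) * ξ) * (((q - c / 2) * y ξ 0 - y ξ 1) / (2 * q)),
    ⟨?_, ?_, ?_, ?_⟩, ?_⟩
  · intro ξ hξ
    have he := (hasDerivAt_cexp_mul_ofReal (-(q - c / 2)) ξ).hasDerivWithinAt (s := Iic 0)
    have hy := hasDerivWithinAt_pi.1 (h.1 ξ hξ)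
    refine (he.mul (((hy 1).add ((hy 0).const_mul (q + c / 2))).div_const (2 * q))).congr_deriv ?_
    simp [potentialCoeff, Matrix.mulVec, dotProduct, Fin.sum_univ_two, hφ, hlam]
    field_simp
    ring
  · intro ξ hξ
    have he := (hasDerivAt_cexp_mul_ofReal (-(q - c / 2)) ξ).hasDerivWithinAt (s := Iic 0)
    have hy := hasDerivWithinAt_pi.1 (h.1 ξ hξ)
    refine (he.mul ((((hy 0).const_mul (q - c / 2)).sub (hy 1)).div_const (2 * q))).congr_deriv ?_
    simp [potentialCoeff, Matrix.mulVec, dotProduct, Fin.sum_univ_two, hφ, hlam]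
    field_simp
    ring
  · have ht := tendsto_pi_nhds.1 h.2
    have h0 := ht 0
    have h1 := ht 1
    simp only [Pi.smul_apply, smul_eq_mul, Matrix.cons_val_zero, Matrix.cons_val_one] at h0 h1
    have := (h1.add (h0.const_mul (q + c / 2 : ℂ))).div_const (2 * q)
    convert! this using 2
    · ring
    · field_simp; ring
  · have ht := tendsto_pi_nhds.1 h.2
    have h0 := ht 0
    have h1 := ht 1
    simp only [Pi.smul_apply, smul_eq_mul, Matrix.cons_val_zero, Matrix.cons_val_one] at h0 h1
    have := ((h0.const_mul (q - c / 2 : ℂ)).sub h1).div_const (2 * q)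
    convert! this using 2
    · ring
    · field_simp; ring
  · intro ξ
    have he := hexp ξ
    ext i
    fin_cases i
    · simp only [eigenVec, Fin.zero_eta, Pi.smul_apply, smul_eq_mul, Matrix.cons_val_zero]
      rw [← mul_add, ← mul_assoc, he]
      field_simp
      ring
    · simp only [eigenVec, Fin.mk_one, Pi.smul_apply, smul_eq_mul, Matrix.cons_val_one,
        Matrix.cons_val_fin_one]
      rw [mul_left_comm _ (Complex.exp _), mul_left_comm _ (Complex.exp _), ← mul_add,
        ← mul_assoc, he]
      field_simp
      ring

end Scaled

/-- In the application `a₀`, `a₁` are the exact dominant coordinates at `-L` and `0`, `δ - Ψ` is the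
numerical growth exponent and `P` the product of the defect factors. Replacing `exp δ` by `1 + δ`
costs `Y²`, replacing the factor `a₀ exp(-Ψ)` of `δ` by one costs `XY`, and `V` measures the failure
of `a₁ exp Ψ = a₀`. -/
lemma norm_growth_diff_le {a₀ a₁ Ψ δ P m : ℂ} {X Y Z W V : ℝ} (hX : X ≤ 1)
    (hΨ : ‖Ψ‖ ≤ X) (ha : ‖a₀ - 1‖ ≤ X) (hδ1 : ‖δ‖ ≤ 1) (hδ : ‖δ‖ ≤ Y) (hP : ‖P - 1‖ ≤ Z)
    (hm : ‖δ - m‖ ≤ W) (hV : ‖a₁ * Complex.exp Ψ - a₀‖ ≤ V) :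
    ‖a₀ * Complex.exp (δ - Ψ) * P - a₁ - m‖ ≤ 6 * (3 * Z + Y ^ 2) + 5 * X * Y + W + 3 * V := by
  have hX0 : 0 ≤ X := (norm_nonneg _).trans hΨ
  have hY0 : 0 ≤ Y := (norm_nonneg _).trans hδ
  have hexp : ∀ z : ℂ, ‖z‖ ≤ 1 → ‖Complex.exp z‖ ≤ 3 := fun z hz => by
    rw [Complex.norm_exp]
    exact (Real.exp_le_exp.2 ((Complex.re_le_norm z).trans hz)).trans Real.exp_one_lt_three.le
  have hE : ‖Complex.exp (-Ψ)‖ ≤ 3 := hexp _ (by rw [norm_neg]; linarith)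
  have hE1 : ‖Complex.exp (-Ψ) - 1‖ ≤ 2 * X := by
    refine (Complex.norm_exp_sub_one_le (by rw [norm_neg]; linarith)).trans ?_
    rw [norm_neg]; linarith
  have ha0 : ‖a₀‖ ≤ 2 := by
    have : ‖a₀‖ ≤ ‖a₀ - 1‖ + 1 := by simpa using norm_add_le (a₀ - 1) 1
    linarith
  have hinv : Complex.exp Ψ * Complex.exp (-Ψ) = 1 := by rw [← Complex.exp_add]; simp
  have e : a₀ * Complex.exp (δ - Ψ) * P - a₁ - m =
      Complex.exp (-Ψ) * (a₀ * (Complex.exp δ * (P - 1) + (Complex.exp δ - 1 - δ))) +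
      ((Complex.exp (-Ψ) - 1) * a₀ + (a₀ - 1)) * δ + (δ - m) -
      Complex.exp (-Ψ) * (a₁ * Complex.exp Ψ - a₀) := by
    rw [sub_eq_add_neg δ Ψ, Complex.exp_add]
    linear_combination a₁ * hinv
  rw [e]
  have b1 : ‖Complex.exp (-Ψ) * (a₀ * (Complex.exp δ * (P - 1) + (Complex.exp δ - 1 - δ)))‖ ≤
      3 * (2 * (3 * Z + Y ^ 2)) := by
    rw [norm_mul, norm_mul]
    gcongr
    refine (norm_add_le _ _).trans (add_le_add ?_ ?_)
    · rw [norm_mul]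
      gcongr
      exact hexp _ hδ1
    · refine (Complex.norm_exp_sub_one_sub_id_le hδ1).trans ?_
      gcongr
  have b2 : ‖((Complex.exp (-Ψ) - 1) * a₀ + (a₀ - 1)) * δ‖ ≤ (2 * X * 2 + X) * Y := by
    rw [norm_mul]
    gcongr
    refine (norm_add_le _ _).trans (add_le_add ?_ ha)
    rw [norm_mul]
    gcongr
  have b4 : ‖Complex.exp (-Ψ) * (a₁ * Complex.exp Ψ - a₀)‖ ≤ 3 * V := by
    rw [norm_mul]
    gcongr
  refine (norm_sub_le _ _).trans ((add_le_add ((norm_add_le _ _).trans (add_le_add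
    ((norm_add_le _ _).trans (add_le_add b1 b2)) hm)) b4).trans (le_of_eq (by ring)))

end EvansMagnus

/-! ### Numerical against exact growth exponent on a half-line. -/

namespace EvansMagnus

open Set

variable {c : ℝ} {φ g : ℝ → ℝ} {φinf K β σ : ℝ}

/-- The conditions on `q` and `h` used on a half-line, for a constant `H` that dominates the
data. -/
structure HalfLineRegime (g : ℝ → ℝ) (K β σ h₀ H h : ℝ) (q : ℂ) : Prop where
  decay : ExpDecay g K β
  sector_pos : 0 < σ
  step_pos : 0 < h
  step_le : h ≤ h₀
  one_le : 1 ≤ H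
  exp_le : K * Real.exp (β * h₀) ≤ H
  bound_le : h₀ ≤ H
  rate_le : 1 / β ≤ H
  ratio_le : K ^ 2 * (1 + 1 / σ) / σ ≤ H
  sector : σ * ‖q‖ ≤ q.re
  stiff : 2 ≤ σ * h * ‖q‖
  inv_le : ‖q‖⁻¹ ≤ h
  large : 200 * H ^ 18 ≤ ‖q‖
  large₂ : 4 * H ^ 6 ≤ σ * ‖q‖ ^ 2
  large₃ : K * (1 / β + 1 / σ) ≤ ‖q‖
  large₄ : 2 * (K ^ 2 / β) ≤ ‖q‖

namespace HalfLineRegime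

variable {h₀ H h : ℝ} {q lam : ℂ} {a b : ℝ → ℂ} {N : ℕ}

lemma one_le_norm (R : HalfLineRegime g K β σ h₀ H h q) : 1 ≤ ‖q‖ := by
  have := one_le_pow₀ R.one_le (n := 18)
  linarith [R.large]

lemma ne_zero (R : HalfLineRegime g K β σ h₀ H h q) : q ≠ 0 :=
  norm_pos_iff.1 (by linarith [R.one_le_norm])

lemma grid_zero_nonpos (R : HalfLineRegime g K β σ h₀ H h q) (N : ℕ) : -(N * h : ℝ) ≤ 0 := by
  have : 0 ≤ (N : ℝ) * h := mul_nonneg (Nat.cast_nonneg _) R.step_pos.le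
  linarith

lemma stepBounds (R : HalfLineRegime g K β σ h₀ H h q) {k : ℕ} (hk : k < N) :
    StepBounds g q σ H (Real.exp (β * grid h N k)) (grid h N k) h :=
  R.decay.stepBounds R.step_pos R.step_le (ExpDecay.grid_add_nonpos R.step_pos hk) R.one_le
    R.exp_le R.bound_le R.sector_pos R.sector R.stiff R.inv_le R.large R.large₂

lemma norm_fst_sub_one_le (R : HalfLineRegime g K β σ h₀ H h q) (hab : IsScaledSolution g q a b)
    {x : ℝ} (hx : x ≤ 0) : ‖a x - 1‖ ≤ K ^ 2 / β * ‖q‖⁻¹ := by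
  have hβ := R.decay.rate_pos
  have hK := R.decay.pos
  obtain ⟨h1, -, -, -⟩ := hab.bounds R.decay R.sector_pos R.sector R.one_le_norm R.large₃ hx
  refine h1.trans ((mul_le_of_le_one_right (by positivity) (R.decay.exp_le_one hx)).trans ?_)
  rw [div_eq_mul_inv _ ‖q‖]
  gcongr
  exact le_self_pow₀ R.decay.one_le (by norm_num)

lemma growth_le_half (R : HalfLineRegime g K β σ h₀ H h q) : K ^ 2 / β * ‖q‖⁻¹ ≤ 1 / 2 := by
  have := R.one_le_norm
  rw [← div_eq_mul_inv, div_le_iff₀ (by linarith)]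
  linarith [R.large₄]

/-- Trading `|q|⁻²` for `h²` brings the WKB bound to the form in which the recursion for the ratios
starts. -/
lemma norm_snd_sub_le (R : HalfLineRegime g K β σ h₀ H h q) (hab : IsScaledSolution g q a b)
    {x : ℝ} (hx : x ≤ 0) :
    ‖b x - g x / (4 * q ^ 2) * a x‖ ≤ H * h ^ 2 * Real.exp (β * x) * ‖q‖⁻¹ := by
  obtain ⟨-, -, -, h1⟩ := hab.bounds R.decay R.sector_pos R.sector R.one_le_norm R.large₃ hx
  have hH := R.one_le
  refine h1.trans ?_
  have hh := R.step_pos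
  have := R.inv_le
  calc _ = K ^ 2 * (1 + 1 / σ) / σ * (‖q‖⁻¹ ^ 2 * ‖q‖⁻¹) * Real.exp (β * x) := by
        rw [← pow_succ, inv_pow]; ring
    _ ≤ H * (h ^ 2 * ‖q‖⁻¹) * Real.exp (β * x) := by
        gcongr
        exact R.ratio_le
    _ = _ := by ring

lemma half_le_norm_fst (R : HalfLineRegime g K β σ h₀ H h q) (hab : IsScaledSolution g q a b)
    {x : ℝ} (hx : x ≤ 0) : 1 / 2 ≤ ‖a x‖ := by
  have h1 := (R.norm_fst_sub_one_le hab hx).trans R.growth_le_half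
  have h2 := norm_sub_norm_le 1 (1 - a x)
  rw [sub_sub_cancel, norm_one, norm_sub_rev] at h2
  linarith

lemma norm_fst_le (R : HalfLineRegime g K β σ h₀ H h q) (hab : IsScaledSolution g q a b)
    {x : ℝ} (hx : x ≤ 0) : ‖a x‖ ≤ 2 :=
  (hab.bounds R.decay R.sector_pos R.sector R.one_le_norm R.large₃ hx).2.1

lemma norm_ratio_sub_le (R : HalfLineRegime g K β σ h₀ H h q) (hab : IsScaledSolution g q a b)
    {x : ℝ} (hx : x ≤ 0) :
    ‖b x / a x - g x / (4 * q ^ 2)‖ ≤ 15 * H * h ^ 2 * Real.exp (β * x) * ‖q‖⁻¹ := by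
  have h1 := R.norm_snd_sub_le hab hx
  have h2 := R.half_le_norm_fst hab hx
  have hH := R.one_le
  have ha : a x ≠ 0 := norm_pos_iff.1 (by linarith)
  have e : b x / a x - g x / (4 * q ^ 2) = (b x - g x / (4 * q ^ 2) * a x) / a x := by
    rw [sub_div, mul_div_cancel_right₀ _ ha]
  rw [e, norm_div]
  have h0 : 0 ≤ H * h ^ 2 * Real.exp (β * x) * ‖q‖⁻¹ := by positivity
  calc _ ≤ H * h ^ 2 * Real.exp (β * x) * ‖q‖⁻¹ / (1 / 2) := by gcongr
    _ ≤ _ := by linarith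

/-- The dominant coordinate of the numerical solution at `0`. -/
lemma magnus_eq (R : HalfLineRegime g K β σ h₀ H h q) (hab : IsScaledSolution g q a b)
    (hφ : ∀ x, φ x = φinf + g x) (hq : q ^ 2 = (c : ℂ) ^ 2 / 4 + lam - φinf) :
    magnus (potentialCoeff c φ lam) (-(N * h)) h
      (Complex.exp ((q - c / 2) * (-(N * h) : ℝ)) •
        eigenVec c q (a (-(N * h))) (b (-(N * h)))) N =
      (a (-(N * h)) * Complex.exp (∑ i ∈ Finset.range N, h * (stepFreq g q (grid h N i) h - q)) *
        ∏ i ∈ Finset.range N,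
          (1 + defectSeq g q h N (b (-(N * h)) / a (-(N * h))) i)) •
        eigenVec c q 1 (ratioSeq g q h N (b (-(N * h)) / a (-(N * h))) N) := by
  have hL := R.grid_zero_nonpos N
  have h2 := R.half_le_norm_fst hab hL
  have ha : a (-(N * h)) ≠ 0 := norm_pos_iff.1 (by linarith)
  have e1 : Complex.exp ((q - c / 2) * (-(N * h) : ℝ)) •
        eigenVec c q (a (-(N * h))) (b (-(N * h))) =
      (Complex.exp ((q - c / 2) * (-(N * h) : ℝ)) * a (-(N * h))) •
        eigenVec c q 1 (b (-(N * h)) / a (-(N * h))) := by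
    rw [smul_eigenVec, smul_eigenVec]
    congr 1
    · ring
    · field_simp
  rw [e1, magnus_eq_smul hφ hq R.step_pos R.decay.rate_pos (fun k hk => R.stepBounds hk)
    (by linarith [R.one_le]) (R.norm_ratio_sub_le hab hL) _ le_rfl]
  congr 1
  rw [Finset.prod_mul_distrib, ← Complex.exp_sum]
  -- The accumulated factor `exp((q - c/2) L)` cancels the factor `exp(-(q - c/2) L)` of the initial
  -- value; only `w - q` remains.
  have e2 : ∑ i ∈ Finset.range N, (h : ℂ) * (stepFreq g q (grid h N i) h - c / 2) =
      ∑ i ∈ Finset.range N, (h : ℂ) * (stepFreq g q (grid h N i) h - q) -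
        (q - c / 2) * (-(N * h) : ℝ) := by
    have : ∀ i, (h : ℂ) * (stepFreq g q (grid h N i) h - c / 2) =
        (h : ℂ) * (stepFreq g q (grid h N i) h - q) + h * (q - c / 2) := fun i => by ring
    simp only [this, Finset.sum_add_distrib, Finset.sum_const, Finset.card_range, nsmul_eq_mul]
    push_cast
    ring
  rw [e2, sub_eq_add_neg (∑ i ∈ Finset.range N, (h : ℂ) * (stepFreq g q (grid h N i) h - q)),
    Complex.exp_add]
  have e3 : Complex.exp ((q - c / 2) * (-(N * h) : ℝ)) *
      Complex.exp (-((q - c / 2) * (-(N * h) : ℝ))) = 1 := by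
    rw [← Complex.exp_add, add_neg_cancel, Complex.exp_zero]
  linear_combination (a (-(N * h)) * Complex.exp (∑ i ∈ Finset.range N, (h : ℂ) *
    (stepFreq g q (grid h N i) h - q)) * ∏ i ∈ Finset.range N,
      (1 + defectSeq g q h N (b (-(N * h)) / a (-(N * h))) i)) * e3

end HalfLineRegime

/-- The error of composite two-point Gauss quadrature on `[-N h, 0]`. -/
noncomputable def halfGaussError (g : ℝ → ℝ) (h : ℝ) (N : ℕ) : ℝ :=
  ∑ k ∈ Finset.range N, h * gaussMean g (grid h N k) h - ∫ x in (-(N * h))..0, g x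

/-- The means leave the quadrature error divided by `-2q`, the squared commutator terms leave
`h⁴/(288q) ∫(g')²`, and the squared means match the second WKB term within the error. -/
lemma ExpDecay.norm_exponent_add_growth_sub_le (hg : ExpDecay g K β) (h₀ : ℝ) :
    ∃ C, 0 ≤ C ∧ ∀ (σ H h : ℝ) (q : ℂ) (N : ℕ), HalfLineRegime g K β σ h₀ H h q →
      ‖∑ i ∈ Finset.range N, h * (stepFreq g q (grid h N i) h - q) +
        growthExponent g q (-(N * h)) 0 -
        ((h ^ 4 / 288 * (∫ x in Iic 0, deriv g x ^ 2) - halfGaussError g h N / 2 : ℝ) : ℂ) / q‖ ≤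
      (C + H) * (h ^ 2 * ‖q‖⁻¹ ^ 2 + (h ^ 6 + h ^ 4 * Real.exp (-β * (N * h))) * ‖q‖⁻¹) := by
  obtain ⟨C₂, hC₂, h2⟩ := hg.abs_sum_gaussDiff_sq_sub_le h₀
  obtain ⟨C₃, hC₃, h3⟩ := hg.abs_sum_gaussMean_sq_sub_le h₀
  refine ⟨C₂ + C₃, by positivity, fun σ H h q N R => ?_⟩
  have hh := R.step_pos
  have h1 := norm_sum_exponent_sub_le hg.rate_pos (fun k hk => R.stepBounds (N := N) hk) R.rate_le
  specialize h2 h N R.step_pos R.step_le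
  specialize h3 h N R.step_pos R.step_le
  have hq := R.ne_zero
  have hH := R.one_le
  have hqp : 0 < ‖q‖ := norm_pos_iff.2 hq
  rw [halfGaussError]
  set S := ∑ i ∈ Finset.range N, (h : ℂ) * (stepFreq g q (grid h N i) h - q)
  set S1 := ∑ i ∈ Finset.range N, h * gaussMean g (grid h N i) h
  set S2 := ∑ i ∈ Finset.range N, h * gaussDiff g (grid h N i) h ^ 2
  set S3 := ∑ i ∈ Finset.range N, h * gaussMean g (grid h N i) h ^ 2
  set I := ∫ x in Iic 0, deriv g x ^ 2
  rw [growthExponent]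
  set I1 := ∫ x in (-(N * h))..0, g x
  set I3 := ∫ x in (-(N * h))..0, g x ^ 2
  set e := h ^ 6 + h ^ 4 * Real.exp (-β * (N * h))
  have he : 0 ≤ e := by positivity
  have eq : S + ((I1 : ℂ) / (2 * q) + (I3 : ℂ) / (8 * q ^ 3)) -
      ((h ^ 4 / 288 * I - (S1 - I1) / 2 : ℝ) : ℂ) / q =
      (S - (-(S1 : ℂ) / (2 * q) + (S2 : ℂ) / (2 * q) - (S3 : ℂ) / (8 * q ^ 3))) +
      ((S2 - h ^ 4 / 144 * I : ℝ) : ℂ) / (2 * q) - ((S3 - I3 : ℝ) : ℂ) / (8 * q ^ 3) := by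
    push_cast
    field_simp
    ring
  rw [eq]
  have t2 : ‖((S2 - h ^ 4 / 144 * I : ℝ) : ℂ) / (2 * q)‖ ≤ C₂ * (e * ‖q‖⁻¹) := by
    rw [norm_div, norm_mul, Complex.norm_real, Real.norm_eq_abs, Complex.norm_ofNat,
      div_eq_mul_inv, mul_inv]
    calc _ ≤ C₂ * e * (2⁻¹ * ‖q‖⁻¹) := by gcongr
      _ = C₂ * (e * ‖q‖⁻¹) * 2⁻¹ := by ring
      _ ≤ _ := mul_le_of_le_one_right (by positivity) (by norm_num)
  have t3 : ‖((S3 - I3 : ℝ) : ℂ) / (8 * q ^ 3)‖ ≤ C₃ * (h ^ 2 * ‖q‖⁻¹ ^ 2) := by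
    rw [norm_div, norm_mul, norm_pow, Complex.norm_real, Real.norm_eq_abs, Complex.norm_ofNat,
      div_eq_mul_inv, mul_inv, ← inv_pow]
    calc _ ≤ C₃ * h * (1 * (h * ‖q‖⁻¹ ^ 2)) := by
          gcongr
          · norm_num
          · rw [pow_succ, mul_comm]
            gcongr
            exact R.inv_le
      _ = _ := by ring
  refine (norm_sub_le _ _).trans ((add_le_add ((norm_add_le _ _).trans (add_le_add h1 t2))
    t3).trans ?_)
  have p1 : 0 ≤ h ^ 2 * ‖q‖⁻¹ ^ 2 := by positivity
  have p2 : 0 ≤ e * ‖q‖⁻¹ := by positivity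
  nlinarith

lemma ExpDecay.abs_halfGaussError_le (hg : ExpDecay g K β) (h₀ : ℝ) :
    ∃ C, 0 ≤ C ∧ ∀ (h : ℝ) (N : ℕ), 0 < h → h ≤ h₀ →
      |halfGaussError g h N + h ^ 4 / 4320 * iteratedDeriv 3 g 0| ≤
        C * (h ^ 6 + h ^ 4 * Real.exp (-β * (N * h))) :=
  hg.abs_sum_gaussMean_sub_le h₀

lemma exp_neg_mul_nat_le_one {β h : ℝ} (hβ : 0 < β) (hh : 0 < h) (N : ℕ) :
    Real.exp (-β * (N * h)) ≤ 1 := by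
  rw [Real.exp_le_one_iff]
  have : 0 ≤ β * (N * h) := by positivity
  linarith

lemma ExpDecay.abs_main_le (hg : ExpDecay g K β) (h₀ : ℝ) :
    ∃ C, 0 ≤ C ∧ ∀ (h : ℝ) (N : ℕ), 0 < h → h ≤ h₀ →
      |h ^ 4 / 288 * (∫ x in Iic 0, deriv g x ^ 2) - halfGaussError g h N / 2| ≤ C * h ^ 4 := by
  obtain ⟨C, hC, h1⟩ := hg.abs_halfGaussError_le h₀
  have hI : 0 ≤ ∫ x in Iic 0, deriv g x ^ 2 :=
    MeasureTheory.integral_nonneg fun x => sq_nonneg _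
  refine ⟨(∫ x in Iic 0, deriv g x ^ 2) + |iteratedDeriv 3 g 0| + C * (h₀ ^ 2 + 1),
    by positivity, fun h N hh hh₀ => ?_⟩
  specialize h1 h N hh hh₀
  set I := ∫ x in Iic 0, deriv g x ^ 2
  have he : h ^ 6 + h ^ 4 * Real.exp (-β * (N * h)) ≤ (h₀ ^ 2 + 1) * h ^ 4 := by
    have h2 : h ^ 2 ≤ h₀ ^ 2 := by gcongr
    have h3 := exp_neg_mul_nat_le_one hg.rate_pos hh N
    have h4 : 0 < h ^ 4 := by positivity
    nlinarith
  have h5 : |halfGaussError g h N| ≤ C * ((h₀ ^ 2 + 1) * h ^ 4) +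
      h ^ 4 / 4320 * |iteratedDeriv 3 g 0| := by
    have e : halfGaussError g h N = (halfGaussError g h N + h ^ 4 / 4320 * iteratedDeriv 3 g 0) -
      h ^ 4 / 4320 * iteratedDeriv 3 g 0 := by ring
    rw [e]
    refine (abs_sub _ _).trans (add_le_add (h1.trans (by gcongr)) ?_)
    rw [abs_mul, abs_of_nonneg (by positivity)]
  refine (abs_sub _ _).trans ?_
  rw [abs_of_nonneg (by positivity), abs_div, abs_two]
  have p1 : 0 ≤ h ^ 4 * I := by positivity
  have p2 : 0 ≤ h ^ 4 * |iteratedDeriv 3 g 0| := by positivity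
  have p3 : 0 ≤ C * ((h₀ ^ 2 + 1) * h ^ 4) := by positivity
  nlinarith

end EvansMagnus

/-! ### The half-line theorem. -/

namespace EvansMagnus

open Set

variable {c : ℝ} {φ g : ℝ → ℝ} {φinf K β σ : ℝ}

/-- The order of quantifiers matters: `H` is fixed before the threshold `A`, so that `A` may be
built from constants depending on `H`, as in `ExpDecay.half_line`. -/
lemma ExpDecay.exists_regime (hg : ExpDecay g K β) (hσ : 0 < σ) {h₀ : ℝ} (hh₀ : 0 < h₀) :
    ∃ H, ∀ A : ℝ, ∃ M, 0 < M ∧ ∀ (h : ℝ) (q : ℂ), 0 < h → h ≤ h₀ → M ≤ h * ‖q‖ →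
      σ * ‖q‖ ≤ q.re → HalfLineRegime g K β σ h₀ H h q ∧ A ≤ ‖q‖ := by
  have hβ := hg.rate_pos
  have hK := hg.pos
  have p1 : 0 < K * Real.exp (β * h₀) := by positivity
  have p2 : 0 < 1 / β := by positivity
  have p3 : 0 < K ^ 2 * (1 + 1 / σ) / σ := by positivity
  obtain ⟨H, hH⟩ : ∃ H, H = 1 + K * Real.exp (β * h₀) + h₀ + 1 / β + K ^ 2 * (1 + 1 / σ) / σ :=
    ⟨_, rfl⟩
  refine ⟨H, fun A => ?_⟩
  have hH1 : 1 ≤ H := by linarith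
  obtain ⟨Q, hQ⟩ : ∃ Q, Q = 200 * H ^ 18 + 4 * H ^ 6 / σ + K * (1 / β + 1 / σ) +
      2 * (K ^ 2 / β) + |A| := ⟨_, rfl⟩
  have q1 : 0 < 200 * H ^ 18 := by positivity
  have q2 : 0 < 4 * H ^ 6 / σ := by positivity
  have q3 : 0 < K * (1 / β + 1 / σ) := by positivity
  have q4 : 0 < 2 * (K ^ 2 / β) := by positivity
  have q5 : 0 ≤ |A| := abs_nonneg _
  have hQ0 : 0 < Q := by linarith
  -- The summands secure, in turn, `|q| ≥ Q` (using `h ≤ h₀`), the stiffness condition, and `|q|⁻¹ ≤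
  -- h`.
  refine ⟨h₀ * Q + 2 / σ + 1, by positivity, fun h q hh hhh₀ hM hs => ?_⟩
  have hσ2 : 0 < 2 / σ := by positivity
  have hhQ : 0 < h₀ * Q := by positivity
  have hq0 : 0 < ‖q‖ := by
    by_contra hcon
    have : h * ‖q‖ ≤ 0 := mul_nonpos_of_nonneg_of_nonpos hh.le (not_lt.1 hcon)
    linarith
  have hqQ : Q ≤ ‖q‖ := by
    have h1 : h * ‖q‖ ≤ h₀ * ‖q‖ := by gcongr
    have h2 : h₀ * Q ≤ h₀ * ‖q‖ := by linarith
    exact le_of_mul_le_mul_left h2 hh₀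
  have hl : 200 * H ^ 18 ≤ ‖q‖ := by linarith
  have hq1 : 1 ≤ ‖q‖ := by linarith [one_le_pow₀ hH1 (n := 18)]
  refine ⟨⟨hg, hσ, hh, hhh₀, hH1, by linarith, by linarith, by linarith, by linarith, hs, ?_, ?_,
    hl, ?_, by linarith, by linarith⟩, by linarith [le_abs_self A]⟩
  · have h1 : 2 / σ ≤ h * ‖q‖ := by linarith
    rw [div_le_iff₀ hσ] at h1
    linarith
  · rw [inv_le_iff_one_le_mul₀ hq0]
    linarith
  · have h1 : 4 * H ^ 6 / σ ≤ ‖q‖ := by linarith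
    rw [div_le_iff₀ hσ] at h1
    calc 4 * H ^ 6 ≤ ‖q‖ * σ * 1 := by linarith
      _ ≤ ‖q‖ * σ * ‖q‖ := by gcongr
      _ = _ := by ring

/-- The values at `0` of the solution on the half-line and of its numerical approximation. -/
structure HalfLineEstimate (g : ℝ → ℝ) (β C h : ℝ) (N : ℕ) (q a b a' b' : ℂ) : Prop where
  fst_le : ‖a - 1‖ ≤ C * ‖q‖⁻¹
  snd_le : ‖b‖ ≤ C * ‖q‖⁻¹
  snd_sub_le : ‖b' - b‖ ≤ C * (h ^ 2 * ‖q‖⁻¹)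
  fst_sub_le : ‖a' - a - ((h ^ 4 / 288 * (∫ x in Iic 0, deriv g x ^ 2) -
      halfGaussError g h N / 2 : ℝ) : ℂ) / q‖ ≤
    C * (h ^ 2 * ‖q‖⁻¹ ^ 2 + (h ^ 6 + h ^ 4 * Real.exp (-β * (N * h))) * ‖q‖⁻¹)

-- The error of order `1/|q|` in the dominant coordinate has to be known exactly, because the
-- determinant multiplies it by a factor of size `|q|`. For the other coordinate an upper bound is
-- enough.
set_option maxHeartbeats 1600000 in
theorem ExpDecay.half_line (hg : ExpDecay g K β) (hφ : ∀ x, φ x = φinf + g x) (hσ : 0 < σ)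
    {h₀ : ℝ} (hh₀ : 0 < h₀) :
    ∃ C M, 0 ≤ C ∧ 0 < M ∧ ∀ (h : ℝ) (N : ℕ) (lam q : ℂ), 0 < h → h ≤ h₀ → M ≤ h * ‖q‖ →
      σ * ‖q‖ ≤ q.re → q ^ 2 = (c : ℂ) ^ 2 / 4 + lam - φinf →
      (∃ y, IsHalfSolution c φ lam (q - c / 2) y) ∧
      ∀ y, IsHalfSolution c φ lam (q - c / 2) y →
        ∃ a b a' b', y 0 = eigenVec c q a b ∧
          magnus (potentialCoeff c φ lam) (-(N * h)) h (y (-(N * h))) N = eigenVec c q a' b' ∧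
          HalfLineEstimate g β C h N q a b a' b' := by
  have hβ := hg.rate_pos
  have hK := hg.pos
  obtain ⟨H, hreg⟩ := hg.exists_regime hσ hh₀
  obtain ⟨C₁, hC₁, hexpo⟩ := hg.norm_exponent_add_growth_sub_le h₀
  obtain ⟨Cm, hCm, hmain⟩ := hg.abs_main_le h₀
  obtain ⟨Cw, hCw⟩ : ∃ x, x = C₁ + |H| := ⟨_, rfl⟩
  have hCw0 : 0 ≤ Cw := by rw [hCw]; positivity
  obtain ⟨Cδ, hCδ⟩ : ∃ x, x = Cm * h₀ ^ 2 + Cw * (1 + (h₀ ^ 2 + 1) * h₀ ^ 2) := ⟨_, rfl⟩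
  have hCδ0 : 0 ≤ Cδ := by rw [hCδ]; positivity
  -- This threshold makes the difference of the growth exponents at most one in norm, so that its
  -- exponential can be linearised.
  obtain ⟨M, hM0, hreg⟩ := hreg (Cδ * h₀ ^ 2)
  obtain ⟨Cz, hCz⟩ : ∃ x, x = 3 * K ^ 3 * (1 + 1 / σ) / σ / β := ⟨_, rfl⟩
  have hCz0 : 0 ≤ Cz := by rw [hCz]; positivity
  obtain ⟨Ca, hCa⟩ : ∃ x, x = 6 * (540 * H ^ 4 + Cδ ^ 2 * h₀ ^ 2) + 5 * (K ^ 2 / β) * Cδ + Cw + 3 * Cz := ⟨_, rfl⟩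
  have hCa0 : 0 ≤ Ca := by rw [hCa]; positivity
  obtain ⟨Cd, hCd⟩ : ∃ x, x = Cm * h₀ ^ 2 + Ca * (1 + (h₀ ^ 2 + 1) * h₀ ^ 2) := ⟨_, rfl⟩
  have hCd0 : 0 ≤ Cd := by rw [hCd]; positivity
  obtain ⟨Cb, hCb⟩ : ∃ x, x = (2 + Cd * h₀ ^ 2) * (15 * |H|) + K * Cd + |H| := ⟨_, rfl⟩
  have hCb0 : 0 ≤ Cb := by rw [hCb]; positivity
  refine ⟨K ^ 2 / β + K / σ + Cb + Ca, M, by positivity, hM0,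
    fun h N lam q hh hhh₀ hM hs hq => ?_⟩
  obtain ⟨R, hA⟩ := hreg h q hh hhh₀ hM hs
  have hq0 := R.ne_zero
  have hq1 := R.one_le_norm
  have hqp : 0 < ‖q‖ := by linarith
  have hH := R.one_le
  have hHabs : |H| = H := abs_of_pos (by linarith)
  have hre : 0 < q.re := lt_of_lt_of_le (by positivity) hs
  constructor
  · obtain ⟨a, b, hab⟩ := hg.exists_isScaledSolution hre (by
      refine le_trans ?_ R.large₄
      gcongr
      exact le_self_pow₀ hg.one_le (by norm_num))
    exact ⟨_, hab.isHalfSolution hφ hq hq0⟩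
  intro y hy
  obtain ⟨a, b, hab, hyab⟩ := hy.exists_scaled hφ hq hq0
  have hL := R.grid_zero_nonpos N
  have hmag := R.magnus_eq (N := N) hab hφ hq
  rw [← hyab (-(N * h)), smul_eigenVec, mul_one] at hmag
  set t := ‖q‖⁻¹ with ht
  have ht0 : 0 < t := inv_pos.2 hqp
  have ht1 : t ≤ 1 := inv_le_one_of_one_le₀ hq1
  have hth : t ≤ h := R.inv_le
  set S := ∑ i ∈ Finset.range N, (h : ℂ) * (stepFreq g q (grid h N i) h - q) with hS
  set P := ∏ i ∈ Finset.range N, (1 + defectSeq g q h N (b (-(N * h)) / a (-(N * h))) i) with hP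
  set r := ratioSeq g q h N (b (-(N * h)) / a (-(N * h))) N with hr
  set Ψ := growthExponent g q (-(N * h)) 0 with hΨ
  set e := h ^ 6 + h ^ 4 * Real.exp (-β * (N * h)) with he
  set m := h ^ 4 / 288 * (∫ x in Iic 0, deriv g x ^ 2) - halfGaussError g h N / 2 with hm
  have he0 : 0 ≤ e := by positivity
  have heh : e ≤ (h₀ ^ 2 + 1) * h₀ ^ 2 * h ^ 2 := by
    have h2 : h ^ 2 ≤ h₀ ^ 2 := by gcongr
    have h3 := exp_neg_mul_nat_le_one hβ hh N
    calc e ≤ h₀ ^ 2 * (h₀ ^ 2 * h ^ 2) + h₀ ^ 2 * h ^ 2 * 1 := by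
          rw [he, show h ^ 6 = h ^ 2 * (h ^ 2 * h ^ 2) by ring,
            show h ^ 4 = h ^ 2 * h ^ 2 by ring]
          gcongr
      _ = _ := by ring
  have hδm : ‖S + Ψ - (m : ℂ) / q‖ ≤ Cw * (h ^ 2 * t ^ 2 + e * t) := by
    rw [hCw, hHabs]
    exact hexpo σ H h q N R
  have hmq : ‖(m : ℂ) / q‖ ≤ Cm * h₀ ^ 2 * (h ^ 2 * t) := by
    rw [norm_div, Complex.norm_real, Real.norm_eq_abs, div_eq_mul_inv, ← ht]
    calc _ ≤ Cm * h ^ 4 * t := by gcongr; exact hmain h N hh hhh₀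
      _ = Cm * h ^ 2 * (h ^ 2 * t) := by ring
      _ ≤ _ := by gcongr
  have hcrude : h ^ 2 * t ^ 2 + e * t ≤ (1 + (h₀ ^ 2 + 1) * h₀ ^ 2) * (h ^ 2 * t) := by
    calc _ ≤ h ^ 2 * (t * 1) + (h₀ ^ 2 + 1) * h₀ ^ 2 * h ^ 2 * t := by
          rw [sq t]
          gcongr
      _ = _ := by ring
  have hδ : ‖S + Ψ‖ ≤ Cδ * (h ^ 2 * t) := by
    have h1 : ‖S + Ψ‖ ≤ ‖S + Ψ - (m : ℂ) / q‖ + ‖(m : ℂ) / q‖ := by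
      simpa using norm_add_le (S + Ψ - (m : ℂ) / q) ((m : ℂ) / q)
    refine h1.trans ((add_le_add (hδm.trans (mul_le_mul_of_nonneg_left hcrude hCw0))
      hmq).trans (le_of_eq ?_))
    rw [hCδ]; ring
  have hδ1 : ‖S + Ψ‖ ≤ 1 := by
    refine hδ.trans ?_
    calc _ ≤ Cδ * (h₀ ^ 2 * t) := by gcongr
      _ = Cδ * h₀ ^ 2 * t := by ring
      _ ≤ ‖q‖ * t := by gcongr
      _ = 1 := mul_inv_cancel₀ hqp.ne'
  have hPb : ‖P - 1‖ ≤ 180 * H ^ 4 * h ^ 2 * t ^ 2 :=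
    norm_prod_defect_sub_one_le hh hβ (fun k hk => R.stepBounds hk) hH R.rate_le
      (hhh₀.trans R.bound_le) R.large (R.norm_ratio_sub_le hab hL)
  have hΨb : ‖Ψ‖ ≤ K ^ 2 / β * t := by
    have := hg.norm_growthExponent_le hq1 hL le_rfl
    rwa [div_eq_mul_inv _ ‖q‖] at this
  have hV : ‖a 0 * Complex.exp Ψ - a (-(N * h))‖ ≤ Cz * t ^ 4 := by
    have h1 := hab.norm_growth_sub_le hg hσ hs hq1 R.large₃ (by
      have := R.large₄
      have : 0 ≤ K ^ 2 / β := by positivity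
      linarith) hL
    rw [div_eq_mul_inv _ (‖q‖ ^ 4), ← inv_pow] at h1
    rw [hCz]
    exact h1
  have hfst := norm_growth_diff_le (R.growth_le_half.trans (by norm_num)) hΨb
    (R.norm_fst_sub_one_le hab hL) hδ1 hδ hPb hδm hV
  rw [add_sub_cancel_right] at hfst
  have hfst' : ‖a (-(N * h)) * Complex.exp S * P - a 0 - (m : ℂ) / q‖ ≤
      Ca * (h ^ 2 * t ^ 2 + e * t) := by
    refine hfst.trans ?_
    have w1 : (Cδ * (h ^ 2 * t)) ^ 2 ≤ Cδ ^ 2 * h₀ ^ 2 * (h ^ 2 * t ^ 2) := by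
      calc _ = Cδ ^ 2 * h ^ 2 * (h ^ 2 * t ^ 2) := by ring
        _ ≤ _ := by gcongr
    have w2 : t ^ 4 ≤ h ^ 2 * t ^ 2 := by
      rw [show t ^ 4 = t ^ 2 * t ^ 2 by ring]
      gcongr
    have w3 : Cz * t ^ 4 ≤ Cz * (h ^ 2 * t ^ 2) := by gcongr
    calc _ ≤ 6 * (3 * (180 * H ^ 4 * h ^ 2 * t ^ 2) + Cδ ^ 2 * h₀ ^ 2 * (h ^ 2 * t ^ 2)) +
          5 * (K ^ 2 / β * t) * (Cδ * (h ^ 2 * t)) + Cw * (h ^ 2 * t ^ 2 + e * t) +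
          3 * (Cz * (h ^ 2 * t ^ 2)) := by gcongr
      _ = (6 * (540 * H ^ 4 + Cδ ^ 2 * h₀ ^ 2) + 5 * (K ^ 2 / β) * Cδ + 3 * Cz) *
          (h ^ 2 * t ^ 2) + Cw * (h ^ 2 * t ^ 2 + e * t) := by ring
      _ ≤ (6 * (540 * H ^ 4 + Cδ ^ 2 * h₀ ^ 2) + 5 * (K ^ 2 / β) * Cδ + 3 * Cz) *
          (h ^ 2 * t ^ 2 + e * t) + Cw * (h ^ 2 * t ^ 2 + e * t) := by
        gcongr
        have : 0 ≤ e * t := by positivity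
        linarith
      _ = _ := by rw [hCa]; ring
  set a' := a (-(N * h)) * Complex.exp S * P with ha'
  have hdiff : ‖a' - a 0‖ ≤ Cd * (h ^ 2 * t) := by
    have h1 : ‖a' - a 0‖ ≤ ‖a' - a 0 - (m : ℂ) / q‖ + ‖(m : ℂ) / q‖ := by
      simpa using norm_add_le (a' - a 0 - (m : ℂ) / q) ((m : ℂ) / q)
    refine h1.trans ((add_le_add (hfst'.trans (mul_le_mul_of_nonneg_left hcrude hCa0))
      hmq).trans (le_of_eq ?_))
    rw [hCd]; ring
  have hrb : ‖r - g 0 / (4 * q ^ 2)‖ ≤ 15 * H * h ^ 2 * t := by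
    have := norm_ratioSeq_sub_le hh hβ (fun k hk => R.stepBounds hk) (by linarith)
      (R.norm_ratio_sub_le hab hL) (le_refl N)
    simpa [grid_self] using this
  have hb0 : ‖b 0 - g 0 / (4 * q ^ 2) * a 0‖ ≤ H * h ^ 2 * t := by
    simpa using R.norm_snd_sub_le hab (le_refl (0 : ℝ))
  have hsndle := (hab.bounds hg hσ hs hq1 R.large₃ (le_refl (0 : ℝ))).2.2.1
  have hext : ∀ x y z w : ℝ, 0 ≤ x → 0 ≤ y → 0 ≤ z → 0 ≤ w → x ≤ x + y + z + w ∧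
      y ≤ x + y + z + w ∧ z ≤ x + y + z + w ∧ w ≤ x + y + z + w := by
    intro x y z w _ _ _ _
    refine ⟨?_, ?_, ?_, ?_⟩ <;> linarith
  obtain ⟨c1, c2, c3, c4⟩ := hext (K ^ 2 / β) (K / σ) Cb Ca (by positivity) (by positivity)
    hCb0 hCa0
  refine ⟨a 0, b 0, a', a' * r, ?_, hmag, ?_, ?_, ?_, ?_⟩
  · rw [hyab 0]; simp
  · exact (R.norm_fst_sub_one_le hab le_rfl).trans (by gcongr)
  · refine hsndle.trans ?_
    simp only [mul_zero, Real.exp_zero, mul_one]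
    rw [div_eq_mul_inv _ (‖q‖ ^ 2), ← inv_pow, ← ht]
    have : t ^ 2 ≤ t := pow_le_of_le_one ht0.le ht1 (by norm_num)
    gcongr
  -- The numerical and the exact second coordinate are each compared with `g 0/(4q²)` times their
  -- own first coordinate.
  · have e1 : a' * r - b 0 = a' * (r - g 0 / (4 * q ^ 2)) + g 0 / (4 * q ^ 2) * (a' - a 0) -
        (b 0 - g 0 / (4 * q ^ 2) * a 0) := by ring
    rw [e1]
    have n1 : ‖a'‖ ≤ 2 + Cd * h₀ ^ 2 := by
      have h1 : ‖a'‖ ≤ ‖a' - a 0‖ + ‖a 0‖ := by simpa using norm_add_le (a' - a 0) (a 0)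
      have h2 : Cd * (h ^ 2 * t) ≤ Cd * (h₀ ^ 2 * 1) := by gcongr
      have h3 := R.norm_fst_le hab (le_refl (0 : ℝ))
      linarith
    have n2 : ‖(g 0 : ℂ) / (4 * q ^ 2)‖ ≤ K := by
      rw [norm_div, norm_mul, norm_pow, Complex.norm_ofNat]
      have h1 : ‖(g 0 : ℂ)‖ ≤ K := by simpa using hg.norm_le (le_refl (0 : ℝ))
      have h2 : 1 ≤ ‖q‖ ^ 2 := one_le_pow₀ hq1
      rw [div_le_iff₀ (by positivity)]
      nlinarith
    have m1 : ‖a' * (r - g 0 / (4 * q ^ 2))‖ ≤ (2 + Cd * h₀ ^ 2) * (15 * H * h ^ 2 * t) := by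
      rw [norm_mul]; gcongr
    have m2 : ‖(g 0 : ℂ) / (4 * q ^ 2) * (a' - a 0)‖ ≤ K * (Cd * (h ^ 2 * t)) := by
      rw [norm_mul]; gcongr
    refine (norm_sub_le _ _).trans ((add_le_add ((norm_add_le _ _).trans (add_le_add m1 m2))
      hb0).trans ?_)
    calc _ = Cb * (h ^ 2 * t) := by rw [hCb, hHabs]; ring
      _ ≤ _ := by gcongr
  · exact hfst'.trans (by gcongr)

end EvansMagnus

/-! ### Smoothness of the wave and exponential decay of the derivatives of `φ`. -/

namespace EvansMagnus

open Set

/-- A smooth function with all its derivatives bounded. -/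
structure HasBoundedDerivs (g : ℝ → ℝ) : Prop where
  contDiff : ContDiff ℝ ∞ g
  bounded : ∀ n : ℕ, ∃ B, ∀ x, |iteratedDeriv n g x| ≤ B

lemma hasDerivAt_iteratedDeriv_of_contDiff {g : ℝ → ℝ} (hg : ContDiff ℝ ∞ g) (k : ℕ) (x : ℝ) :
    HasDerivAt (iteratedDeriv k g) (iteratedDeriv (k + 1) g x) x := by
  rw [iteratedDeriv_succ]
  exact ((hg.differentiable_iteratedDeriv k
    (by exact_mod_cast WithTop.coe_lt_top _)).differentiableAt).hasDerivAt

section Composition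

variable {F u : ℝ → ℝ} {R : ℝ}

lemma exists_iteratedDeriv_comp_le (hF : ContDiff ℝ ∞ F) (hu : ContDiff ℝ ∞ u)
    (hR : ∀ x, |u x| ≤ R) {n : ℕ} (hb : ∀ i ≤ n, ∃ B, ∀ x, |iteratedDeriv i u x| ≤ B) :
    ∃ B, ∀ x, |iteratedDeriv n (F ∘ u) x| ≤ B := by
  have hFb : ∀ i : ℕ, ∃ B, ∀ x ∈ Icc (-R) R, ‖iteratedDeriv i F x‖ ≤ B := fun i =>
    isCompact_Icc.exists_bound_of_continuousOn
      (hF.continuous_iteratedDeriv i (by exact_mod_cast le_top)).continuousOn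
  choose A hA using hFb
  choose! B hB using hb
  -- The base of the power is at least one, so its `i`-th power still bounds the `i`-th derivative,
  -- as the Faà di Bruno estimate demands.
  refine ⟨n.factorial * (∑ i ∈ Finset.range (n + 1), |A i|) *
    (1 + ∑ i ∈ Finset.range (n + 1), |B i|) ^ n, fun x => ?_⟩
  rw [← Real.norm_eq_abs, ← norm_iteratedFDeriv_eq_norm_iteratedDeriv]
  refine norm_iteratedFDeriv_comp_le hF hu (by exact_mod_cast le_top) x ?_ ?_
  · intro i hi
    rw [norm_iteratedFDeriv_eq_norm_iteratedDeriv]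
    refine (hA i (u x) (abs_le.1 (hR x))).trans ((le_abs_self _).trans ?_)
    exact Finset.single_le_sum (f := fun i => |A i|) (fun _ _ => abs_nonneg _)
      (Finset.mem_range.2 (by omega))
  · intro i hi hin
    rw [norm_iteratedFDeriv_eq_norm_iteratedDeriv, Real.norm_eq_abs]
    have h1 := Finset.single_le_sum (f := fun i => |B i|) (fun _ _ => abs_nonneg _)
      (Finset.mem_range.2 (by omega : i < n + 1))
    have h2 : (0 : ℝ) ≤ ∑ i ∈ Finset.range (n + 1), |B i| :=
      Finset.sum_nonneg fun _ _ => abs_nonneg _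
    have h3 : |iteratedDeriv i u x| ≤ 1 + ∑ i ∈ Finset.range (n + 1), |B i| := by
      have := hB i hin x
      have := le_abs_self (B i)
      linarith
    exact h3.trans (le_self_pow₀ (by linarith) (by omega))

lemma HasBoundedDerivs.comp (hF : ContDiff ℝ ∞ F) (hu : HasBoundedDerivs u) :
    HasBoundedDerivs (F ∘ u) := by
  obtain ⟨R, hR⟩ := hu.bounded 0
  exact ⟨hF.comp hu.contDiff, fun n => exists_iteratedDeriv_comp_le hF hu.contDiff
    (by simpa using hR) fun i _ => hu.bounded i⟩

lemma HasBoundedDerivs.sub_const (hu : HasBoundedDerivs u) (a : ℝ) :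
    HasBoundedDerivs fun x => u x - a :=
  hu.comp (F := fun y => y - a) (by fun_prop)

lemma HasBoundedDerivs.comp_neg (hu : HasBoundedDerivs u) :
    HasBoundedDerivs fun x => u (-x) := by
  refine ⟨hu.contDiff.comp contDiff_neg, fun n => ?_⟩
  obtain ⟨B, hB⟩ := hu.bounded n
  refine ⟨B, fun x => ?_⟩
  rw [iteratedDeriv_comp_neg, smul_eq_mul, abs_mul, abs_pow, abs_neg, abs_one, one_pow, one_mul]
  exact hB _

end Composition

section Wave

variable {f : ℝ → ℝ} {c : ℝ} {u : ℝ → ℝ} {um up : ℝ}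

lemma IsTravellingWave.contDiff_infty (hu : IsTravellingWave f c u um up)
    (hf : ContDiff ℝ ∞ f) : ContDiff ℝ ∞ u := by
  have key : ∀ n : ℕ, ContDiff ℝ (n + 2 : ℕ) u := by
    intro n
    induction n with
    | zero => exact_mod_cast hu.contDiff
    | succ n ih =>
      have h1 : ContDiff ℝ ((n + 1 : ℕ) + 1) u := by exact_mod_cast ih
      have hd : ContDiff ℝ (n + 1 : ℕ) (deriv u) := (contDiff_succ_iff_deriv.1 h1).2.2
      have hdd : ContDiff ℝ (n + 1 : ℕ) (deriv (deriv u)) := by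
        have e : deriv (deriv u) = fun ξ => -c * deriv u ξ - f (u ξ) := by
          funext ξ
          linarith [hu.profile ξ]
        rw [e]
        exact (contDiff_const.mul hd).sub
          ((hf.of_le (by exact_mod_cast le_top)).comp (h1.of_le (by exact_mod_cast le_self_add)))
      have hd2 : ContDiff ℝ ((n + 1 : ℕ) + 1) (deriv u) :=
        contDiff_succ_iff_deriv.2 ⟨hd.differentiable (by simp), by simp, hdd⟩
      have h2 : ContDiff ℝ ((n + 1 + 1 : ℕ) + 1) u :=
        contDiff_succ_iff_deriv.2 ⟨h1.differentiable (by simp), by simp, by exact_mod_cast hd2⟩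
      exact_mod_cast h2
  exact _root_.contDiff_infty.2 fun n => (key n).of_le (by exact_mod_cast (by omega))

lemma exists_abs_le_of_tendsto {u : ℝ → ℝ} {um up : ℝ} (hu : Continuous u)
    (hm : Tendsto u atBot (𝓝 um)) (hp : Tendsto u atTop (𝓝 up)) : ∃ R, ∀ x, |u x| ≤ R := by
  obtain ⟨A, hA⟩ := eventually_atBot.1 (hm.abs.eventually (gt_mem_nhds (lt_add_one |um|)))
  obtain ⟨B, hB⟩ := eventually_atTop.1 (hp.abs.eventually (gt_mem_nhds (lt_add_one |up|)))
  obtain ⟨R, hR⟩ := (isCompact_Icc (a := A) (b := B)).exists_bound_of_continuousOn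
    hu.continuousOn
  refine ⟨|um| + 1 + (|up| + 1) + |R|, fun x => ?_⟩
  have h1 := abs_nonneg um
  have h2 := abs_nonneg up
  have h3 := abs_nonneg R
  rcases le_total x A with h | h
  · linarith [hA x h]
  rcases le_total B x with h' | h'
  · linarith [hB x h']
  · have := hR x ⟨h, h'⟩
    rw [Real.norm_eq_abs] at this
    linarith [le_abs_self R]

/-- Every unit interval contains a point where `|u'| ≤ 2R`, by the mean value theorem. From there
`u' + c u`, whose derivative `-f(u)` is bounded, cannot move far. -/
lemma IsTravellingWave.exists_abs_deriv_le (hu : IsTravellingWave f c u um up)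
    (hf : Continuous f) {R : ℝ} (hR : ∀ x, |u x| ≤ R) : ∃ B, ∀ x, |deriv u x| ≤ B := by
  obtain ⟨F, hF⟩ := (isCompact_Icc (a := -R) (b := R)).exists_bound_of_continuousOn
    hf.continuousOn
  have hd : Differentiable ℝ u := hu.contDiff.differentiable (by norm_num)
  have hdd : Differentiable ℝ (deriv u) := by
    have h1 : ContDiff ℝ (1 + 1) u := by
      have := hu.contDiff
      norm_num
      exact this
    exact (contDiff_succ_iff_deriv.1 h1).2.2.differentiable (by norm_num)
  have hv : ∀ x, HasDerivAt (fun ξ => deriv u ξ + c * u ξ) (-f (u x)) x := fun x =>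
    ((hdd x).hasDerivAt.add ((hd x).hasDerivAt.const_mul c)).congr_deriv
      (by linarith [hu.profile x])
  refine ⟨2 * R + 2 * (|c| * R) + F, fun x => ?_⟩
  obtain ⟨η, hη, hη'⟩ := exists_deriv_eq_slope u (show x < x + 1 by linarith)
    hd.continuous.continuousOn hd.differentiableOn
  have h1 : |deriv u η| ≤ 2 * R := by
    rw [hη', add_sub_cancel_left, div_one]
    exact (abs_sub _ _).trans (by linarith [hR x, hR (x + 1)])
  have h2 : ‖(deriv u η + c * u η) - (deriv u x + c * u x)‖ ≤ F * ‖η - x‖ :=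
    convex_univ.norm_image_sub_le_of_norm_hasDerivWithin_le
      (f' := fun x => -f (u x)) (fun y _ => (hv y).hasDerivWithinAt)
      (fun y _ => by rw [norm_neg]; exact hF _ (abs_le.1 (hR y))) (mem_univ _) (mem_univ _)
  have hF0 : 0 ≤ F := (norm_nonneg _).trans (hF _ (abs_le.1 (hR x)))
  have h3 : F * ‖η - x‖ ≤ F := by
    refine mul_le_of_le_one_right hF0 ?_
    rw [Real.norm_eq_abs, abs_of_nonneg (by linarith [hη.1])]
    linarith [hη.2]
  have h4 : ∀ y, |c * u y| ≤ |c| * R := fun y => by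
    rw [abs_mul]
    exact mul_le_mul_of_nonneg_left (hR y) (abs_nonneg _)
  have h5 := abs_le.1 (h2.trans h3)
  have h6 := abs_le.1 h1
  have h7 := abs_le.1 (h4 x)
  have h8 := abs_le.1 (h4 η)
  rw [abs_le]
  constructor <;> linarith [h5.1, h5.2, h6.1, h6.2, h7.1, h7.2, h8.1, h8.2]

/-- The profile equation expresses derivative `n + 2` through derivative `n + 1` and the `n`-th
derivative of `f ∘ u`, which involves only derivatives of `u` up to order `n`. -/
lemma IsTravellingWave.hasBoundedDerivs (hu : IsTravellingWave f c u um up)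
    (hf : ContDiff ℝ ∞ f) : HasBoundedDerivs u := by
  have hsm := hu.contDiff_infty hf
  obtain ⟨R, hR⟩ := exists_abs_le_of_tendsto hsm.continuous hu.tendsto_left hu.tendsto_right
  obtain ⟨B₁, hB₁⟩ := hu.exists_abs_deriv_le hf.continuous hR
  refine ⟨hsm, fun n => ?_⟩
  induction n using Nat.strong_induction_on with
  | _ n ih =>
    match n with
    | 0 => exact ⟨R, by simpa using hR⟩
    | 1 => exact ⟨B₁, by simpa using hB₁⟩
    | n + 2 =>
      obtain ⟨A, hA⟩ := ih (n + 1) (by omega)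
      obtain ⟨B, hB⟩ := exists_iteratedDeriv_comp_le hf hsm hR (n := n)
        fun i hi => ih i (by omega)
      refine ⟨|c| * A + B, fun x => ?_⟩
      have e : deriv (deriv u) = fun ξ => -c * deriv u ξ - (f ∘ u) ξ := by
        funext ξ
        simp only [Function.comp]
        linarith [hu.profile ξ]
      have hd : ContDiff ℝ ∞ (deriv u) := (contDiff_infty_iff_deriv.1 hsm).2
      have h1 : ContDiffAt ℝ n (fun ξ => -c * deriv u ξ) x :=
        ((contDiff_const.mul hd).of_le (by exact_mod_cast le_top)).contDiffAt
      have h2 : ContDiffAt ℝ n (f ∘ u) x :=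
        ((hf.comp hsm).of_le (by exact_mod_cast le_top)).contDiffAt
      rw [iteratedDeriv_succ', iteratedDeriv_succ', e, iteratedDeriv_fun_sub h1 h2,
        iteratedDeriv_const_mul_field, ← iteratedDeriv_succ']
      refine (abs_sub _ _).trans (add_le_add ?_ (hB x))
      rw [abs_mul, abs_neg]
      exact mul_le_mul_of_nonneg_left (hA x) (abs_nonneg _)

lemma IsTravellingWave.hasBoundedDerivs_phi (hu : IsTravellingWave f c u um up)
    (hf : ContDiff ℝ ∞ f) : HasBoundedDerivs (phi f u) :=
  (hu.hasBoundedDerivs hf).comp (contDiff_infty_iff_deriv.1 hf).2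

end Wave

/-- If `g` decays exponentially and `g''` is bounded, then `g'` decays exponentially. -/
lemma abs_deriv_le_exp_of_abs_le {g g' g'' : ℝ → ℝ} {K M a : ℝ} (ha : 0 < a)
    (h1 : ∀ x, HasDerivAt g (g' x) x) (h2 : ∀ x, HasDerivAt g' (g'' x) x)
    (hg : ∀ x ≤ 0, |g x| ≤ K * Real.exp (a * x)) (hM : ∀ x, |g'' x| ≤ M) {x : ℝ} (hx : x ≤ 0) :
    |g' x| ≤ (2 * K + M) * Real.exp (a / 2 * x) := by
  -- Over a step of this length the difference quotient of `g` and the variation of `g'` are both of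
  -- order `s`; the price is half the decay rate.
  obtain ⟨s, hs⟩ : ∃ s, s = Real.exp (a / 2 * x) := ⟨_, rfl⟩
  have hs0 : 0 < s := hs ▸ Real.exp_pos _
  have hss : Real.exp (a * x) = s * s := by
    rw [hs, ← Real.exp_add]
    ring_nf
  have hgd : Differentiable ℝ g := fun y => (h1 y).differentiableAt
  obtain ⟨η, hη, hη'⟩ := exists_hasDerivAt_eq_slope g g' (show x - s < x by linarith)
    hgd.continuous.continuousOn fun y _ => h1 y
  rw [sub_sub_cancel, eq_div_iff hs0.ne'] at hη'
  have hK : 0 ≤ K := by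
    have := (abs_nonneg _).trans (hg 0 le_rfl)
    simpa using this
  have e1 := hg x hx
  have e2 : |g (x - s)| ≤ K * (s * s) := by
    refine (hg _ (by linarith)).trans ?_
    rw [← hss]
    gcongr
    linarith
  rw [hss] at e1
  have e3 : |g' η| * s ≤ 2 * K * (s * s) := by
    rw [← abs_of_pos hs0, ← abs_mul, abs_of_pos hs0, hη']
    exact (abs_sub _ _).trans (by linarith)
  have e4 : |g' η| ≤ 2 * K * s := by
    refine le_of_mul_le_mul_right ?_ hs0
    linarith
  have e5 : ‖g' x - g' η‖ ≤ M * ‖x - η‖ :=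
    convex_univ.norm_image_sub_le_of_norm_hasDerivWithin_le
      (fun y _ => (h2 y).hasDerivWithinAt) (fun y _ => hM y) (mem_univ _) (mem_univ _)
  have hM0 : 0 ≤ M := (abs_nonneg _).trans (hM 0)
  have e6 : M * ‖x - η‖ ≤ M * s := by
    rw [Real.norm_eq_abs, abs_of_nonneg (by linarith [hη.2])]
    exact mul_le_mul_of_nonneg_left (by linarith [hη.1]) hM0
  have e7 : |g' x| ≤ |g' x - g' η| + |g' η| := by
    simpa using abs_add_le (g' x - g' η) (g' η)
  rw [← hs]
  rw [Real.norm_eq_abs] at e5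
  linarith

lemma HasBoundedDerivs.exists_iteratedDeriv_le_exp {g : ℝ → ℝ} (hg : HasBoundedDerivs g)
    {K a : ℝ} (ha : 0 < a) (h0 : ∀ x ≤ 0, |g x| ≤ K * Real.exp (a * x)) (n : ℕ) :
    ∃ K a, 0 < a ∧ ∀ x ≤ 0, |iteratedDeriv n g x| ≤ K * Real.exp (a * x) := by
  induction n with
  | zero => exact ⟨K, a, ha, by simpa using h0⟩
  | succ n ih =>
    obtain ⟨K', a', ha', h⟩ := ih
    obtain ⟨M, hM⟩ := hg.bounded (n + 2)
    exact ⟨2 * K' + M, a' / 2, by positivity, fun x hx => abs_deriv_le_exp_of_abs_le ha'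
      (fun y => hasDerivAt_iteratedDeriv_of_contDiff hg.contDiff n y)
      (fun y => hasDerivAt_iteratedDeriv_of_contDiff hg.contDiff (n + 1) y) h hM hx⟩

lemma ExpDecay.mono {g : ℝ → ℝ} {K K' b b' : ℝ} (hg : ExpDecay g K b) (hK : K ≤ K') (hb : 0 < b')
    (hb' : b' ≤ b) : ExpDecay g K' b' where
  contDiff := hg.contDiff
  rate_pos := hb
  one_le := hg.one_le.trans hK
  bound k hk x hx := by
    have h1 : b * x ≤ b' * x := mul_le_mul_of_nonpos_right hb' hx
    have h2 : 0 ≤ K' := hg.pos.le.trans hK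
    refine (hg.bound k hk x hx).trans ?_
    gcongr

lemma HasBoundedDerivs.exists_expDecay {g : ℝ → ℝ} (hg : HasBoundedDerivs g)
    {K a : ℝ} (ha : 0 < a) (h0 : ∀ x ≤ 0, |g x| ≤ K * Real.exp (a * x)) :
    ∃ K β, ExpDecay g K β := by
  have key : ∀ n : ℕ, ∃ K β, 1 ≤ K ∧ 0 < β ∧ ∀ k ≤ n, ∀ x ≤ 0,
      |iteratedDeriv k g x| ≤ K * Real.exp (β * x) := by
    intro n
    induction n with
    | zero =>
      refine ⟨1 + |K|, a, by linarith [abs_nonneg K], ha, fun k hk x hx => ?_⟩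
      obtain rfl : k = 0 := by omega
      rw [iteratedDeriv_zero]
      exact (h0 x hx).trans (by gcongr; linarith [le_abs_self K])
    | succ n ih =>
      obtain ⟨K₁, β₁, hK₁, hβ₁, h1⟩ := ih
      obtain ⟨K₂, β₂, hβ₂, h2⟩ := hg.exists_iteratedDeriv_le_exp ha h0 (n + 1)
      refine ⟨K₁ + |K₂|, min β₁ β₂, by linarith [abs_nonneg K₂], lt_min hβ₁ hβ₂,
        fun k hk x hx => ?_⟩
      rcases Nat.lt_or_ge k (n + 1) with h | h
      · refine (h1 k (by omega) x hx).trans ?_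
        have := mul_le_mul_of_nonpos_right (min_le_left β₁ β₂) hx
        gcongr
        linarith [abs_nonneg K₂]
      · obtain rfl : k = n + 1 := by omega
        refine (h2 x hx).trans ?_
        have := mul_le_mul_of_nonpos_right (min_le_right β₁ β₂) hx
        have h3 : K₂ ≤ K₁ + |K₂| := by linarith [le_abs_self K₂]
        have h4 := abs_nonneg K₂
        gcongr
  obtain ⟨K, β, hK, hβ, h⟩ := key 6
  exact ⟨K, β, hg.contDiff, hβ, hK, h⟩

/-- One pair of constants serves both ends, and `β` becomes the rate `b` of the main theorem. -/
theorem IsTravellingWave.exists_expDecay {f : ℝ → ℝ} {c : ℝ} {u : ℝ → ℝ} {um up : ℝ}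
    (hu : IsTravellingWave f c u um up) (hf : ContDiff ℝ ∞ f)
    (hφ : HasExponentialTails f u um up) :
    ∃ K β, ExpDecay (fun x => phi f u x - deriv f um) K β ∧
      ExpDecay (fun x => phi f u (-x) - deriv f up) K β := by
  obtain ⟨K, a, ha, hm, hp⟩ := hφ
  have hb := hu.hasBoundedDerivs_phi hf
  obtain ⟨K₁, β₁, h1⟩ := (hb.sub_const (deriv f um)).exists_expDecay ha hm
  obtain ⟨K₂, β₂, h2⟩ := (hb.comp_neg.sub_const (deriv f up)).exists_expDecay (K := K) ha
    fun x hx => by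
      have := hp (-x) (by linarith)
      rwa [neg_mul_neg] at this
  have hβ := lt_min h1.rate_pos h2.rate_pos
  exact ⟨max K₁ K₂, min β₁ β₂, h1.mono (le_max_left _ _) hβ (min_le_left _ _),
    h2.mono (le_max_right _ _) hβ (min_le_right _ _)⟩

end EvansMagnus

/-! ### Reflection of the right half-line onto the left one. -/

namespace EvansMagnus

open Set

/-- The matrix of the reflection `(v₀, v₁) ↦ (v₀, -v₁)`. -/
def reflection : Matrix (Fin 2) (Fin 2) ℂ := !![1, 0; 0, -1]

lemma reflection_mulVec (v : Fin 2 → ℂ) : reflection *ᵥ v = ![v 0, -v 1] := by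
  ext i
  fin_cases i <;> simp [reflection, Matrix.mulVec, dotProduct, Fin.sum_univ_two]

lemma reflection_mulVec_zero (v : Fin 2 → ℂ) : (reflection *ᵥ v) 0 = v 0 := by
  rw [reflection_mulVec]; rfl

lemma reflection_mulVec_one (v : Fin 2 → ℂ) : (reflection *ᵥ v) 1 = -v 1 := by
  rw [reflection_mulVec]; rfl

lemma reflection_mul_self : reflection * reflection = 1 := by
  ext i j
  fin_cases i <;> fin_cases j <;> simp [reflection, Matrix.mul_apply, Fin.sum_univ_two]

lemma reflection_mulVec_mulVec (v : Fin 2 → ℂ) : reflection *ᵥ (reflection *ᵥ v) = v := by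
  rw [Matrix.mulVec_mulVec, reflection_mul_self, Matrix.one_mulVec]

lemma exp_reflection_conj (A : Matrix (Fin 2) (Fin 2) ℂ) :
    NormedSpace.exp (reflection * A * reflection) =
      reflection * NormedSpace.exp A * reflection :=
  Matrix.exp_units_conj
    ⟨reflection, reflection, reflection_mul_self, reflection_mul_self⟩ A

section Reflection

variable {c : ℝ} {φ : ℝ → ℝ} {lam μ : ℂ} {y : ℝ → Fin 2 → ℂ}

/-- Reversing `x` together with the sign of the second component preserves the form of the system,
with `c` replaced by `-c`. So the right half-line needs no separate analysis. -/
lemma potentialCoeff_neg (c : ℝ) (φ : ℝ → ℝ) (lam : ℂ) (x : ℝ) :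
    potentialCoeff c φ lam (-x) =
      -(reflection * potentialCoeff (-c) (fun x => φ (-x)) lam x * reflection) := by
  ext i j
  fin_cases i <;> fin_cases j <;> simp [reflection, potentialCoeff]

lemma gauss₁_neg_step (ξ h : ℝ) : gauss₁ ξ (-h) = -gauss₁ (-ξ) h := by
  rw [gauss₁, gauss₁]; ring

lemma gauss₂_neg_step (ξ h : ℝ) : gauss₂ ξ (-h) = -gauss₂ (-ξ) h := by
  rw [gauss₂, gauss₂]; ring

/-- The nodes are reflected in order. In the linear term the signs of the step and of the matrix
cancel; the commutator term is even in both. -/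
lemma magnusStep_neg_step (c : ℝ) (φ : ℝ → ℝ) (lam : ℂ) (ξ h : ℝ) :
    magnusStep (potentialCoeff c φ lam) ξ (-h) =
      reflection * magnusStep (potentialCoeff (-c) (fun x => φ (-x)) lam) (-ξ) h *
        reflection := by
  rw [magnusStep, magnusStep, ← exp_reflection_conj]
  congr 1
  rw [gauss₁_neg_step, gauss₂_neg_step, potentialCoeff_neg, potentialCoeff_neg]
  generalize potentialCoeff (-c) (fun x => φ (-x)) lam (gauss₁ (-ξ) h) = A
  generalize potentialCoeff (-c) (fun x => φ (-x)) lam (gauss₂ (-ξ) h) = B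
  have key : ∀ A B : Matrix (Fin 2) (Fin 2) ℂ,
      -(reflection * A * reflection) * -(reflection * B * reflection) =
        reflection * (A * B) * reflection := by
    intro A B
    rw [neg_mul_neg]
    calc _ = reflection * A * (reflection * reflection) * B * reflection := by
          simp only [Matrix.mul_assoc]
      _ = _ := by rw [reflection_mul_self]; simp only [Matrix.mul_assoc, Matrix.one_mul]
  rw [key, key, ← neg_add, ← Matrix.add_mul, ← Matrix.mul_add, smul_neg, neg_div, neg_smul, neg_neg,
    neg_sq]
  rw [mul_sub, sub_mul, mul_smul_comm, smul_mul_assoc, mul_smul_comm, smul_mul_assoc, mul_sub,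
    sub_mul]

lemma magnus_neg_step (c : ℝ) (φ : ℝ → ℝ) (lam : ℂ) (ξ h : ℝ) (y₀ : Fin 2 → ℂ) (k : ℕ) :
    magnus (potentialCoeff c φ lam) ξ (-h) y₀ k =
      reflection *ᵥ magnus (potentialCoeff (-c) (fun x => φ (-x)) lam) (-ξ) h
        (reflection *ᵥ y₀) k := by
  induction k with
  | zero => simp only [magnus, reflection_mulVec_mulVec]
  | succ k ih =>
    simp only [magnus]
    rw [ih, magnusStep_neg_step, ← Matrix.mulVec_mulVec, reflection_mulVec_mulVec,
      ← Matrix.mulVec_mulVec, show -(ξ + k * -h) = -ξ + k * h by ring]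

/-- `y` solves `y' = A(ξ; λ) y` on `[0, ∞)`, and `y(ξ) ∼ exp(μ ξ) (1, μ)` as `ξ → ∞`. -/
def IsRightHalfSolution (c : ℝ) (φ : ℝ → ℝ) (lam μ : ℂ) (y : ℝ → Fin 2 → ℂ) : Prop :=
  (∀ ξ ∈ Ici (0 : ℝ),
    HasDerivWithinAt y (potentialCoeff c φ lam ξ *ᵥ y ξ) (Ici 0) ξ) ∧
  Tendsto (fun ξ : ℝ => Complex.exp (-μ * (ξ : ℂ)) • y ξ) atTop (𝓝 ![1, μ])

lemma hasDerivWithinAt_reflect {s t : Set ℝ} (hst : MapsTo (fun x : ℝ => -x) t s) {x : ℝ}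
    (hy : HasDerivWithinAt y (potentialCoeff c φ lam (-x) *ᵥ y (-x)) s (-x)) :
    HasDerivWithinAt (fun x => reflection *ᵥ y (-x))
      (potentialCoeff (-c) (fun x => φ (-x)) lam x *ᵥ (reflection *ᵥ y (-x))) t x := by
  have h1 := HasDerivWithinAt.scomp x hy (hasDerivAt_neg x).hasDerivWithinAt hst
  rw [hasDerivWithinAt_pi] at h1 ⊢
  intro i
  fin_cases i
  · refine ((h1 0).congr_of_eventuallyEq (f₁ := fun x => (reflection *ᵥ y (-x)) 0)
      (Eventually.of_forall fun z => reflection_mulVec_zero _)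
      (reflection_mulVec_zero _)).congr_deriv ?_
    simp [reflection, potentialCoeff, Matrix.mulVec, dotProduct, Fin.sum_univ_two]
  · refine ((h1 1).neg.congr_of_eventuallyEq (f₁ := fun x => (reflection *ᵥ y (-x)) 1)
      (Eventually.of_forall fun z => reflection_mulVec_one _)
      (reflection_mulVec_one _)).congr_deriv ?_
    simp [reflection, potentialCoeff, Matrix.mulVec, dotProduct, Fin.sum_univ_two]
    ring

lemma tendsto_reflect {l l' : Filter ℝ} (hl : Tendsto (fun x : ℝ => -x) l' l)
    (hy : Tendsto (fun ξ : ℝ => Complex.exp (-μ * (ξ : ℂ)) • y ξ) l (𝓝 ![1, μ])) :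
    Tendsto (fun ξ : ℝ => Complex.exp (- -μ * (ξ : ℂ)) • (reflection *ᵥ y (-ξ))) l'
      (𝓝 ![1, -μ]) := by
  have h1 := hy.comp hl
  rw [tendsto_pi_nhds] at h1 ⊢
  intro i
  fin_cases i
  · change Tendsto (fun ξ : ℝ => Complex.exp (- -μ * ξ) * (reflection *ᵥ y (-ξ)) 0) l' (𝓝 1)
    simp only [reflection_mulVec_zero]
    simpa [Function.comp_def] using h1 0
  · change Tendsto (fun ξ : ℝ => Complex.exp (- -μ * ξ) * (reflection *ᵥ y (-ξ)) 1) l' (𝓝 (-μ))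
    simp only [reflection_mulVec_one]
    simpa [Function.comp_def] using (h1 1).neg

lemma IsRightHalfSolution.reflect (hy : IsRightHalfSolution c φ lam μ y) :
    IsHalfSolution (-c) (fun x => φ (-x)) lam (-μ) (fun x => reflection *ᵥ y (-x)) := by
  have hst : MapsTo (fun x : ℝ => -x) (Iic 0) (Ici 0) := fun x hx => by
    simpa using hx
  exact ⟨fun x hx => hasDerivWithinAt_reflect hst (hy.1 (-x) (hst hx)),
    tendsto_reflect tendsto_neg_atBot_atTop hy.2⟩

lemma IsHalfSolution.reflect (hy : IsHalfSolution c φ lam μ y) :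
    IsRightHalfSolution (-c) (fun x => φ (-x)) lam (-μ) (fun x => reflection *ᵥ y (-x)) := by
  have hst : MapsTo (fun x : ℝ => -x) (Ici 0) (Iic 0) := fun x hx => by
    simpa using hx
  exact ⟨fun x hx => hasDerivWithinAt_reflect hst (hy.1 (-x) (hst hx)),
    tendsto_reflect tendsto_neg_atTop_atBot hy.2⟩

/-- A solution on `[0, ∞)` and its numerical approximation, reflected. -/
lemma wedge_reflection (c : ℝ) (p r a b A B : ℂ) :
    wedge (eigenVec c p a b) (reflection *ᵥ eigenVec (-c) r A B) =
      -(r + p) * (a * A - b * B) + (r - p) * (a * B - b * A) := by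
  rw [reflection_mulVec, wedge, Matrix.det_fin_two]
  simp [eigenVec]
  ring

end Reflection

/-! ### Quadrature and the integral of `(φ')²` on the whole line. -/

section Quadrature

variable {φ : ℝ → ℝ}

/-- The nonnegative indices are listed downwards, to agree with the reflected grid, which runs from
`L` towards `0`. -/
lemma sum_Ico_neg_eq (F : ℤ → ℝ) (N : ℕ) :
    ∑ j ∈ Finset.Ico (-(N : ℤ)) N, F j =
      ∑ k ∈ Finset.range N, F (k - N) + ∑ k ∈ Finset.range N, F (N - 1 - k) := by
  have key : ∑ j ∈ Finset.Ico (-(N : ℤ)) N, F j =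
      ∑ k ∈ Finset.range N, F (-(k + 1)) + ∑ k ∈ Finset.range N, F k := by
    induction N with
    | zero => simp
    | succ n ih =>
      have e : Finset.Ico (-((n + 1 : ℕ) : ℤ)) ((n + 1 : ℕ) : ℤ) =
          insert (-((n : ℤ) + 1)) (insert (n : ℤ) (Finset.Ico (-(n : ℤ)) n)) := by
        ext j
        simp only [Finset.mem_Ico, Finset.mem_insert]
        omega
      rw [e, Finset.sum_insert (by simp), Finset.sum_insert (by simp), ih,
        Finset.sum_range_succ, Finset.sum_range_succ]
      ring
  rw [key, ← Finset.sum_range_reflect (fun k => F (-((k : ℤ) + 1))),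
    ← Finset.sum_range_reflect (fun k => F (k : ℤ))]
  congr 1 <;>
  · refine Finset.sum_congr rfl fun k hk => ?_
    have := Finset.mem_range.1 hk
    congr 1
    omega

lemma halfGaussError_sub_const (hφ : Continuous φ) (a h : ℝ) (N : ℕ) :
    halfGaussError (fun x => φ x - a) h N = halfGaussError φ h N := by
  have h1 : ∀ k, h * gaussMean (fun x => φ x - a) (grid h N k) h =
      h * gaussMean φ (grid h N k) h - h * a := fun k => by
    rw [gaussMean, gaussMean]; ring
  rw [halfGaussError, halfGaussError, intervalIntegral.integral_sub
    (hφ.intervalIntegrable _ _) (by simp)]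
  simp only [h1, Finset.sum_sub_distrib, intervalIntegral.integral_const, Finset.sum_const,
    Finset.card_range, nsmul_eq_mul, smul_eq_mul]
  ring

lemma gaussError_eq (hφ : Continuous φ) (h : ℝ) (N : ℕ) :
    gaussError φ h N = halfGaussError φ h N + halfGaussError (fun x => φ (-x)) h N := by
  have h1 : ∀ k : ℕ, φ (gauss₁ (((k : ℤ) - N : ℤ) * h) h) + φ (gauss₂ (((k : ℤ) - N : ℤ) * h) h) =
      2 * gaussMean φ (grid h N k) h := by
    intro k
    have : (((k : ℤ) - N : ℤ) : ℝ) * h = grid h N k := by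
      rw [grid]; push_cast; ring
    rw [this, gaussMean]
    ring
  have h2 : ∀ k : ℕ, φ (gauss₁ (((N : ℤ) - 1 - k : ℤ) * h) h) +
      φ (gauss₂ (((N : ℤ) - 1 - k : ℤ) * h) h) =
      2 * gaussMean (fun x => φ (-x)) (grid h N k) h := by
    intro k
    have e1 : gauss₁ (((N : ℤ) - 1 - k : ℤ) * h) h = -gauss₂ (grid h N k) h := by
      rw [gauss₁, gauss₂, grid]; push_cast; ring
    have e2 : gauss₂ (((N : ℤ) - 1 - k : ℤ) * h) h = -gauss₁ (grid h N k) h := by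
      rw [gauss₁, gauss₂, grid]; push_cast; ring
    rw [e1, e2, gaussMean]
    ring
  have h3 : ∫ x in (-(N * h))..(N * h), φ x =
      (∫ x in (-(N * h))..0, φ x) + ∫ x in (-(N * h))..0, φ (-x) := by
    rw [intervalIntegral.integral_comp_neg, neg_zero, neg_neg,
      intervalIntegral.integral_add_adjacent_intervals (hφ.intervalIntegrable _ _)
        (hφ.intervalIntegrable _ _)]
  rw [gaussError, sum_Ico_neg_eq (fun j : ℤ => φ (gauss₁ (j * h) h) + φ (gauss₂ (j * h) h)), h3,
    halfGaussError, halfGaussError]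
  simp only [h1, h2, ← Finset.mul_sum]
  ring

lemma deriv_comp_neg_sub_const (φ : ℝ → ℝ) (a x : ℝ) :
    deriv (fun x => φ (-x) - a) x = -deriv φ (-x) := by
  rw [deriv_sub_const, deriv_comp_neg]

/-- A derivative of odd order changes sign under reflection. This makes the boundary terms at `0` of
the two half-line quadratures cancel. -/
lemma iteratedDeriv_three_comp_neg (φ : ℝ → ℝ) (a a' : ℝ) :
    iteratedDeriv 3 (fun x => φ (-x) - a) 0 = -iteratedDeriv 3 (fun x => φ x - a') 0 := by
  have h1 : deriv (fun x => φ (-x) - a) = fun x => -deriv φ (-x) := by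
    funext x; exact deriv_comp_neg_sub_const φ a x
  have h2 : deriv (fun x => φ x - a') = deriv φ := by
    funext x; rw [deriv_sub_const]
  rw [iteratedDeriv_succ', iteratedDeriv_succ' (f := fun x => φ x - a'), h1, h2]
  have h3 := iteratedDeriv_comp_neg 2 (deriv φ) 0
  rw [iteratedDeriv_fun_neg, h3]
  simp

/-- The error of the composite Gauss quadrature, when the integrand tends exponentially fast to
its limits. -/
theorem exists_abs_gaussError_le {K K' β a a' : ℝ} (hm : ExpDecay (fun x => φ x - a) K β)
    (hp : ExpDecay (fun x => φ (-x) - a') K' β) (h₀ : ℝ) :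
    ∃ C, 0 ≤ C ∧ ∀ (h : ℝ) (N : ℕ), 0 < h → h ≤ h₀ →
      |halfGaussError (fun x => φ x - a) h N + halfGaussError (fun x => φ (-x) - a') h N| ≤
        C * (h ^ 6 + h ^ 4 * Real.exp (-β * (N * h))) := by
  obtain ⟨C₁, hC₁, h1⟩ := hm.abs_halfGaussError_le h₀
  obtain ⟨C₂, hC₂, h2⟩ := hp.abs_halfGaussError_le h₀
  refine ⟨C₁ + C₂, by positivity, fun h N hh hh₀ => ?_⟩
  specialize h1 h N hh hh₀
  specialize h2 h N hh hh₀
  rw [iteratedDeriv_three_comp_neg φ a' a] at h2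
  have h3 := (abs_add_le _ _).trans (add_le_add h1 h2)
  rw [← add_mul] at h3
  refine le_trans (le_of_eq ?_) h3
  congr 1
  ring

lemma integrableOn_deriv_sq {g : ℝ → ℝ} {K β : ℝ} (hg : ExpDecay g K β) :
    MeasureTheory.IntegrableOn (fun x => deriv g x ^ 2) (Iic 0) := by
  have hc : Continuous (deriv g) := (contDiff_infty_iff_deriv.1 hg.contDiff).2.continuous
  refine integrableOn_Iic_of_le_exp (C := K ^ 2) (hc.pow 2) hg.rate_pos (fun s hs => ?_) 0
  have h1 := hg.abs_deriv_le hs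
  have h2 := hg.exp_le_one hs
  have hK := hg.pos
  change |deriv g s ^ 2| ≤ _
  rw [abs_pow]
  calc |deriv g s| ^ 2 ≤ (K * Real.exp (β * s)) ^ 2 := by gcongr
    _ = K ^ 2 * (Real.exp (β * s) * Real.exp (β * s)) := by ring
    _ ≤ K ^ 2 * (Real.exp (β * s) * 1) := by gcongr
    _ = _ := by ring

theorem integrable_and_integral_deriv_sq {K K' β β' a a' : ℝ}
    (hm : ExpDecay (fun x => φ x - a) K β) (hp : ExpDecay (fun x => φ (-x) - a') K' β') :
    MeasureTheory.Integrable (fun x => deriv φ x ^ 2) ∧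
    ∫ x, deriv φ x ^ 2 = (∫ x in Iic 0, deriv (fun x => φ x - a) x ^ 2) +
      ∫ x in Iic 0, deriv (fun x => φ (-x) - a') x ^ 2 := by
  have h1 := integrableOn_deriv_sq hm
  have h2 := integrableOn_deriv_sq hp
  simp only [deriv_comp_neg_sub_const, neg_sq, deriv_sub_const_fun] at h1 h2 ⊢
  have h3 : MeasureTheory.IntegrableOn (fun x => deriv φ x ^ 2) (Ici 0) := by
    have e := (MeasureTheory.Measure.measurePreserving_neg
      (MeasureTheory.volume : MeasureTheory.Measure ℝ)).integrableOn_comp_preimage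
      (MeasurableEquiv.neg ℝ).measurableEmbedding (f := fun x => deriv φ x ^ 2) (s := Ici 0)
    refine e.1 ?_
    simpa [Function.comp_def] using h2
  have h4 := h3.mono_set (Ioi_subset_Ici le_rfl)
  constructor
  · rw [← MeasureTheory.integrableOn_univ, ← Iic_union_Ioi (a := (0 : ℝ))]
    exact h1.union h4
  · rw [← intervalIntegral.integral_Iic_add_Ioi h1 h4,
      integral_comp_neg_Iic 0 (fun x => deriv φ x ^ 2), neg_zero]

end Quadrature

end EvansMagnus

/-! ### From errors in the coordinates to the error in the determinant. -/

namespace EvansMagnus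

open Set

/-- One side of the data that determine the Evans function and its numerical approximation: the
quantities of size `1/|q|` are bounded in terms of a comparable `t`. -/
structure SideEstimate (Λ h t e : ℝ) (q m a b a' b' : ℂ) : Prop where
  ne_zero : q ≠ 0
  norm_mul_le : ‖q‖ * t ≤ Λ
  inv_le : ‖q‖⁻¹ ≤ Λ * t
  main_le : ‖m‖ ≤ Λ * h ^ 2
  fst_le : ‖a - 1‖ ≤ Λ * t
  snd_le : ‖b‖ ≤ Λ * t
  snd_sub_le : ‖b' - b‖ ≤ Λ * (h ^ 2 * t)
  fst_sub_le : ‖a' - a - m / q‖ ≤ Λ * (h ^ 2 * t ^ 2 + e * t)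

namespace SideEstimate

variable {Λ h t e : ℝ} {q m a b a' b' : ℂ}

lemma norm_fst_sub_le (S : SideEstimate Λ h t e q m a b a' b') (hΛ : 1 ≤ Λ) (ht : 0 < t)
    (htΛ : t ≤ Λ) (he : e ≤ Λ * h ^ 2) : ‖a' - a‖ ≤ 3 * Λ ^ 2 * (h ^ 2 * t) := by
  have h1 : ‖m / q‖ ≤ Λ * h ^ 2 * (Λ * t) := by
    rw [norm_div, div_eq_mul_inv]
    exact mul_le_mul S.main_le S.inv_le (by positivity) (by positivity)
  have h2 : ‖a' - a‖ ≤ ‖a' - a - m / q‖ + ‖m / q‖ := by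
    simpa using norm_add_le (a' - a - m / q) (m / q)
  refine h2.trans ((add_le_add S.fst_sub_le h1).trans ?_)
  calc _ ≤ Λ * (h ^ 2 * (t * Λ) + Λ * h ^ 2 * t) + Λ * h ^ 2 * (Λ * t) := by
        rw [sq t]; gcongr
    _ = _ := by ring

lemma norm_fst_le (S : SideEstimate Λ h t e q m a b a' b') (hΛ : 1 ≤ Λ)
    (htΛ : t ≤ Λ) : ‖a‖ ≤ 2 * Λ ^ 2 := by
  have h1 : ‖a‖ ≤ ‖a - 1‖ + 1 := by simpa using norm_add_le (a - 1) 1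
  have h2 : Λ * t ≤ Λ * Λ := by gcongr
  have h3 : 1 ≤ Λ ^ 2 := one_le_pow₀ hΛ
  linarith [S.fst_le]

lemma norm_num_fst_sub_one_le (S : SideEstimate Λ h t e q m a b a' b') (hΛ : 1 ≤ Λ)
    (ht : 0 < t) (htΛ : t ≤ Λ) (he : e ≤ Λ * h ^ 2) (hh : h ^ 2 ≤ Λ) :
    ‖a' - 1‖ ≤ 4 * Λ ^ 3 * t := by
  have h1 : ‖a' - 1‖ ≤ ‖a' - a‖ + ‖a - 1‖ := by simpa using norm_add_le (a' - a) (a - 1)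
  have h2 := S.norm_fst_sub_le hΛ ht htΛ he
  have h3 : 3 * Λ ^ 2 * (h ^ 2 * t) ≤ 3 * Λ ^ 2 * (Λ * t) := by gcongr
  have h4 : Λ * t ≤ Λ ^ 3 * t := by gcongr; exact le_self_pow₀ hΛ (by norm_num)
  linarith [S.fst_le]

lemma norm_num_fst_le (S : SideEstimate Λ h t e q m a b a' b') (hΛ : 1 ≤ Λ)
    (ht : 0 < t) (htΛ : t ≤ Λ) (he : e ≤ Λ * h ^ 2) (hh : h ^ 2 ≤ Λ) : ‖a'‖ ≤ 5 * Λ ^ 4 := by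
  have h1 : ‖a'‖ ≤ ‖a' - 1‖ + 1 := by simpa using norm_add_le (a' - 1) 1
  have h2 := S.norm_num_fst_sub_one_le hΛ ht htΛ he hh
  have h3 : 4 * Λ ^ 3 * t ≤ 4 * Λ ^ 3 * Λ := by gcongr
  have h4 : 1 ≤ Λ ^ 4 := one_le_pow₀ hΛ
  linarith

lemma norm_num_snd_le (S : SideEstimate Λ h t e q m a b a' b') (hΛ : 1 ≤ Λ)
    (ht : 0 < t) (hh : h ^ 2 ≤ Λ) : ‖b'‖ ≤ 2 * Λ ^ 2 * t := by
  have h1 : ‖b'‖ ≤ ‖b' - b‖ + ‖b‖ := by simpa using norm_add_le (b' - b) b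
  have h2 : Λ * (h ^ 2 * t) ≤ Λ * (Λ * t) := by gcongr
  have h3 : Λ * t ≤ Λ ^ 2 * t := by gcongr; exact le_self_pow₀ hΛ (by norm_num)
  linarith [S.snd_le, S.snd_sub_le]

end SideEstimate

/-- Since `a' - a ≈ m/p`, `A' - A ≈ n/r` and `r + p` is close to both `2p` and `2r`, the product
`-(r + p) a A` changes by about `-2(m + n)`. The other terms contain two second-coordinate factors
or the small difference `r - p`. The powers of `Λ` are not optimised. -/
lemma norm_wedge_error_le {Λ h t e : ℝ} {p m a b a' b' r n A B A' B' : ℂ}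
    (S : SideEstimate Λ h t e p m a b a' b') (T : SideEstimate Λ h t e r n A B A' B')
    (hΛ : 1 ≤ Λ) (ht : 0 < t) (htΛ : t ≤ Λ) (he0 : 0 ≤ e) (he : e ≤ Λ * h ^ 2) (hh : h ^ 2 ≤ Λ)
    (hpr : ‖r - p‖ ≤ Λ * t) :
    ‖(-(r + p) * (a' * A' - b' * B') + (r - p) * (a' * B' - b' * A')) -
      (-(r + p) * (a * A - b * B) + (r - p) * (a * B - b * A)) + 2 * (m + n)‖ ≤
      60 * Λ ^ 8 * (h ^ 2 * t + e) := by
  have hp0 := S.ne_zero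
  have hr0 := T.ne_zero
  obtain ⟨ρ, hρ⟩ : ∃ ρ, ρ = a' - a - m / p := ⟨_, rfl⟩
  obtain ⟨τ, hτ⟩ : ∃ τ, τ = A' - A - n / r := ⟨_, rfl⟩
  have hρn : ‖ρ‖ ≤ Λ * (h ^ 2 * t + e) * t := by
    rw [hρ]; exact S.fst_sub_le.trans (le_of_eq (by ring))
  have hτn : ‖τ‖ ≤ Λ * (h ^ 2 * t + e) * t := by
    rw [hτ]; exact T.fst_sub_le.trans (le_of_eq (by ring))
  have id : (-(r + p) * (a' * A' - b' * B') + (r - p) * (a' * B' - b' * A')) -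
      (-(r + p) * (a * A - b * B) + (r - p) * (a * B - b * A)) + 2 * (m + n) =
      -((r + p) * ρ * A') - (m * ((r - p) / p) * A') - 2 * m * (A' - 1) -
      (r + p) * a * τ + n * ((r - p) / r) * a - 2 * n * (a - 1) +
      (r + p) * ((b' - b) * B' + b * (B' - B)) +
      (r - p) * (a' * (B' - B) + (a' - a) * B - (b' - b) * A' - b * (A' - A)) := by
    rw [hρ, hτ]
    field_simp
    ring
  have hs : ‖r + p‖ * t ≤ 2 * Λ := by
    have h1 : ‖r + p‖ * t ≤ (‖r‖ + ‖p‖) * t := by gcongr; exact norm_add_le _ _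
    linarith [S.norm_mul_le, T.norm_mul_le]
  have hA' := T.norm_num_fst_le hΛ ht htΛ he hh
  have ha' := S.norm_num_fst_le hΛ ht htΛ he hh
  have ha := S.norm_fst_le hΛ htΛ
  have hB' := T.norm_num_snd_le hΛ ht hh
  have hdp : ‖(r - p) / p‖ ≤ Λ * t * (Λ * t) := by
    rw [norm_div, div_eq_mul_inv]
    exact mul_le_mul hpr S.inv_le (by positivity) (by positivity)
  have hdr : ‖(r - p) / r‖ ≤ Λ * t * (Λ * t) := by
    rw [norm_div, div_eq_mul_inv]
    exact mul_le_mul hpr T.inv_le (by positivity) (by positivity)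
  obtain ⟨D, hD⟩ : ∃ D, D = h ^ 2 * t := ⟨_, rfl⟩
  have hD0 : 0 ≤ D := by rw [hD]; positivity
  have x1 : ‖(r + p) * ρ * A'‖ ≤ 10 * Λ ^ 8 * (D + e) := by
    rw [norm_mul, norm_mul]
    calc _ ≤ ‖r + p‖ * (Λ * (h ^ 2 * t + e) * t) * (5 * Λ ^ 4) := by gcongr
      _ = ‖r + p‖ * t * (Λ * (D + e)) * (5 * Λ ^ 4) := by rw [hD]; ring
      _ ≤ 2 * Λ * (Λ * (D + e)) * (5 * Λ ^ 4) := by gcongr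
      _ = 10 * Λ ^ 6 * (D + e) := by ring
      _ ≤ _ := by gcongr; norm_num
  have x2 : ‖m * ((r - p) / p) * A'‖ ≤ 5 * Λ ^ 8 * D := by
    rw [norm_mul, norm_mul]
    calc _ ≤ Λ * h ^ 2 * (Λ * t * (Λ * t)) * (5 * Λ ^ 4) := by
          gcongr; exact S.main_le
      _ = 5 * Λ ^ 7 * D * t := by rw [hD]; ring
      _ ≤ 5 * Λ ^ 7 * D * Λ := by gcongr
      _ = _ := by ring
  have x3 : ‖2 * m * (A' - 1)‖ ≤ 8 * Λ ^ 8 * D := by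
    rw [norm_mul, norm_mul, Complex.norm_ofNat]
    calc _ ≤ 2 * (Λ * h ^ 2) * (4 * Λ ^ 3 * t) := by
          gcongr
          · exact S.main_le
          · exact T.norm_num_fst_sub_one_le hΛ ht htΛ he hh
      _ = 8 * Λ ^ 4 * D := by rw [hD]; ring
      _ ≤ _ := by gcongr; norm_num
  have x4 : ‖(r + p) * a * τ‖ ≤ 4 * Λ ^ 8 * (D + e) := by
    rw [norm_mul, norm_mul]
    calc _ ≤ ‖r + p‖ * (2 * Λ ^ 2) * (Λ * (h ^ 2 * t + e) * t) := by gcongr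
      _ = ‖r + p‖ * t * (2 * Λ ^ 2) * (Λ * (D + e)) := by rw [hD]; ring
      _ ≤ 2 * Λ * (2 * Λ ^ 2) * (Λ * (D + e)) := by gcongr
      _ = 4 * Λ ^ 4 * (D + e) := by ring
      _ ≤ _ := by gcongr; norm_num
  have x5 : ‖n * ((r - p) / r) * a‖ ≤ 2 * Λ ^ 8 * D := by
    rw [norm_mul, norm_mul]
    calc _ ≤ Λ * h ^ 2 * (Λ * t * (Λ * t)) * (2 * Λ ^ 2) := by
          gcongr; exact T.main_le
      _ = 2 * Λ ^ 5 * D * t := by rw [hD]; ring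
      _ ≤ 2 * Λ ^ 5 * D * Λ := by gcongr
      _ = 2 * Λ ^ 6 * D := by ring
      _ ≤ _ := by gcongr; norm_num
  have x6 : ‖2 * n * (a - 1)‖ ≤ 2 * Λ ^ 8 * D := by
    rw [norm_mul, norm_mul, Complex.norm_ofNat]
    calc _ ≤ 2 * (Λ * h ^ 2) * (Λ * t) := by
          gcongr
          · exact T.main_le
          · exact S.fst_le
      _ = 2 * Λ ^ 2 * D := by rw [hD]; ring
      _ ≤ _ := by gcongr; norm_num
  have x7 : ‖(r + p) * ((b' - b) * B' + b * (B' - B))‖ ≤ 6 * Λ ^ 8 * D := by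
    have h1 : ‖(b' - b) * B' + b * (B' - B)‖ ≤ 3 * Λ ^ 3 * (D * t) := by
      refine (norm_add_le _ _).trans ?_
      rw [norm_mul, norm_mul]
      calc _ ≤ Λ * (h ^ 2 * t) * (2 * Λ ^ 2 * t) + Λ * t * (Λ * (h ^ 2 * t)) := by
            gcongr
            exacts [S.snd_sub_le, S.snd_le, T.snd_sub_le]
        _ = 2 * Λ ^ 3 * (D * t) + Λ ^ 2 * (D * t) := by rw [hD]; ring
        _ ≤ 2 * Λ ^ 3 * (D * t) + Λ ^ 3 * (D * t) := by gcongr; norm_num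
        _ = _ := by ring
    rw [norm_mul]
    calc _ ≤ ‖r + p‖ * (3 * Λ ^ 3 * (D * t)) := by gcongr
      _ = ‖r + p‖ * t * (3 * Λ ^ 3 * D) := by ring
      _ ≤ 2 * Λ * (3 * Λ ^ 3 * D) := by gcongr
      _ = 6 * Λ ^ 4 * D := by ring
      _ ≤ _ := by gcongr; norm_num
  have x8 : ‖(r - p) * (a' * (B' - B) + (a' - a) * B - (b' - b) * A' - b * (A' - A))‖ ≤
      16 * Λ ^ 8 * D := by
    have h1 : ‖a' * (B' - B)‖ ≤ 5 * Λ ^ 4 * (Λ * D) := by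
      rw [norm_mul, hD]; gcongr; exact T.snd_sub_le
    have h2 : ‖(a' - a) * B‖ ≤ 3 * Λ ^ 2 * D * (Λ * Λ) := by
      rw [norm_mul, hD]
      exact mul_le_mul (S.norm_fst_sub_le hΛ ht htΛ he)
        (T.snd_le.trans (by gcongr)) (norm_nonneg _) (by positivity)
    have h3 : ‖(b' - b) * A'‖ ≤ Λ * D * (5 * Λ ^ 4) := by
      rw [norm_mul, hD]; gcongr; exact S.snd_sub_le
    have h4 : ‖b * (A' - A)‖ ≤ Λ * Λ * (3 * Λ ^ 2 * D) := by
      rw [norm_mul, hD]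
      exact mul_le_mul (S.snd_le.trans (by gcongr)) (T.norm_fst_sub_le hΛ ht htΛ he)
        (norm_nonneg _) (by positivity)
    have h5 : ‖a' * (B' - B) + (a' - a) * B - (b' - b) * A' - b * (A' - A)‖ ≤
        16 * Λ ^ 5 * D := by
      have w : Λ ^ 4 * D ≤ Λ ^ 5 * D := by gcongr; norm_num
      refine (norm_sub_le _ _).trans ((add_le_add ((norm_sub_le _ _).trans (add_le_add
        ((norm_add_le _ _).trans (add_le_add h1 h2)) h3)) h4).trans ?_)
      calc _ = 10 * (Λ ^ 5 * D) + 6 * (Λ ^ 4 * D) := by ring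
        _ ≤ 10 * (Λ ^ 5 * D) + 6 * (Λ ^ 5 * D) := by gcongr
        _ = _ := by ring
    rw [norm_mul]
    calc _ ≤ Λ * Λ * (16 * Λ ^ 5 * D) := by
          gcongr
          exact hpr.trans (by gcongr)
      _ = 16 * Λ ^ 7 * D := by ring
      _ ≤ _ := by gcongr; norm_num
  rw [id, ← hD]
  refine (norm_add_le_of_le (norm_add_le_of_le (norm_sub_le_of_le (norm_add_le_of_le
    (norm_sub_le_of_le (norm_sub_le_of_le (norm_sub_le_of_le ((norm_neg _).trans_le x1) x2) x3)
    x4) x5) x6) x7) x8).trans ?_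
  have w1 : 0 ≤ Λ ^ 8 * D := by positivity
  have w2 : 0 ≤ Λ ^ 8 * e := by positivity
  nlinarith

end EvansMagnus

/-! ### The sector condition and the size of `κ₋` and `κ₊`. -/

namespace EvansMagnus

open Set

section Spectrum

variable {f : ℝ → ℝ} {c v ε : ℝ} {lam : ℂ}

lemma half_kappa_sq (f : ℝ → ℝ) (c v : ℝ) (lam : ℂ) :
    (kappa f c v lam / 2) ^ 2 = (c : ℂ) ^ 2 / 4 + lam - (deriv f v : ℝ) := by
  rw [div_pow, kappa, complex_sqrt_sq]
  ring

lemma muPlus_eq (f : ℝ → ℝ) (c v : ℝ) (lam : ℂ) :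
    muPlus f c v lam = kappa f c v lam / 2 - c / 2 := by
  rw [muPlus]; ring

lemma neg_muMinus_eq (f : ℝ → ℝ) (c v : ℝ) (lam : ℂ) :
    -muMinus f c v lam = kappa f c v lam / 2 - ((-c : ℝ) : ℂ) / 2 := by
  rw [muMinus]; push_cast; ring

/-- Capping `ε` at `π/4` keeps the sine positive for every `ε > 0`, including those for which the
sector is empty. -/
lemma sin_mul_norm_le_re {z : ℂ} (hε : 0 < ε) (hz : |z.arg| < Real.pi / 2 - ε) :
    Real.sin (min ε (Real.pi / 4)) * ‖z‖ ≤ z.re := by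
  have h1 : |z.arg| ≤ Real.pi / 2 - min ε (Real.pi / 4) := by
    linarith [min_le_left ε (Real.pi / 4)]
  have h2 : 0 < min ε (Real.pi / 4) := lt_min hε (by positivity)
  have h3 := Real.cos_le_cos_of_nonneg_of_le_pi (abs_nonneg z.arg)
    (by linarith [Real.pi_pos]) h1
  rw [Real.cos_pi_div_two_sub, Real.cos_abs] at h3
  calc _ ≤ Real.cos z.arg * ‖z‖ := by gcongr
    _ = z.re := by rw [mul_comm, Complex.norm_mul_cos_arg]

lemma half_kappa_re_ge (hε : 0 < ε) (hz : |(kappa f c v lam).arg| < Real.pi / 2 - ε) :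
    Real.sin (min ε (Real.pi / 4)) * ‖kappa f c v lam / 2‖ ≤ (kappa f c v lam / 2).re := by
  have h1 := sin_mul_norm_le_re hε hz
  rw [norm_div, Complex.norm_ofNat, Complex.div_ofNat_re]
  linarith

lemma sin_min_pos (hε : 0 < ε) : 0 < Real.sin (min ε (Real.pi / 4)) :=
  Real.sin_pos_of_pos_of_lt_pi (lt_min hε (by positivity))
    (by linarith [min_le_right ε (Real.pi / 4), Real.pi_pos])

lemma sqrt_norm_comparable {q z : ℂ} (hq : q ^ 2 = lam + z) (hz : 2 * ‖z‖ ≤ ‖lam‖) :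
    √‖lam‖ ≤ 2 * ‖q‖ ∧ ‖q‖ ≤ 2 * √‖lam‖ := by
  have h1 : ‖q‖ ^ 2 = ‖lam + z‖ := by rw [← hq, norm_pow]
  have h2 := norm_add_le lam z
  have h3 : ‖lam‖ ≤ ‖lam + z‖ + ‖z‖ := by simpa using norm_sub_le (lam + z) z
  have h4 := norm_nonneg lam
  have h5 := Real.sq_sqrt h4
  constructor
  · refine le_of_sq_le_sq ?_ (by positivity)
    nlinarith
  · refine le_of_sq_le_sq ?_ (by positivity)
    nlinarith

/-- Both roots lie in the same sector of the right half-plane, so `r + p` cannot be small. -/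
lemma norm_sub_le_of_sq_sub {p r k : ℂ} {σ : ℝ} (hk : r ^ 2 - p ^ 2 = k) (hσ : 0 < σ)
    (hp0 : p ≠ 0) (hp : σ * ‖p‖ ≤ p.re) (hr : σ * ‖r‖ ≤ r.re) :
    ‖r - p‖ ≤ ‖k‖ / σ * ‖p‖⁻¹ := by
  have hpn : 0 < ‖p‖ := norm_pos_iff.2 hp0
  have h1 : σ * ‖p‖ ≤ ‖r + p‖ := by
    refine le_trans ?_ (Complex.re_le_norm _)
    rw [Complex.add_re]
    have : 0 ≤ σ * ‖r‖ := by positivity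
    linarith
  have h2 : ‖r - p‖ * ‖r + p‖ = ‖k‖ := by
    rw [← norm_mul, ← hk]
    congr 1
    ring
  rw [← div_eq_mul_inv, div_div, le_div_iff₀ (by positivity), ← h2]
  gcongr

end Spectrum

lemma HalfLineEstimate.sideEstimate {g : ℝ → ℝ} {β C h t Λ : ℝ} {N : ℕ} {q a b a' b' : ℂ}
    (E : HalfLineEstimate g β C h N q a b a' b') (hC : 0 ≤ C) (hCΛ : 4 * C ≤ Λ) (hΛ : 2 ≤ Λ)
    (hh : 0 < h) (ht : 0 < t) (hq : q ≠ 0) (hqt : ‖q‖ * t ≤ 2) (hqi : ‖q‖⁻¹ ≤ 2 * t)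
    (hm : |h ^ 4 / 288 * (∫ x in Iic 0, deriv g x ^ 2) - halfGaussError g h N / 2| ≤
      Λ * h ^ 2) :
    SideEstimate Λ h t (h ^ 6 + h ^ 4 * Real.exp (-β * (N * h))) q
      ((h ^ 4 / 288 * (∫ x in Iic 0, deriv g x ^ 2) - halfGaussError g h N / 2 : ℝ) : ℂ)
      a b a' b' := by
  have h1 : C * ‖q‖⁻¹ ≤ Λ * t := by
    calc _ ≤ C * (2 * t) := by gcongr
      _ ≤ 4 * C * t := by
        have : 0 ≤ C * t := by positivity
        linarith
      _ ≤ _ := by gcongr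
  refine ⟨hq, hqt.trans hΛ, hqi.trans (by gcongr), by rwa [Complex.norm_real, Real.norm_eq_abs],
    E.fst_le.trans h1, E.snd_le.trans h1, E.snd_sub_le.trans ?_, E.fst_sub_le.trans ?_⟩
  · calc C * (h ^ 2 * ‖q‖⁻¹) = h ^ 2 * (C * ‖q‖⁻¹) := by ring
      _ ≤ h ^ 2 * (Λ * t) := by gcongr
      _ = _ := by ring
  · obtain ⟨e, he⟩ : ∃ e, e = h ^ 6 + h ^ 4 * Real.exp (-β * (N * h)) := ⟨_, rfl⟩
    have he0 : 0 ≤ e := by rw [he]; positivity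
    rw [← he]
    calc C * (h ^ 2 * ‖q‖⁻¹ ^ 2 + e * ‖q‖⁻¹) ≤ C * (h ^ 2 * (2 * t) ^ 2 + e * (2 * t)) := by
          gcongr
      _ = 4 * C * (h ^ 2 * t ^ 2) + 2 * C * (e * t) := by ring
      _ ≤ 4 * C * (h ^ 2 * t ^ 2) + 4 * C * (e * t) := by gcongr; norm_num
      _ = 4 * C * (h ^ 2 * t ^ 2 + e * t) := by ring
      _ ≤ _ := by gcongr

/-! ### The error in the Evans function and its lower bound. -/

section Evans

variable {f : ℝ → ℝ} {c : ℝ} {u : ℝ → ℝ} {um up K β : ℝ} {lam : ℂ}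

lemma isLeftSolution_iff (y : ℝ → Fin 2 → ℂ) : IsLeftSolution f c u um lam y ↔
    IsHalfSolution c (phi f u) lam (kappa f c um lam / 2 - c / 2) y := by
  rw [← muPlus_eq]
  rfl

lemma isRightSolution_iff (y : ℝ → Fin 2 → ℂ) : IsRightSolution f c u up lam y ↔
    IsHalfSolution (-c) (fun x => phi f u (-x)) lam (kappa f c up lam / 2 - ((-c : ℝ) : ℂ) / 2)
      (fun x => reflection *ᵥ y (-x)) := by
  rw [← neg_muMinus_eq]
  constructor
  · exact fun hy => IsRightHalfSolution.reflect hy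
  · intro hy
    have h1 := hy.reflect
    simp only [neg_neg, reflection_mulVec_mulVec] at h1
    exact h1

/-- The error in the Evans function, for exponentially decaying potentials. -/
theorem exists_norm_evansError_le (hm : ExpDecay (fun x => phi f u x - deriv f um) K β)
    (hp : ExpDecay (fun x => phi f u (-x) - deriv f up) K β) {ε h₀ : ℝ} (hε : 0 < ε)
    (hh₀ : 0 < h₀) :
    ∃ C M : ℝ, 0 < M ∧ ∀ (h : ℝ) (N : ℕ) (lam : ℂ), 0 < h → h ≤ h₀ → M ≤ h * √‖lam‖ →
      InSector f c um up ε lam →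
      ‖evansError f c u um up h N lam -
          ((-(1 / 144) * h ^ 4 * ∫ x, deriv (phi f u) x ^ 2 : ℝ) : ℂ)‖ ≤
        C * (h ^ 2 / √‖lam‖ + h ^ 6 + h ^ 4 * Real.exp (-β * (N * h))) := by
  have hσ := sin_min_pos hε
  obtain ⟨σ, hσe⟩ : ∃ σ, σ = Real.sin (min ε (Real.pi / 4)) := ⟨_, rfl⟩
  rw [← hσe] at hσ
  have hβ := hm.rate_pos
  obtain ⟨C₁, M₁, hC₁, hM₁, H₁⟩ := hm.half_line (c := c) (φ := phi f u) (φinf := deriv f um)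
    (fun x => by ring) hσ hh₀
  obtain ⟨C₂, M₂, hC₂, hM₂, H₂⟩ := hp.half_line (c := -c) (φ := fun x => phi f u (-x))
    (φinf := deriv f up) (fun x => by ring) hσ hh₀
  obtain ⟨D₁, hD₁, E₁⟩ := hm.abs_main_le h₀
  obtain ⟨D₂, hD₂, E₂⟩ := hp.abs_main_le h₀
  obtain ⟨G, hG, EG⟩ := exists_abs_gaussError_le hm hp h₀
  obtain ⟨z₁, hz₁⟩ : ∃ z : ℂ, z = (c : ℂ) ^ 2 / 4 - (deriv f um : ℝ) := ⟨_, rfl⟩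
  obtain ⟨z₂, hz₂⟩ : ∃ z : ℂ, z = (c : ℂ) ^ 2 / 4 - (deriv f up : ℝ) := ⟨_, rfl⟩
  obtain ⟨Λ, hΛ⟩ : ∃ Λ, Λ = 2 + ‖z₂ - z₁‖ / σ * 2 + 4 * C₁ + 4 * C₂ + D₁ * h₀ ^ 2 +
    D₂ * h₀ ^ 2 + h₀ ^ 2 + (h₀ ^ 2 + 1) * h₀ ^ 2 := ⟨_, rfl⟩
  have l1 : 0 ≤ ‖z₂ - z₁‖ / σ * 2 := by positivity
  have l2 : 0 ≤ D₁ * h₀ ^ 2 := by positivity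
  have l3 : 0 ≤ D₂ * h₀ ^ 2 := by positivity
  have l4 : 0 ≤ (h₀ ^ 2 + 1) * h₀ ^ 2 := by positivity
  have l5 : 0 ≤ h₀ ^ 2 := by positivity
  have hΛ2 : 2 ≤ Λ := by linarith
  -- The first summand allows for the factor two between `√|λ|` and `|p|`, `|r|`. The second forces
  -- `√|λ| ≥ 1` and `|λ| ≥ 2|zᵢ|`, where `z₁`, `z₂` are the parts of `p²`, `r²` that do not depend
  -- on `λ`.
  refine ⟨60 * Λ ^ 8 + G, 2 * (M₁ + M₂) + h₀ * (1 + 2 * ‖z₁‖ + 2 * ‖z₂‖), by positivity,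
    fun h N lam hh hhh₀ hM hsec => ?_⟩
  obtain ⟨s, hs⟩ : ∃ s, s = √‖lam‖ := ⟨_, rfl⟩
  obtain ⟨p, hp'⟩ : ∃ p, p = kappa f c um lam / 2 := ⟨_, rfl⟩
  obtain ⟨r, hr'⟩ : ∃ r, r = kappa f c up lam / 2 := ⟨_, rfl⟩
  have hpre := half_kappa_re_ge hε hsec.1
  have hrre := half_kappa_re_ge hε hsec.2
  have hpsq := half_kappa_sq f c um lam
  have hrsq := half_kappa_sq f c up lam
  rw [← hp', ← hσe] at hpre
  rw [← hr', ← hσe] at hrre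
  rw [← hp'] at hpsq
  rw [← hr'] at hrsq
  rw [← hs] at hM
  have hsge : 1 + 2 * ‖z₁‖ + 2 * ‖z₂‖ ≤ s := by
    have h1 : h * s ≤ h₀ * s := by
      rw [hs]; gcongr
    exact le_of_mul_le_mul_left (by linarith) hh₀
  have hz1 := norm_nonneg z₁
  have hz2 := norm_nonneg z₂
  have hs1 : 1 ≤ s := by linarith
  have hs0 : 0 < s := by linarith
  have hlam : s ≤ ‖lam‖ := by
    have := Real.sq_sqrt (norm_nonneg lam)
    rw [← hs] at this
    nlinarith
  obtain ⟨p1, p2⟩ := sqrt_norm_comparable (q := p) (z := z₁) (lam := lam)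
    (by rw [hpsq, hz₁]; ring) (by linarith)
  obtain ⟨r1, r2⟩ := sqrt_norm_comparable (q := r) (z := z₂) (lam := lam)
    (by rw [hrsq, hz₂]; ring) (by linarith)
  rw [← hs] at p1 p2 r1 r2
  have hMp : M₁ ≤ h * ‖p‖ := by
    have h1 : h * s ≤ h * (2 * ‖p‖) := by gcongr
    have h2 : 0 ≤ h₀ * (1 + 2 * ‖z₁‖ + 2 * ‖z₂‖) := by positivity
    linarith
  have hMr : M₂ ≤ h * ‖r‖ := by
    have h1 : h * s ≤ h * (2 * ‖r‖) := by gcongr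
    have h2 : 0 ≤ h₀ * (1 + 2 * ‖z₁‖ + 2 * ‖z₂‖) := by positivity
    linarith
  have hpn : 0 < ‖p‖ := by linarith
  have hrn : 0 < ‖r‖ := by linarith
  obtain ⟨t, ht⟩ : ∃ t, t = s⁻¹ := ⟨_, rfl⟩
  have ht0 : 0 < t := ht ▸ inv_pos.2 hs0
  have ht1 : t ≤ 1 := ht ▸ inv_le_one_of_one_le₀ hs1
  have hts : s * t = 1 := by rw [ht, mul_inv_cancel₀ hs0.ne']
  have inv_le : ∀ x : ℝ, 0 < x → s ≤ 2 * x → x⁻¹ ≤ 2 * t := by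
    intro x hx hsx
    rw [inv_le_iff_one_le_mul₀ hx]
    calc 1 = s * t := hts.symm
      _ ≤ 2 * x * t := by gcongr
      _ = _ := by ring
  have mul_le : ∀ x : ℝ, x ≤ 2 * s → x * t ≤ 2 := by
    intro x hx
    calc x * t ≤ 2 * s * t := by gcongr
      _ = 2 := by rw [mul_assoc, hts, mul_one]
  obtain ⟨ex₁, ab₁⟩ := H₁ h N lam p hh hhh₀ hMp hpre hpsq
  obtain ⟨ex₂, ab₂⟩ := H₂ h N lam r hh hhh₀ hMr hrre (by rw [hrsq]; push_cast; ring)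
  -- Existence guarantees that the choice operator returns a genuine solution.
  have left : IsLeftSolution f c u um lam (leftSolution f c u um lam) := by
    obtain ⟨y, hy⟩ := ex₁
    rw [hp'] at hy
    exact Classical.epsilon_spec ⟨y, (isLeftSolution_iff y).2 hy⟩
  have right : IsRightSolution f c u up lam (rightSolution f c u up lam) := by
    obtain ⟨y, hy⟩ := ex₂
    rw [hr'] at hy
    refine Classical.epsilon_spec ⟨fun x => reflection *ᵥ y (-x), (isRightSolution_iff _).2 ?_⟩
    simpa only [neg_neg, reflection_mulVec_mulVec] using hy
  obtain ⟨a, b, a', b', hy₁, hn₁, F₁⟩ := ab₁ _ (hp' ▸ (isLeftSolution_iff _).1 left)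
  obtain ⟨A, B, A', B', hy₂, hn₂, F₂⟩ := ab₂ _ (hr' ▸ (isRightSolution_iff _).1 right)
  simp only [neg_zero, neg_neg] at hy₂ hn₂
  have hD : evans f c u um up lam =
      -(r + p) * (a * A - b * B) + (r - p) * (a * B - b * A) := by
    rw [evans, hy₁, ← wedge_reflection c, ← hy₂, reflection_mulVec_mulVec]
  have hDn : evansNum f c u um up h N lam =
      -(r + p) * (a' * A' - b' * B') + (r - p) * (a' * B' - b' * A') := by
    have e1 : magnus (coeff f c u lam) (-(N * h)) h (leftSolution f c u um lam (-(N * h))) N =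
        eigenVec c p a' b' := hn₁
    have e2 : magnus (coeff f c u lam) (N * h) (-h) (rightSolution f c u up lam (N * h)) N =
        reflection *ᵥ eigenVec (-c) r A' B' := by
      rw [← hn₂]
      exact magnus_neg_step c (phi f u) lam (N * h) h _ N
    rw [evansNum, e1, e2, wedge_reflection]
  have e₁ := E₁ h N hh hhh₀
  have e₂ := E₂ h N hh hhh₀
  have eG := EG h N hh hhh₀
  obtain ⟨I₁, hI₁⟩ : ∃ I, I = ∫ x in Iic 0, deriv (fun x => phi f u x - deriv f um) x ^ 2 :=
    ⟨_, rfl⟩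
  obtain ⟨I₂, hI₂⟩ : ∃ I, I = ∫ x in Iic 0, deriv (fun x => phi f u (-x) - deriv f up) x ^ 2 :=
    ⟨_, rfl⟩
  have hhsq : h ^ 2 ≤ h₀ ^ 2 := by gcongr
  have four : ∀ D : ℝ, 0 ≤ D → D * h ^ 4 ≤ D * h₀ ^ 2 * h ^ 2 := by
    intro D hD
    rw [show D * h ^ 4 = D * h ^ 2 * h ^ 2 by ring]
    gcongr
  have S₁ := F₁.sideEstimate (Λ := Λ) hC₁ (by linarith) hΛ2 hh ht0 (norm_pos_iff.1 hpn)
    (mul_le _ p2) (inv_le _ hpn p1)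
    (e₁.trans ((four _ hD₁).trans (by gcongr; linarith)))
  have S₂ := F₂.sideEstimate (Λ := Λ) hC₂ (by linarith) hΛ2 hh ht0 (norm_pos_iff.1 hrn)
    (mul_le _ r2) (inv_le _ hrn r1)
    (e₂.trans ((four _ hD₂).trans (by gcongr; linarith)))
  rw [(integrable_and_integral_deriv_sq hm hp).2, ← hI₁, ← hI₂]
  rw [← hI₁] at S₁
  rw [← hI₂] at S₂
  obtain ⟨e, he⟩ : ∃ e, e = h ^ 6 + h ^ 4 * Real.exp (-β * (N * h)) := ⟨_, rfl⟩
  have he0 : 0 ≤ e := by rw [he]; positivity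
  have heΛ : e ≤ Λ * h ^ 2 := by
    have h3 := exp_neg_mul_nat_le_one hβ hh N
    calc e ≤ h₀ ^ 2 * (h₀ ^ 2 * h ^ 2) + h₀ ^ 2 * h ^ 2 * 1 := by
          rw [he, show h ^ 6 = h ^ 2 * (h ^ 2 * h ^ 2) by ring,
            show h ^ 4 = h ^ 2 * h ^ 2 by ring]
          gcongr
      _ = (h₀ ^ 2 + 1) * h₀ ^ 2 * h ^ 2 := by ring
      _ ≤ _ := by gcongr; linarith
  have hpr : ‖r - p‖ ≤ Λ * t := by
    have h1 := norm_sub_le_of_sq_sub (p := p) (r := r) (k := z₂ - z₁)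
      (by rw [hpsq, hrsq, hz₁, hz₂]; ring) hσ (norm_pos_iff.1 hpn) hpre hrre
    calc _ ≤ ‖z₂ - z₁‖ / σ * (2 * t) := h1.trans (by gcongr; exact inv_le _ hpn p1)
      _ = ‖z₂ - z₁‖ / σ * 2 * t := by ring
      _ ≤ _ := by gcongr; linarith
  have main := norm_wedge_error_le S₁ S₂ (by linarith) ht0 (by linarith) (he ▸ he0) (he ▸ heΛ)
    (by linarith) hpr
  rw [← hD, ← hDn, ← he] at main
  rw [← he] at eG
  rw [evansError, ← hs]
  obtain ⟨J₁, hJ₁⟩ : ∃ J, J = halfGaussError (fun x => phi f u x - deriv f um) h N := ⟨_, rfl⟩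
  obtain ⟨J₂, hJ₂⟩ : ∃ J, J = halfGaussError (fun x => phi f u (-x) - deriv f up) h N :=
    ⟨_, rfl⟩
  rw [← hJ₁, ← hJ₂] at main eG
  -- The quadrature errors must be kept together: each of `J₁`, `J₂` may be of order `h⁴`, and only
  -- their sum is within the error.
  have split : evansNum f c u um up h N lam - evans f c u um up lam -
      ((-(1 / 144) * h ^ 4 * (I₁ + I₂) : ℝ) : ℂ) =
      (evansNum f c u um up h N lam - evans f c u um up lam +
        2 * (((h ^ 4 / 288 * I₁ - J₁ / 2 : ℝ) : ℂ) + ((h ^ 4 / 288 * I₂ - J₂ / 2 : ℝ) : ℂ))) +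
      ((J₁ + J₂ : ℝ) : ℂ) := by
    push_cast
    ring
  rw [split]
  have hJ : ‖((J₁ + J₂ : ℝ) : ℂ)‖ ≤ G * e := by rwa [Complex.norm_real, Real.norm_eq_abs]
  refine (norm_add_le_of_le main hJ).trans ?_
  rw [add_assoc (h ^ 2 / s), ← he, div_eq_mul_inv, ← ht, add_mul, mul_add G]
  have : 0 ≤ G * (h ^ 2 * t) := by positivity
  linarith

/-- A quantity with leading term of order `h⁴` that is uniform in `λ` does not decay. -/
lemma exists_lower_bound {E : ℝ → ℕ → ℂ → ℂ} {S : ℂ → Prop} {I b C M : ℝ} (hI : 0 < I)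
    (hb : 0 < b)
    (hE : ∀ (h : ℝ) (N : ℕ) (lam : ℂ), 0 < h → h ≤ 1 → M ≤ h * √‖lam‖ → S lam →
      ‖E h N lam - ((-(1 / 144) * h ^ 4 * I : ℝ) : ℂ)‖ ≤
        C * (h ^ 2 / √‖lam‖ + h ^ 6 + h ^ 4 * Real.exp (-b * (N * h)))) :
    ∃ h₁ L₁ : ℝ, 0 < h₁ ∧ ∀ h : ℝ, 0 < h → h ≤ h₁ → ∃ R : ℝ, ∀ (N : ℕ) (lam : ℂ),
      L₁ ≤ N * h → R ≤ ‖lam‖ → S lam → I / 288 * h ^ 4 ≤ ‖E h N lam‖ := by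
  obtain ⟨D, hD⟩ : ∃ D, D = |C| + 1 := ⟨_, rfl⟩
  have hD0 : 0 < D := by rw [hD]; positivity
  obtain ⟨η, hη⟩ : ∃ η, η = I / (864 * D) := ⟨_, rfl⟩
  have hη0 : 0 < η := by rw [hη]; positivity
  have hηD : D * η = I / 864 := by
    rw [hη]; field_simp
  -- These choices make each of the three remainder terms at most `η h⁴`. As `D η = I/864`, together
  -- they consume half of the leading term `I h⁴/144`.
  refine ⟨min 1 (√η), -Real.log η / b, lt_min one_pos (Real.sqrt_pos.2 hη0),
    fun h hh hh₁ => ⟨(1 / (η * h ^ 2) + |M| / h) ^ 2, fun N lam hN hR hS => ?_⟩⟩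
  have hsq : h ^ 2 ≤ η := by
    have h1 : h ^ 2 ≤ √η ^ 2 := by
      gcongr
      exact hh₁.trans (min_le_right _ _)
    rwa [Real.sq_sqrt hη0.le] at h1
  have hs : 1 / (η * h ^ 2) + |M| / h ≤ √‖lam‖ := Real.le_sqrt_of_sq_le hR
  have q1 : 0 < 1 / (η * h ^ 2) := by positivity
  have q2 : 0 ≤ |M| / h := by positivity
  have hs0 : 0 < √‖lam‖ := by linarith
  have hM : M ≤ h * √‖lam‖ := by
    have h1 : |M| / h ≤ √‖lam‖ := by linarith
    rw [div_le_iff₀ hh] at h1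
    linarith [le_abs_self M]
  have t1 : h ^ 2 / √‖lam‖ ≤ η * h ^ 4 := by
    have h1 : 1 / (η * h ^ 2) ≤ √‖lam‖ := by linarith
    rw [div_le_iff₀ (by positivity)] at h1
    rw [div_le_iff₀ hs0]
    calc h ^ 2 = h ^ 2 * 1 := (mul_one _).symm
      _ ≤ h ^ 2 * (√‖lam‖ * (η * h ^ 2)) := by gcongr
      _ = _ := by ring
  have t2 : h ^ 6 ≤ η * h ^ 4 := by
    calc h ^ 6 = h ^ 2 * h ^ 4 := by ring
      _ ≤ _ := by gcongr
  have t3 : h ^ 4 * Real.exp (-b * (N * h)) ≤ η * h ^ 4 := by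
    rw [mul_comm]
    gcongr
    rw [← Real.exp_log hη0]
    gcongr
    rw [div_le_iff₀ hb] at hN
    linarith
  have key := hE h N lam hh (hh₁.trans (min_le_left _ _)) hM hS
  have h4 : 0 < h ^ 4 := by positivity
  have hT : C * (h ^ 2 / √‖lam‖ + h ^ 6 + h ^ 4 * Real.exp (-b * (N * h))) ≤
      I / 288 * h ^ 4 := by
    have hT0 : 0 ≤ h ^ 2 / √‖lam‖ + h ^ 6 + h ^ 4 * Real.exp (-b * (N * h)) := by positivity
    calc _ ≤ D * (h ^ 2 / √‖lam‖ + h ^ 6 + h ^ 4 * Real.exp (-b * (N * h))) := by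
          gcongr
          rw [hD]
          linarith [le_abs_self C]
      _ ≤ D * (η * h ^ 4 + η * h ^ 4 + η * h ^ 4) := by gcongr
      _ = 3 * (D * η) * h ^ 4 := by ring
      _ = _ := by rw [hηD]; ring
  have low : ‖((-(1 / 144) * h ^ 4 * I : ℝ) : ℂ)‖ = I / 144 * h ^ 4 := by
    rw [Complex.norm_real, Real.norm_eq_abs, show -(1 / 144) * h ^ 4 * I = -(I / 144 * h ^ 4) by ring,
      abs_neg, abs_of_pos (by positivity)]
  have tri := norm_sub_norm_le ((-(1 / 144) * h ^ 4 * I : ℝ) : ℂ)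
    (((-(1 / 144) * h ^ 4 * I : ℝ) : ℂ) - E h N lam)
  rw [sub_sub_cancel, low, norm_sub_rev] at tri
  linarith

lemma integral_sq_pos {F : ℝ → ℝ} (hF : Continuous F)
    (hi : MeasureTheory.Integrable fun x => F x ^ 2) (h : ∃ x, F x ≠ 0) : 0 < ∫ x, F x ^ 2 := by
  rw [MeasureTheory.integral_pos_iff_support_of_nonneg (fun x => sq_nonneg _) hi]
  have hc : Continuous fun x => F x ^ 2 := hF.pow 2
  obtain ⟨x, hx⟩ := h
  exact (hc.isOpen_support).measure_pos _ ⟨x, pow_ne_zero 2 hx⟩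

end Evans

end EvansMagnus

theorem mainTheorem3 (f : ℝ → ℝ) (c : ℝ) (u : ℝ → ℝ) (um up : ℝ)
    (hf : ContDiff ℝ ∞ f) (hu : EvansMagnus.IsTravellingWave f c u um up)
    (hφ : EvansMagnus.HasExponentialTails f u um up) :
    MeasureTheory.Integrable (fun x => deriv (EvansMagnus.phi f u) x ^ 2) ∧
    ∃ b : ℝ, 0 < b ∧
      -- the Gauss quadrature error is negligible for large `L = N h`
      (∀ h₀ : ℝ, 0 < h₀ → ∃ C : ℝ, ∀ (h : ℝ) (N : ℕ), 0 < h → h ≤ h₀ →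
        |EvansMagnus.gaussError (EvansMagnus.phi f u) h N| ≤
          C * (h ^ 6 + h ^ 4 * Real.exp (-b * (N * h)))) ∧
      -- the error in the Evans function
      (∀ ε h₀ : ℝ, 0 < ε → 0 < h₀ → ∃ C M : ℝ, 0 < M ∧
        ∀ (h : ℝ) (N : ℕ) (lam : ℂ), 0 < h → h ≤ h₀ → M ≤ h * √‖lam‖ →
          EvansMagnus.InSector f c um up ε lam →
          ‖EvansMagnus.evansError f c u um up h N lam -
              ((-(1 / 144) * h ^ 4 * ∫ x, deriv (EvansMagnus.phi f u) x ^ 2 : ℝ) : ℂ)‖ ≤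
            C * (h ^ 2 / √‖lam‖ + h ^ 6 + h ^ 4 * Real.exp (-b * (N * h)))) ∧
      -- the error does not decay as `|λ| → ∞`
      ((∃ x, deriv (EvansMagnus.phi f u) x ≠ 0) → ∃ δ : ℝ, 0 < δ ∧
        ∀ ε : ℝ, 0 < ε → ∃ h₁ L₁ : ℝ, 0 < h₁ ∧ ∀ h : ℝ, 0 < h → h ≤ h₁ → ∃ R : ℝ,
          ∀ (N : ℕ) (lam : ℂ), L₁ ≤ N * h → R ≤ ‖lam‖ →
            EvansMagnus.InSector f c um up ε lam →
            δ * h ^ 4 ≤ ‖EvansMagnus.evansError f c u um up h N lam‖) := by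
  obtain ⟨K, β, hm, hp⟩ := hu.exists_expDecay hf hφ
  obtain ⟨hint, -⟩ := EvansMagnus.integrable_and_integral_deriv_sq hm hp
  have hsm := (hu.hasBoundedDerivs_phi hf).contDiff
  refine ⟨hint, β, hm.rate_pos, fun h₀ _ => ?_, fun ε h₀ hε hh₀ => ?_, fun hne => ?_⟩
  · obtain ⟨C, -, hC⟩ := EvansMagnus.exists_abs_gaussError_le hm hp h₀
    refine ⟨C, fun h N hh hhh₀ => ?_⟩
    have h1 := hC h N hh hhh₀
    rwa [EvansMagnus.halfGaussError_sub_const hsm.continuous,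
      EvansMagnus.halfGaussError_sub_const (φ := fun x => EvansMagnus.phi f u (-x))
        (hsm.continuous.comp continuous_neg),
      ← EvansMagnus.gaussError_eq hsm.continuous] at h1
  · exact EvansMagnus.exists_norm_evansError_le hm hp hε hh₀
  · have hI := EvansMagnus.integral_sq_pos (contDiff_infty_iff_deriv.1 hsm).2.continuous hint hne
    -- Half the leading coefficient, fixed before `ε`; only the constants `C` and `M` depend on the
    -- sector.
    refine ⟨(∫ x, deriv (EvansMagnus.phi f u) x ^ 2) / 288, by positivity, fun ε hε => ?_⟩
    obtain ⟨C, M, -, hE⟩ := EvansMagnus.exists_norm_evansError_le hm hp hε one_pos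
    exact EvansMagnus.exists_lower_bound hI hm.rate_pos hE
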